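/- **Notation.** A partition is a weakly decreasing sequence $\lambda=(\lambda_1\ge\lambda_2\ge\cdots\ge 0)$ with finitely many nonzero parts; $\ell(\lambda)$ is the number of nonzero parts, $|\lambda|$ the sum of the parts, $\lambda'$ the conjugate, and the rank is the largest $k$ with $\lambda_k\ge k$ (or $0$). A partition of rank $r$ is *orthogonal* if $\lambda_i-i=(\lambda'_i-i)+1$ for $1\le i\le r$, i.e. $\lambda=(\alpha+1\mid\alpha)$ in Frobenius coordinates. If $\ell(\lambda)+\ell(\mu)\le m$, then $(\lambda,-\mu)_m$ is the partition with $m$ parts $\mu_1+(\lambda,0,\dots,0,-\operatorname{rev}\mu)$. Fix integers $T,m\ge1$ with $T\mid m$ and a partition $\lambda$ with $\ell(\lambda)\le m$. Put $\beta_i=\lambda_i+m-i$ ($1\le i\le m$), and let $n_i(\lambda)$ be the number of the $\beta_j$ congruent to $i$ mod $T$. The partition with beta-set $b_1>\dots>b_k\geq 0$ is $(b_j-k+j)_{1\le j\le k}$. The $T$-core of $\lambda$ is the partition with beta-set $\{Tj+i: 0\le i<T,\ 0\le j<n_i(\lambda)\}$. The component $\lambda^{(i)}$ ($0\le i<T$)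 of the $T$-quotient is the partition with beta-set $\{c: Tc+i\in\{\beta_1,\dots,\beta_m\}\}$. Let $\sigma_\lambda\in S_m$ be the permutation such that $\beta_{\sigma_\lambda(1)},\dots,\beta_{\sigma_\lambda(m)}$ lists the $\beta_j$ that are $\equiv 0$ mod $T$ in decreasing order, then those $\equiv 1$ in decreasing order, and so on. Let $h_k$ be the complete homogeneous symmetric polynomial ($h_k=0$ for $k<0$). For a $k$-tuple $Y$ of nonzero elements of a field, with $\overline Y$ the tuple of inverses, and a partition $\lambda$ with $\ell(\lambda)\le k$, put $$s_\lambda(Y)=\det\big(h_{\lambda_i-i+j}(Y)\big)_{i,j=1}^{k},$$ $$\mathrm{o}^{\mathrm{even}}_\lambda(Y)=\det\big(h_{\lambda_i-i+j}(Y,\overline Y)-h_{\lambda_i-i-j}(Y,\overline Y)\big)_{i,j=1}^{k},\qquad \mathrm{o}^{\mathrm{odd}}_\lambda(Y)=\det\big(h_{\lambda_i-i+j}(Y,\overline Y,1)-h_{\lambda_i-i-j}(Y,\overline Y,1)\big)_{i,j=1}^{k}.$$ **Theorem.** Let $t$ be a positive multiple of $4$, $n\ge 0$ an integer, $\omega\in\mathbb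 C$ a primitive $t$-th root of unity, $X=(x_1,\dots,x_n)$ indeterminates, $X^k=(x_1^k,\dots,x_n^k)$, and $$X_\omega=(\omega X,\omega^3X,\dots,\omega^{t-1}X,\ \omega,\omega^3,\dots,\omega^{t/2-1}),$$ a tuple of length $tn/2+t/4$ over $\mathbb C(x_1,\dots,x_n)$. Let $\lambda$ be a partition with $\ell(\lambda)\le tn/2+t/4$, and take its core, quotient, $n_i(\lambda)$ and $\sigma_\lambda$ with $T=t/2$ and $m=tn+t/2$. Then $\mathrm{o}^{\mathrm{even}}_\lambda(X_\omega)\neq0$ if and only if the $(t/2)$-core of $\lambda$ is orthogonal. In that case $\ell(\lambda^{(0)})\le n$, $\ell(\lambda^{(t/4)})\le n+1$, $\ell(\lambda^{(i)})+\ell(\lambda^{(t/2-i)})\le 2n+1$ for $1\le i\le t/4-1$ (so all terms below are defined), and $$\mathrm{o}^{\mathrm{even}}_\lambda(X_\omega)=(-1)^{\epsilon}\,\operatorname{sgn}(\sigma_\lambda)\;\mathrm{o}^{\mathrm{odd}}_{\lambda^{(0)}}(X^{t/2})\;\mathrm{o}^{\mathrm{even}}_{\lambda^{(t/4)}}(-X^{t/2},-1)\prod_{i=1}^{t/4-1}s_{(\lambda^{(i)},-\lambda^{(t/2-i)})_{2n+1}}(X^{t/2},\overline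 X^{t/2},1),$$ $$\epsilon=\sum_{i=t/4+1}^{t/2-1}\binom{n_i(\lambda)+1}{2}+(n+1)+|\lambda^{(0)}|+\sum_{i=1}^{t/4-1}\big(|\lambda^{(i)}|+|\lambda^{(t/2-i)}|\big).$$ -/

import Mathlib

namespace TwistedChar

/-! ### Partitions

A partition is the sequence `p 0 ≥ p 1 ≥ p 2 ≥ ...` of its parts, eventually zero. The parts are
indexed from `0`, so `p i` is the part with the usual number `i + 1`. -/

/-- `p` is weakly decreasing with finitely many nonzero parts. -/
def IsPartition (p : ℕ → ℕ) : Prop :=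
  Antitone p ∧ {i | p i ≠ 0}.Finite

/-- The number of nonzero parts. -/
noncomputable def length (p : ℕ → ℕ) : ℕ :=
  {i | p i ≠ 0}.ncard

/-- The size `|p|`, the sum of the parts. -/
noncomputable def size (p : ℕ → ℕ) : ℕ :=
  ∑ᶠ i, p i

/-- The conjugate partition: the part number `j + 1` counts the parts of `p` that are `≥ j + 1`. -/
noncomputable def conj (p : ℕ → ℕ) (j : ℕ) : ℕ :=
  {i | j + 1 ≤ p i}.ncard

/-- The Frobenius rank: the largest `k ≥ 1` such that the part number `k` is at least `k`,
and `0` if there is none. -/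
noncomputable def rank (p : ℕ → ℕ) : ℕ :=
  sSup {k | 1 ≤ k ∧ k ≤ p (k - 1)}

/-- The first half of the Frobenius coordinates; meaningful for `i < rank p`. -/
def arm (p : ℕ → ℕ) (i : ℕ) : ℕ :=
  p i - (i + 1)

/-- The second half of the Frobenius coordinates; meaningful for `i < rank p`. -/
noncomputable def leg (p : ℕ → ℕ) (i : ℕ) : ℕ :=
  conj p i - (i + 1)

/-- `p = (α + 1 ∣ α)` in Frobenius coordinates. (Both halves are automatically strict.) -/
def IsOrthogonal (p : ℕ → ℕ) : Prop :=
  ∀ i < rank p, arm p i = leg p i + 1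

/-- The partition `(p, -q)_n = q₁ + (p, 0, ..., 0, -rev q)` with `n` parts, for
`length p + length q ≤ n`: then `p i` and `q (n - 1 - i)` are never both nonzero. -/
def glue (p q : ℕ → ℕ) (n : ℕ) (i : ℕ) : ℕ :=
  if i < n then q 0 + p i - q (n - 1 - i) else 0

/-! ### Beta-sets, cores and quotients -/

/-- The entry number `i + 1` of the beta-set of `p` with `m` entries. -/
def beta (p : ℕ → ℕ) (m : ℕ) (i : Fin m) : ℕ :=
  p i + (m - 1 - i)

/-- The beta-set of `p` with `m` entries, as a set. -/
def betaSet (p : ℕ → ℕ) (m : ℕ) : Finset ℕ :=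
  Finset.univ.image (beta p m)

/-- The entries of the beta-set that are congruent to `i` modulo `t`. -/
def betaClass (t : ℕ) (p : ℕ → ℕ) (m i : ℕ) : Finset ℕ :=
  (betaSet p m).filter (fun b => b % t = i)

/-- `n_i(p, m)`: the number of entries of the beta-set congruent to `i` modulo `t`. -/
def classCount (t : ℕ) (p : ℕ → ℕ) (m i : ℕ) : ℕ :=
  (betaClass t p m i).card

/-- The partition with beta-set `B`: if `b₀ > b₁ > ... > b_{k-1}` are the elements of `B`, then
its parts are `b_i - (k - 1 - i)`. -/
def ofBetaSet (B : Finset ℕ) (i : ℕ) : ℕ :=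
  if h : i < B.card then B.orderEmbOfFin rfl (Fin.rev ⟨i, h⟩) - (B.card - 1 - i) else 0

/-- The `t`-core of `p`, computed from the beta-set with `m` entries: the partition with beta-set
`{t j + i : 0 ≤ i < t, 0 ≤ j < n_i(p, m)}`. -/
def core (t : ℕ) (p : ℕ → ℕ) (m : ℕ) : ℕ → ℕ :=
  ofBetaSet ((Finset.range t).biUnion fun i =>
    (Finset.range (classCount t p m i)).image fun j => t * j + i)

/-- The component number `i` (for `0 ≤ i < t`) of the `t`-quotient of `p`, computed from the
beta-set with `m` entries: the partition with beta-set `{c : t c + i ∈ betaSet p m}`. -/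
def quo (t : ℕ) (p : ℕ → ℕ) (m i : ℕ) : ℕ → ℕ :=
  ofBetaSet ((betaClass t p m i).image fun b => b / t)

/-- The permutation `σ` such that `beta p m (σ 0), beta p m (σ 1), ...` lists first the entries
congruent to `0` modulo `t` in decreasing order, then those congruent to `1`, and so on. -/
def sigma (t : ℕ) (p : ℕ → ℕ) (m : ℕ) : Equiv.Perm (Fin m) :=
  Tuple.sort fun i : Fin m =>
    (toLex (beta p m i % t, OrderDual.toDual (beta p m i)) : ℕ ×ₗ ℕᵒᵈ)

/-- The sign of `sigma`. -/
def sgn (t : ℕ) (p : ℕ → ℕ) (m : ℕ) : ℤ :=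
  (Equiv.Perm.sign (sigma t p m) : ℤˣ)

/-! ### Characters

The characters are evaluated at a finite family `Y : ι → K` of elements of a field. Their size is
the number of entries of `Y`; they are symmetric, so the order of the entries does not matter. -/

section Characters

variable {K ι : Type*} [Field K] [Fintype ι] [DecidableEq ι]

/-- The complete homogeneous symmetric polynomial of degree `m` evaluated at `Y`, zero if `m` is
negative. -/
noncomputable def h (Y : ι → K) (m : ℤ) : K :=
  if m < 0 then 0 else MvPolynomial.aeval Y (MvPolynomial.hsymm ι ℤ m.toNat)

/-- The family `(Y, Y⁻¹)`. -/
def double (Y : ι → K) : ι ⊕ ι → K :=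
  Sum.elim Y fun i => (Y i)⁻¹

/-- The family `(Y, y)`. -/
def snoc (Y : ι → K) (y : K) : ι ⊕ Unit → K :=
  Sum.elim Y fun _ => y

/-- The Schur polynomial of `p` at `Y`. -/
noncomputable def schur (p : ℕ → ℕ) (Y : ι → K) : K :=
  Matrix.det (Matrix.of fun i j : Fin (Fintype.card ι) => h Y ((p i : ℤ) - i + j))

/-- The odd orthogonal character of `p` at `Y`. With rows and columns numbered from `1` the entries
are `h_{p_i - i + j} - h_{p_i - i - j}` in the variables `(Y, Y⁻¹, 1)`. -/
noncomputable def oddOrth (p : ℕ → ℕ) (Y : ι → K) : K :=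
  Matrix.det (Matrix.of fun i j : Fin (Fintype.card ι) =>
    h (snoc (double Y) 1) ((p i : ℤ) - (i + 1) + (j + 1)) -
      h (snoc (double Y) 1) ((p i : ℤ) - (i + 1) - (j + 1)))

/-- The even orthogonal character of `p` at `Y`. With rows and columns numbered from `1` the entries
are `h_{p_i - i + j} - h_{p_i - i - j}` in the variables `(Y, Y⁻¹)`. -/
noncomputable def evenOrth (p : ℕ → ℕ) (Y : ι → K) : K :=
  Matrix.det (Matrix.of fun i j : Fin (Fintype.card ι) =>
    h (double Y) ((p i : ℤ) - (i + 1) + (j + 1)) -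
      h (double Y) ((p i : ℤ) - (i + 1) - (j + 1)))

end Characters

/-! ### The specialization -/

/-- The field `ℂ(x₁, ..., x_n)` of rational functions. -/
abbrev RatFun (n : ℕ) : Type :=
  FractionRing (MvPolynomial (Fin n) ℂ)

/-- The indeterminate `x_{i+1}`. -/
noncomputable def x {n : ℕ} (i : Fin n) : RatFun n :=
  algebraMap (MvPolynomial (Fin n) ℂ) (RatFun n) (MvPolynomial.X i)

/-- The constant `c`. -/
noncomputable def const (n : ℕ) (c : ℂ) : RatFun n :=
  algebraMap (MvPolynomial (Fin n) ℂ) (RatFun n) (MvPolynomial.C c)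

/-- `X_ω = (ω X, ω³ X, ..., ω^{t-1} X, ω, ω³, ..., ω^{t/2-1})`. -/
noncomputable def Xω (t n : ℕ) (ω : ℂ) : (Fin (t / 2) × Fin n) ⊕ Fin (t / 4) → RatFun n :=
  Sum.elim (fun ki => const n ω ^ (2 * (ki.1 : ℕ) + 1) * x ki.2)
    (fun k => const n ω ^ (2 * (k : ℕ) + 1))

/-- `X^k = (x₁^k, ..., x_n^k)`. -/
noncomputable def Xpow (n k : ℕ) (i : Fin n) : RatFun n :=
  x i ^ k

end TwistedChar

open TwistedChar

/-!
The characters are Jacobi-Trudi determinants in the complete homogeneous functions of the variables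
and their inverses, possibly with `1`. Write `t = 4 s`. Multiplying `x` by all odd powers of `ω`
turns `1 - x z` into `1 + (x z) ^ (2 s)`, so the complete homogeneous functions `h_k` of `X_ω` and
its inverses vanish unless `2 s ∣ k`, and then equal, up to a sign, `h_{k / 2 s}` of
`W = (X ^ (2 s), X ^ (-2 s), 1)` (`h_double_twist`). Hence the entry of the Jacobi-Trudi matrix in
the row of a beta-set entry `b` and in the column `j` vanishes unless `b ≡ ± j` modulo `2 s`. The
matrix is block diagonal after a permutation of its rows and columns, with a block for the class
`0`, a block for each pair of opposite classes, and a block for the class `s`.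

The blocks can be square only if the class counts of the beta-set are `2 n + 1` for the classes `0`
and `s` and sum to `2 (2 n + 1)` for opposite classes (`balanced_of_det_ne_zero`), and this says
that the core is orthogonal (`isOrthogonal_core_iff`), because a partition with beta-set `B` is
orthogonal exactly when the cardinality of `B` is not in `B` and the reflection in it exchanges `B`,
enlarged by the negative integers, and its complement (`isOrthogonal_ofBetaSet_iff`).

In that case the determinant is the product of the determinants of the blocks
(`det_jacobiMatrix`). The block of the class `0` is the Jacobi-Trudi matrix of an odd orthogonal
character up to signs (`det_block_zero`), and that of the class `s` is obtained from the one of an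
even orthogonal character by column operations that remove the variable `-1` (`det_block_half`).
The block of a pair of opposite classes mixes two kinds of rows. Multiplied by the matrix of
coefficients of the polynomials `∏_{i ≠ q} (1 - Wᵢ z)` it becomes an alternant, with exponents of
both signs, and as the product of the entries of `W` is `1`, this is also the alternant of the
glued partition (`det_mixed`). The same multiplication exhibits the determinant of each block as
a factor of an alternant. The alternants do not vanish, since the specialization `xᵢ ↦ 4 ^ i` turns
them into nonzero multiples of Vandermonde determinants with distinct nodes.

It remains to compare two signs: that of the permutation of rows and columns into blocks, and that
of `sigma`. Both count inversions between linear orders on the beta-set, and three linear orders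
disagree pairwise an even number of times in total (`inversions_cocycle`). This reduces the
comparison to counting inversions between residue classes, and the result depends on the class
counts only (`inversions_parity`). The remaining constant is found at the empty partition, where all
characters are `1` (`sign_rows`).
-/

namespace TwistedChar

/-! ### Generating series of the complete homogeneous functions -/

section Series

variable {K : Type*} [Field K]

section

variable {ι : Type*} [Fintype ι]

open PowerSeries in
/-- The generating series `∏ᵢ (1 - Yᵢ z)` of the signed elementary symmetric functions of `Y`. -/
noncomputable def eser (Y : ι → K) : PowerSeries K := ∏ i, (1 - C (Y i) * X)

theorem eser_snoc (Y : ι → K) (y : K) :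
    eser (snoc Y y) = eser Y * (1 - PowerSeries.C y * PowerSeries.X) := by
  simp [eser, snoc]

theorem eser_double (Y : ι → K) : eser (double Y) = eser Y * eser (fun i => (Y i)⁻¹) := by
  simp [eser, double]

end

variable {ι κ : Type*} [Fintype ι] [DecidableEq ι] [Fintype κ] [DecidableEq κ]

/-- The generating series of the complete homogeneous symmetric functions of `Y`. -/
noncomputable def hser (Y : ι → K) : PowerSeries K := PowerSeries.mk fun k => h Y (k : ℤ)

theorem h_of_neg (Y : ι → K) {k : ℤ} (hk : k < 0) : h Y k = 0 := by simp [h, hk]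

theorem h_zero (Y : ι → K) : h Y 0 = 1 := by simp [h]

theorem h_natCast (Y : ι → K) (k : ℕ) :
    h Y (k : ℤ) = ∑ l ∈ Finset.finsuppAntidiag Finset.univ k, ∏ i, Y i ^ l i := by
  have hk : ¬ ((k : ℤ) < 0) := by omega
  simp only [h, hk, if_false, Int.toNat_natCast, MvPolynomial.hsymm, map_sum, map_multiset_prod,
    Multiset.map_map, Function.comp_def, MvPolynomial.aeval_X]
  rw [← Finset.sum_coe_sort (Finset.finsuppAntidiag Finset.univ k)]
  refine Fintype.sum_equiv ((Sym.equivNatSum ι k).trans (Equiv.subtypeEquivRight fun P => ?_)) _ _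
    fun s => ?_
  · rw [Finset.mem_finsuppAntidiag]; simp [Finsupp.sum_fintype]
  · rw [Finset.prod_multiset_map_count]
    rw [Finset.prod_subset (Finset.subset_univ _)]
    · rfl
    · intro i _ hi
      rw [Multiset.mem_toFinset] at hi
      rw [Multiset.count_eq_zero_of_notMem hi, pow_zero]

theorem hser_mul_eser (Y : ι → K) : hser Y * eser Y = 1 := by
  have hgeom (y : K) :
      PowerSeries.mk (fun k => y ^ k) * (1 - PowerSeries.C y * PowerSeries.X) = 1 := by
    ext k
    rw [mul_sub, mul_one, map_sub, ← mul_assoc]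
    cases k with
    | zero => simp
    | succ k =>
      rw [PowerSeries.coeff_succ_mul_X, mul_comm, PowerSeries.coeff_C_mul]
      simp [PowerSeries.coeff_one, pow_succ']
  have hprod : hser Y = ∏ i, PowerSeries.mk (fun k => Y i ^ k) := by
    ext k
    rw [PowerSeries.coeff_prod]
    simp [hser, h_natCast]
  rw [hprod, eser, ← Finset.prod_mul_distrib]
  simp [hgeom]

theorem eser_ne_zero (Y : ι → K) : eser Y ≠ 0 := fun h0 => by
  simpa [h0] using hser_mul_eser Y

theorem coeff_hser (Y : ι → K) (k : ℕ) : PowerSeries.coeff k (hser Y) = h Y k := by simp [hser]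

theorem h_congr {Y : ι → K} {Z : κ → K} (hYZ : eser Y = eser Z) (k : ℤ) : h Y k = h Z k := by
  rcases lt_or_ge k 0 with hk | hk
  · rw [h_of_neg _ hk, h_of_neg _ hk]
  · lift k to ℕ using hk
    rw [← coeff_hser, ← coeff_hser]
    congr 1
    apply mul_right_cancel₀ (eser_ne_zero Y)
    rw [hser_mul_eser, hYZ, hser_mul_eser]

/-- Removing the variable `y` from a complete homogeneous symmetric function. -/
theorem h_snoc_sub (Y : ι → K) (y : K) (k : ℤ) :
    h (snoc Y y) k - y * h (snoc Y y) (k - 1) = h Y k := by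
  rcases lt_or_ge k 0 with hk | hk
  · rw [h_of_neg _ hk, h_of_neg _ hk, h_of_neg _ (by omega)]; simp
  · have hs : hser (snoc Y y) * (1 - PowerSeries.C y * PowerSeries.X) = hser Y := by
      apply mul_right_cancel₀ (eser_ne_zero Y)
      rw [hser_mul_eser, mul_assoc, mul_comm _ (eser Y), ← eser_snoc, hser_mul_eser]
    lift k to ℕ using hk
    rw [← coeff_hser Y, ← hs, mul_sub, mul_one, map_sub, coeff_hser, ← mul_assoc]
    cases k with
    | zero => simp [h_of_neg]
    | succ k =>
      rw [PowerSeries.coeff_succ_mul_X, mul_comm, PowerSeries.coeff_mul_C, mul_comm]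
      simp [coeff_hser, mul_comm]

theorem h_neg_family (Y : ι → K) (k : ℤ) : h (fun i => -Y i) k = (-1) ^ k * h Y k := by
  rcases lt_or_ge k 0 with hk | hk
  · rw [h_of_neg _ hk, h_of_neg _ hk, mul_zero]
  · lift k to ℕ using hk
    rw [h_natCast, h_natCast, Finset.mul_sum]
    refine Finset.sum_congr rfl fun l hl => ?_
    rw [Finset.mem_finsuppAntidiag] at hl
    have h1 : ∀ i, (-Y i) ^ l i = (-1) ^ l i * Y i ^ l i := fun i => neg_pow _ _
    simp only [h1, Finset.prod_mul_distrib, Finset.prod_pow_eq_pow_sum]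
    rw [hl.1, zpow_natCast]

/-- If `∏ᵢ (1 - Yᵢ z)` is obtained from `∏ⱼ (1 - Zⱼ z)` by `z ↦ z ^ T`, then `h_k(Y)` vanishes
unless `T ∣ k`, and is `h_{k / T}(Z)` in that case. -/
theorem h_of_expand {Y : ι → K} {Z : κ → K} {T : ℕ} (hT : T ≠ 0)
    (hYZ : eser Y = PowerSeries.expand T hT (eser Z)) (k : ℤ) :
    h Y k = if (T : ℤ) ∣ k then h Z (k / T) else 0 := by
  rcases lt_or_ge k 0 with hk | hk
  · rw [h_of_neg _ hk, h_of_neg _ (Int.ediv_neg_of_neg_of_pos hk (by omega)), ite_self]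
  · have hs : hser Y = PowerSeries.expand T hT (hser Z) := by
      apply mul_right_cancel₀ (eser_ne_zero Y)
      rw [hser_mul_eser, hYZ, ← map_mul, hser_mul_eser, map_one]
    lift k to ℕ using hk
    rw [← coeff_hser, hs]
    split_ifs with hd
    · obtain ⟨j, hj⟩ := Int.natCast_dvd_natCast.mp hd
      subst hj
      rw [PowerSeries.coeff_expand_mul, coeff_hser]
      congr 1
      push_cast
      rw [Int.mul_ediv_cancel_left _ (by exact_mod_cast hT)]
    · exact PowerSeries.coeff_expand_of_not_dvd _ _ _ (fun h' => hd (by exact_mod_cast h'))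

/-- The polynomial `∏_{i ≠ q} (1 - Wᵢ z)`. -/
noncomputable def omitPoly (W : ι → K) (q : ι) : Polynomial K :=
  ∏ i ∈ Finset.univ.erase q, (1 - Polynomial.C (W i) * Polynomial.X)

theorem natDegree_omitPoly_lt (W : ι → K) (q : ι) :
    (omitPoly W q).natDegree < Fintype.card ι := by
  refine lt_of_le_of_lt (Polynomial.natDegree_prod_le _ _) ?_
  have : ∑ i ∈ Finset.univ.erase q,
      (1 - Polynomial.C (W i) * Polynomial.X : Polynomial K).natDegree ≤
      ∑ i ∈ Finset.univ.erase q, 1 := by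
    refine Finset.sum_le_sum fun i _ => ?_
    compute_degree
  refine lt_of_le_of_lt this ?_
  rw [Finset.sum_const, Finset.card_erase_of_mem (Finset.mem_univ _), Finset.card_univ]
  have := Fintype.card_pos_iff.mpr ⟨q⟩
  simp only [smul_eq_mul]; omega

/-- The determinantal formulas for characters rest on this inversion of the Jacobi-Trudi matrix:
`∏_{i ≠ q} (1 - Wᵢ z)` times the generating series of the `h_k(W)` is the geometric series of
ratio `W_q`. -/
theorem sum_omitPoly_mul_h (W : ι → K) (q : ι) (α : ℤ) :
    ∑ k ∈ Finset.range (Fintype.card ι), (omitPoly W q).coeff k * h W (α - k) =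
      if α < 0 then 0 else W q ^ α := by
  split_ifs with hα
  · refine Finset.sum_eq_zero fun k _ => ?_
    rw [h_of_neg _ (by omega), mul_zero]
  · push Not at hα
    lift α to ℕ using hα
    have hs : (omitPoly W q : PowerSeries K) * hser W = PowerSeries.mk (fun k => W q ^ k) := by
      apply mul_right_cancel₀ (eser_ne_zero W)
      rw [mul_assoc, hser_mul_eser, mul_one, eser,
        ← Finset.mul_prod_erase _ _ (Finset.mem_univ q), ← mul_assoc]
      have h1 : (omitPoly W q : PowerSeries K) =
          ∏ i ∈ Finset.univ.erase q, (1 - PowerSeries.C (W i) * PowerSeries.X) := by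
        rw [omitPoly]
        rw [← Polynomial.coeToPowerSeries.ringHom_apply, map_prod]
        simp
      have h2 : PowerSeries.mk (fun k => W q ^ k) *
          (1 - PowerSeries.C (W q) * PowerSeries.X) = 1 := by
        ext k
        rw [mul_sub, mul_one, map_sub, ← mul_assoc]
        cases k with
        | zero => simp
        | succ k =>
          rw [PowerSeries.coeff_succ_mul_X, mul_comm, PowerSeries.coeff_C_mul]
          simp [PowerSeries.coeff_one, pow_succ']
      rw [h2, one_mul, h1]
    have hc := congrArg (PowerSeries.coeff α) hs
    rw [PowerSeries.coeff_mul, PowerSeries.coeff_mk,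
      Finset.Nat.sum_antidiagonal_eq_sum_range_succ_mk] at hc
    rw [zpow_natCast, ← hc]
    simp only [Polynomial.coeff_coe, coeff_hser]
    have e1 : ∀ k : ℕ, k ∉ Finset.range (Fintype.card ι) →
        (omitPoly W q).coeff k * h W ((α : ℤ) - k) = 0 := fun k hk => by
      rw [Polynomial.coeff_eq_zero_of_natDegree_lt, zero_mul]
      exact lt_of_lt_of_le (natDegree_omitPoly_lt W q) (by simpa using hk)
    have e2 : ∀ k : ℕ, k ∉ Finset.range (α + 1) →
        (omitPoly W q).coeff k * h W ((α : ℤ) - k) = 0 := fun k hk => by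
      rw [Finset.mem_range] at hk
      rw [h_of_neg _ (by omega), mul_zero]
    have e3 : ∑ k ∈ Finset.range (α + 1), (omitPoly W q).coeff k * h W ((α - k : ℕ) : ℤ) =
        ∑ k ∈ Finset.range (α + 1), (omitPoly W q).coeff k * h W ((α : ℤ) - k) := by
      refine Finset.sum_congr rfl fun k hk => ?_
      rw [Finset.mem_range] at hk
      rw [Nat.cast_sub (by omega)]
    rw [e3]
    exact (Finset.sum_subset (Finset.subset_union_right (s₁ := Finset.range (α + 1)))
      (fun k _ hk => e1 k hk)).trans (Finset.sum_subset Finset.subset_union_left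
        (fun k _ hk => e2 k hk)).symm

end Series

/-! ### Jacobi-Trudi matrices for a self-reciprocal family -/

section SelfReciprocal

variable {K : Type*} [Field K] {n : ℕ}

/-- The family `(Y, Y⁻¹, 1)`. -/
def recip (Y : Fin n → K) : (Fin n ⊕ Fin n) ⊕ Unit → K := snoc (double Y) 1

/-- The involution of the index set of `recip Y` that inverts the entries. -/
def bar : (Fin n ⊕ Fin n) ⊕ Unit ≃ (Fin n ⊕ Fin n) ⊕ Unit :=
  (Equiv.sumComm (Fin n) (Fin n)).sumCongr (Equiv.refl Unit)

theorem card_recip : Fintype.card ((Fin n ⊕ Fin n) ⊕ Unit) = 2 * n + 1 := by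
  simp; omega

theorem recip_bar (Y : Fin n → K) (q) : recip Y (bar q) = (recip Y q)⁻¹ := by
  rcases q with (q | q) | q <;> simp [recip, bar, snoc, double]

theorem recip_ne_zero {Y : Fin n → K} (hY : ∀ i, Y i ≠ 0) (q) : recip Y q ≠ 0 := by
  rcases q with (q | q) | q <;> simp [recip, snoc, double, hY]

theorem prod_recip {Y : Fin n → K} (hY : ∀ i, Y i ≠ 0) : ∏ q, recip Y q = 1 := by
  have h1 : ∏ i, Y i ≠ 0 := Finset.prod_ne_zero_iff.mpr fun i _ => hY i
  simp [recip, snoc, double, h1]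

/-- The polynomials `omitPoly` of inverse entries are reciprocal to each other up to a factor,
which is the omitted entry as the product of all the entries is `1`. -/
theorem coeff_omitPoly_bar {Y : Fin n → K} (hY : ∀ i, Y i ≠ 0) (q) {k : ℕ} (hk : k ≤ 2 * n) :
    (omitPoly (recip Y) (bar q)).coeff k =
      recip Y q * (omitPoly (recip Y) q).coeff (2 * n - k) := by
  classical
  set W := recip Y with hW
  have hW0 : ∀ i, W i ≠ 0 := recip_ne_zero hY
  set s := Finset.univ.erase q with hs
  have hcard : s.card = 2 * n := by
    rw [hs, Finset.card_erase_of_mem (Finset.mem_univ _), Finset.card_univ, card_recip]; omega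
  have hbar : omitPoly W (bar q) =
      ∏ i ∈ s, (1 - Polynomial.C (W i)⁻¹ * Polynomial.X) := by
    rw [omitPoly]
    symm
    refine Finset.prod_bij (fun i _ => bar i) ?_ ?_ ?_ ?_
    · intro i hi; simpa [hs] using hi
    · intro i _ j _ hij; exact bar.injective hij
    · intro j hj
      refine ⟨bar.symm j, ?_, by simp⟩
      rw [hs, Finset.mem_erase] at *
      refine ⟨fun hc => hj.1 ?_, Finset.mem_univ _⟩
      rw [← hc]; simp
    · intro i _; rw [hW, recip_bar]
  have hrev1 : ∀ i, (1 - Polynomial.C (W i) * Polynomial.X : Polynomial K).natDegree = 1 := by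
    intro i
    have : (1 - Polynomial.C (W i) * Polynomial.X : Polynomial K) =
      Polynomial.C (-W i) * Polynomial.X + Polynomial.C 1 := by simp; ring
    rw [this, Polynomial.natDegree_linear (neg_ne_zero.mpr (hW0 i))]
  have hfac : ∀ i, (1 - Polynomial.C (W i)⁻¹ * Polynomial.X : Polynomial K) =
      Polynomial.C (-(W i)⁻¹) *
        (1 - Polynomial.C (W i) * Polynomial.X : Polynomial K).reverse := by
    intro i
    have h1 : (1 - Polynomial.C (W i) * Polynomial.X : Polynomial K).reverse =
        Polynomial.X - Polynomial.C (W i) := by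
      rw [Polynomial.reverse, hrev1, Polynomial.reflect_sub]
      congr 1
      · rw [← Polynomial.C_1, Polynomial.reflect_C]; simp
      · simp
    rw [h1, mul_sub, ← Polynomial.C_mul, neg_mul, inv_mul_cancel₀ (hW0 i)]
    simp; ring
  have hrevprod : ∀ u : Finset ((Fin n ⊕ Fin n) ⊕ Unit),
      ∏ i ∈ u, (1 - Polynomial.C (W i) * Polynomial.X : Polynomial K).reverse =
        (∏ i ∈ u, (1 - Polynomial.C (W i) * Polynomial.X : Polynomial K)).reverse := by
    intro u
    induction u using Finset.induction_on with
    | empty => simpa using (Polynomial.reverse_C (1 : K)).symm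
    | insert a u ha ih =>
      rw [Finset.prod_insert ha, Finset.prod_insert ha, ih, Polynomial.reverse_mul_of_domain]
  have hdeg : (omitPoly W q).natDegree = 2 * n := by
    rw [omitPoly, Polynomial.natDegree_prod _ _ (fun i _ hi => ?_)]
    · simp [hrev1, ← hs, hcard]
    · have := hrev1 i
      rw [hi] at this; simp at this
  have hconst : ∏ i ∈ s, (-(W i)⁻¹) = W q := by
    have h1 : ∀ i, -(W i)⁻¹ = (-1) * (W i)⁻¹ := fun i => by ring
    simp only [h1, Finset.prod_mul_distrib, Finset.prod_const, hcard, pow_mul]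
    rw [Finset.prod_inv_distrib]
    have h2 := prod_recip hY
    rw [← Finset.mul_prod_erase _ _ (Finset.mem_univ q)] at h2
    rw [← hW, ← hs] at h2
    have h3 : ∏ i ∈ s, W i ≠ 0 := Finset.prod_ne_zero_iff.mpr fun i _ => hW0 i
    simp only [neg_one_sq, one_pow, one_mul]
    exact (eq_inv_of_mul_eq_one_left h2).symm
  rw [hbar, Finset.prod_congr rfl fun i _ => hfac i, Finset.prod_mul_distrib, hrevprod,
    ← map_prod, hconst, Polynomial.coeff_C_mul, Polynomial.coeff_reverse]
  change W q * (omitPoly W q).coeff (Polynomial.revAt (omitPoly W q).natDegree k) = _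
  rw [hdeg, Polynomial.revAt_le hk]

/-- `sum_omitPoly_mul_h` for the inverse of an entry of `recip Y`. -/
theorem sum_omitPoly_reflect_mul_h {Y : Fin n → K} (hY : ∀ i, Y i ≠ 0) (q) (α : ℤ) :
    ∑ k ∈ Finset.range (2 * n + 1),
      (omitPoly (recip Y) q).coeff (2 * n - k) * h (recip Y) (α - k) =
      if α < 0 then 0 else recip Y q ^ (-1 - α) := by
  have h0 := recip_ne_zero hY q
  have h1 := sum_omitPoly_mul_h (recip Y) (bar q) α
  rw [card_recip, Finset.sum_congr rfl (fun k hk => by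
    rw [coeff_omitPoly_bar hY q (Nat.lt_succ_iff.mp (Finset.mem_range.mp hk)), mul_assoc]),
    ← Finset.mul_sum, recip_bar] at h1
  rw [eq_comm, ← inv_mul_eq_iff_eq_mul₀ h0] at h1
  rw [← h1]
  split_ifs
  · simp
  · rw [inv_zpow', sub_eq_add_neg, zpow_add₀ h0]; simp

/-- Pairing the terms of a sum around its middle term. -/
theorem sum_range_two_mul_add_one (f : ℕ → K) :
    ∑ k ∈ Finset.range (2 * n + 1), f k =
      f n + ∑ j ∈ Finset.range n, (f (n - 1 - j) + f (n + 1 + j)) := by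
  rw [show 2 * n + 1 = n + (n + 1) by ring, Finset.sum_range_add, Finset.sum_range_succ',
    Finset.sum_add_distrib, Finset.sum_range_reflect]
  simp only [add_zero, add_assoc, add_comm 1]
  ring

theorem sum_range_two_mul_add_two (f : ℕ → K) :
    ∑ k ∈ Finset.range (2 * n + 2), f k =
      ∑ j ∈ Finset.range (n + 1), (f (n - j) + f (n + 1 + j)) := by
  rw [show 2 * n + 2 = (n + 1) + (n + 1) by ring, Finset.sum_range_add,
    Finset.sum_add_distrib, ← Finset.sum_range_reflect f]
  simp

/-- The Jacobi-Trudi matrix of the odd orthogonal character, multiplied by a suitable matrix,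
gives the numerator of the Weyl character formula. -/
theorem odd_jacobi_mul {Y : Fin n → K} (hY : ∀ i, Y i ≠ 0) (q) (α : ℤ) (hα : 0 ≤ α) :
    ∑ j ∈ Finset.range n,
      (h (recip Y) (α - n + (j + 1)) - h (recip Y) (α - n - (j + 1))) *
        ((omitPoly (recip Y) q).coeff (n - 1 - j) - (omitPoly (recip Y) q).coeff (n + 1 + j)) =
      recip Y q ^ α - recip Y q ^ (-1 - α) := by
  have h1 := sum_omitPoly_mul_h (recip Y) q α
  have h2 := sum_omitPoly_reflect_mul_h hY q α
  rw [if_neg (by omega)] at h1 h2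
  rw [card_recip] at h1
  rw [← h1, ← h2, ← Finset.sum_sub_distrib, sum_range_two_mul_add_one]
  rw [show 2 * n - n = n by omega, sub_self, zero_add]
  refine Finset.sum_congr rfl fun j hj => ?_
  rw [Finset.mem_range] at hj
  rw [show 2 * n - (n - 1 - j) = n + 1 + j by omega, show 2 * n - (n + 1 + j) = n - 1 - j by omega,
    show α - ((n - 1 - j : ℕ) : ℤ) = α - n + (j + 1) by omega,
    show α - ((n + 1 + j : ℕ) : ℤ) = α - n - (j + 1) by omega]
  ring

/-- The analogue of `odd_jacobi_mul` for even orthogonal characters. The numerator is the one of the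
character of type `D` in the variables `(Y, 1)`. -/
theorem even_jacobi_mul {Y : Fin n → K} (hY : ∀ i, Y i ≠ 0) (q) (α : ℤ) (hα : 0 ≤ α) :
    ∑ j ∈ Finset.range (n + 1),
      (h (recip Y) (α - n - 1 + (j + 1)) + h (recip Y) (α - n - 1 - j)) *
        ((omitPoly (recip Y) q).coeff (n - j) + (omitPoly (recip Y) q).coeff (n + 1 + j)) =
      if α = 0 then 1 else recip Y q ^ α + recip Y q ^ (-α) := by
  have h1 := sum_omitPoly_mul_h (recip Y) q α
  have h2 := sum_omitPoly_reflect_mul_h hY q (α - 1)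
  rw [if_neg (by omega), card_recip] at h1
  have hz : (omitPoly (recip Y) q).coeff (2 * n + 1) = 0 := by
    apply Polynomial.coeff_eq_zero_of_natDegree_lt
    have := natDegree_omitPoly_lt (recip Y) q
    rwa [card_recip] at this
  rw [← Finset.sum_range_reflect] at h2
  have h3 : (if α = 0 then (1 : K) else recip Y q ^ α + recip Y q ^ (-α)) =
      ∑ k ∈ Finset.range (2 * n + 2), (omitPoly (recip Y) q).coeff k *
        (h (recip Y) (α - k) + h (recip Y) (α - 1 - 2 * n + k)) := by
    rw [Finset.sum_range_succ, hz, zero_mul, add_zero]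
    simp only [mul_add, Finset.sum_add_distrib]
    rw [h1]
    have h4 : ∑ k ∈ Finset.range (2 * n + 1), (omitPoly (recip Y) q).coeff k *
        h (recip Y) (α - 1 - 2 * n + k) =
        if α - 1 < 0 then 0 else recip Y q ^ (-1 - (α - 1)) := by
      rw [← h2]
      refine Finset.sum_congr rfl fun k hk => ?_
      rw [Finset.mem_range] at hk
      rw [show 2 * n - (2 * n + 1 - 1 - k) = k by omega,
        show α - 1 - ((2 * n + 1 - 1 - k : ℕ) : ℤ) = α - 1 - 2 * n + k by omega]
    rw [h4]
    by_cases hα0 : α = 0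
    · simp [hα0]
    · rw [if_neg hα0, if_neg (by omega), show -1 - (α - 1) = -α by ring]
  rw [h3, sum_range_two_mul_add_two]
  refine Finset.sum_congr rfl fun j hj => ?_
  rw [Finset.mem_range] at hj
  rw [show α - ((n - j : ℕ) : ℤ) = α - n - 1 + (j + 1) by omega,
    show α - ((n + 1 + j : ℕ) : ℤ) = α - n - 1 - j by omega,
    show α - 1 - 2 * n + ((n - j : ℕ) : ℤ) = α - n - 1 - j by omega,
    show α - 1 - 2 * n + ((n + 1 + j : ℕ) : ℤ) = α - n - 1 + (j + 1) by omega]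
  ring

/-- The Jacobi-Trudi matrix of the Schur function, multiplied by a suitable matrix, gives the
numerator of the bialternant formula. -/
theorem schur_jacobi_mul (Y : Fin n → K) (q) (α : ℤ) (hα : 0 ≤ α) :
    ∑ j ∈ Finset.range (2 * n + 1),
      h (recip Y) (α - 2 * n + j) * (omitPoly (recip Y) q).coeff (2 * n - j) =
      recip Y q ^ α := by
  have h1 := sum_omitPoly_mul_h (recip Y) q α
  rw [if_neg (by omega), card_recip] at h1
  rw [← h1, ← Finset.sum_range_reflect]
  refine Finset.sum_congr rfl fun k hk => ?_
  rw [Finset.mem_range] at hk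
  rw [show 2 * n - (2 * n + 1 - 1 - k) = k by omega,
    show α - 2 * n + ((2 * n + 1 - 1 - k : ℕ) : ℤ) = α - k by omega, mul_comm]

/-- A row in the inverse variables gives a negative exponent: this is what allows mixing both
kinds of rows in one determinant. -/
theorem schur_jacobi_mul' {Y : Fin n → K} (hY : ∀ i, Y i ≠ 0) (q) (α : ℤ) (hα : 0 ≤ α) :
    ∑ j ∈ Finset.range (2 * n + 1),
      h (recip Y) (α - j) * (omitPoly (recip Y) q).coeff (2 * n - j) =
      recip Y q ^ (-1 - α) := by
  have h2 := sum_omitPoly_reflect_mul_h hY q α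
  rw [if_neg (by omega)] at h2
  rw [← h2]
  exact Finset.sum_congr rfl fun k _ => mul_comm _ _

end SelfReciprocal

/-! ### Nonvanishing of the alternants -/

section Nonvanishing

open Polynomial in
/-- The quotients `(u ^ (k + 1) - u ^ (-k - 1)) / (u - u⁻¹)` are monic polynomials of degree `k`
in `u + u⁻¹`. -/
theorem exists_monic_sub (F : Type*) [Field F] (k : ℕ) :
    ∃ p : F[X], p.Monic ∧ p.natDegree = k ∧
      ∀ u : F, u ≠ 0 → (u - u⁻¹) * p.eval (u + u⁻¹) = u ^ (k + 1) - u⁻¹ ^ (k + 1) := by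
  have key : ∀ k : ℕ, ∃ p q : F[X],
      (p.Monic ∧ p.natDegree = k ∧
        ∀ u : F, u ≠ 0 → (u - u⁻¹) * p.eval (u + u⁻¹) = u ^ (k + 1) - u⁻¹ ^ (k + 1)) ∧
      (q.Monic ∧ q.natDegree = k + 1 ∧
        ∀ u : F, u ≠ 0 → (u - u⁻¹) * q.eval (u + u⁻¹) = u ^ (k + 2) - u⁻¹ ^ (k + 2)) := by
    intro k
    induction k with
    | zero =>
      refine ⟨1, X, ⟨monic_one, by simp, fun u hu => by simp⟩, monic_X, by simp, fun u hu => ?_⟩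
      rw [eval_X]; ring
    | succ k ih =>
      obtain ⟨p, q, ⟨hp1, hp2, hp3⟩, hq1, hq2, hq3⟩ := ih
      have hlt : p.degree < (X * q).degree := by
        rw [degree_eq_natDegree hp1.ne_zero, degree_eq_natDegree (monic_X.mul hq1).ne_zero,
          natDegree_X_mul hq1.ne_zero, hp2, hq2]
        exact_mod_cast by omega
      refine ⟨q, X * q - p, ⟨hq1, hq2, hq3⟩, (monic_X.mul hq1).sub_of_left hlt, ?_, ?_⟩
      · rw [natDegree_sub_eq_left_of_natDegree_lt, natDegree_X_mul hq1.ne_zero, hq2]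
        rw [natDegree_X_mul hq1.ne_zero]; omega
      · intro u hu
        have h1 := hp3 u hu
        have h2 := hq3 u hu
        rw [eval_sub, eval_mul, eval_X, mul_sub, h1, mul_left_comm, h2]
        have h3 : u * u⁻¹ = 1 := mul_inv_cancel₀ hu
        linear_combination (u ^ (k + 1) - u⁻¹ ^ (k + 1)) * h3
  obtain ⟨p, -, hp, -⟩ := key k
  exact ⟨p, hp⟩

open Polynomial in
/-- For `k ≥ 1`, the sum `u ^ k + u ^ (-k)` is a monic polynomial of degree `k` in `u + u⁻¹`. -/
theorem exists_monic_add (F : Type*) [Field F] (k : ℕ) :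
    ∃ p : F[X], p.Monic ∧ p.natDegree = k ∧
      ∀ u : F, u ≠ 0 → (if k = 0 then 2 else 1) * p.eval (u + u⁻¹) = u ^ k + u⁻¹ ^ k := by
  have key : ∀ k : ℕ, ∃ p q : F[X],
      (p.Monic ∧ p.natDegree = k + 1 ∧
        ∀ u : F, u ≠ 0 → p.eval (u + u⁻¹) = u ^ (k + 1) + u⁻¹ ^ (k + 1)) ∧
      (q.Monic ∧ q.natDegree = k + 2 ∧
        ∀ u : F, u ≠ 0 → q.eval (u + u⁻¹) = u ^ (k + 2) + u⁻¹ ^ (k + 2)) := by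
    intro k
    induction k with
    | zero =>
      refine ⟨X, X ^ 2 - C 2, ⟨monic_X, by simp, fun u hu => by simp⟩,
        monic_X_pow_sub_C _ (by simp), natDegree_X_pow_sub_C, fun u hu => ?_⟩
      have h3 : u * u⁻¹ = 1 := mul_inv_cancel₀ hu
      rw [eval_sub, eval_pow, eval_X, eval_C]
      linear_combination 2 * h3
    | succ k ih =>
      obtain ⟨p, q, ⟨hp1, hp2, hp3⟩, hq1, hq2, hq3⟩ := ih
      have hlt : p.degree < (X * q).degree := by
        rw [degree_eq_natDegree hp1.ne_zero, degree_eq_natDegree (monic_X.mul hq1).ne_zero,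
          natDegree_X_mul hq1.ne_zero, hp2, hq2]
        exact_mod_cast by omega
      refine ⟨q, X * q - p, ⟨hq1, hq2, hq3⟩, (monic_X.mul hq1).sub_of_left hlt, ?_, ?_⟩
      · rw [natDegree_sub_eq_left_of_natDegree_lt, natDegree_X_mul hq1.ne_zero, hq2]
        rw [natDegree_X_mul hq1.ne_zero]; omega
      · intro u hu
        rw [eval_sub, eval_mul, eval_X, hp3 u hu, hq3 u hu]
        have h3 : u * u⁻¹ = 1 := mul_inv_cancel₀ hu
        linear_combination (u ^ (k + 1) + u⁻¹ ^ (k + 1)) * h3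
  rcases k with - | k
  · exact ⟨1, monic_one, by simp, fun u hu => by simp; norm_num⟩
  · obtain ⟨p, -, ⟨h1, h2, h3⟩, -⟩ := key k
    exact ⟨p, h1, h2, fun u hu => by simpa using h3 u hu⟩

variable {F : Type*} [Field F]

theorem add_inv_injective {k : ℕ} {u : Fin k → F} (hu0 : ∀ i, u i ≠ 0)
    (hu : Function.Injective u) (hu' : ∀ i j, i ≠ j → u i * u j ≠ 1) :
    Function.Injective fun i => u i + (u i)⁻¹ := by
  intro i j hij
  by_contra hne
  have h1 := mul_inv_cancel₀ (hu0 i)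
  have h2 := mul_inv_cancel₀ (hu0 j)
  have h3 : (u i - u j) * (u i * u j - 1) = 0 := by
    linear_combination (u i * u j) * hij - u j * h1 + u i * h2
  rcases mul_eq_zero.mp h3 with h4 | h4
  · exact hne (hu (sub_eq_zero.mp h4))
  · exact hu' i j hne (sub_eq_zero.mp h4)

theorem det_eval_ne_zero {k : ℕ} {v : Fin k → F} (hv : Function.Injective v)
    (p : Fin k → Polynomial F) (hdeg : ∀ i, (p i).natDegree = i) (hmon : ∀ i, (p i).Monic) :
    (Matrix.of fun i j => (p j).eval (v i)).det ≠ 0 := by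
  rw [← Matrix.det_eval_matrixOfPolynomials_eq_det_vandermonde v p hdeg hmon]
  exact Matrix.det_vandermonde_ne_zero_iff.mpr hv

end Nonvanishing

theorem det_scale {R m : Type*} [CommRing R] [Fintype m] [DecidableEq m] (A : Matrix m m R)
    (a b : m → R) :
    (Matrix.of fun i j => a i * (b j * A i j)).det = (∏ i, a i) * ((∏ j, b j) * A.det) := by
  rw [← Matrix.det_mul_row b A, ← Matrix.det_mul_column a]
  rfl

section Numerators

variable {F : Type*} [Field F] {σ : F}

/-- With nodes in geometric progression the numerator becomes, after exchanging the roles of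
nodes and exponents, a multiple of a Vandermonde determinant in the numbers `u + u⁻¹`. -/
theorem det_odd_numerator_ne_zero (hσ0 : σ ≠ 0) (hσ : ∀ k : ℤ, σ ^ k = 1 → k = 0) {k : ℕ}
    {α : Fin k → ℤ} (hα0 : ∀ i, 0 ≤ α i) (hα : Function.Injective α) :
    (Matrix.of fun i j : Fin k => (σ ^ (2 * ((j : ℤ) + 1))) ^ α i -
      (σ ^ (2 * ((j : ℤ) + 1))) ^ (-1 - α i)).det ≠ 0 := by
  choose p hp1 hp2 hp3 using fun j : Fin k => exists_monic_sub F (j : ℕ)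
  set u : Fin k → F := fun i => σ ^ (2 * α i + 1) with hu
  have hu0 : ∀ i, u i ≠ 0 := fun i => zpow_ne_zero _ hσ0
  have hinj : ∀ a b : ℤ, σ ^ a = σ ^ b → a = b := fun a b hab => by
    have := hσ (a - b) (by rw [zpow_sub₀ hσ0, hab, div_self (zpow_ne_zero _ hσ0)])
    omega
  have h1 : (Matrix.of fun i j : Fin k => (σ ^ (2 * ((j : ℤ) + 1))) ^ α i -
      (σ ^ (2 * ((j : ℤ) + 1))) ^ (-1 - α i)) =
      Matrix.of fun i j : Fin k => (u i - (u i)⁻¹) * (σ ^ (-((j : ℤ) + 1)) *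
        (Matrix.of fun i j => (p j).eval (u i + (u i)⁻¹)) i j) := by
    ext i j
    simp only [Matrix.of_apply]
    rw [mul_left_comm, hp3 j _ (hu0 i), mul_sub, hu]
    simp only [← zpow_natCast, ← zpow_mul, ← zpow_neg, ← zpow_add₀ hσ0]
    congr 2 <;> push_cast <;> ring
  rw [h1, det_scale]
  refine mul_ne_zero (Finset.prod_ne_zero_iff.mpr fun i _ => ?_)
    (mul_ne_zero (Finset.prod_ne_zero_iff.mpr fun j _ => zpow_ne_zero _ hσ0)
      (det_eval_ne_zero (add_inv_injective hu0 ?_ ?_) p hp2 hp1))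
  · intro h0
    rw [hu] at h0
    simp only [← zpow_neg] at h0
    have := hinj _ _ (sub_eq_zero.mp h0)
    omega
  · intro i j hij
    have := hinj _ _ hij
    exact hα (by omega)
  · intro i j _ hij
    rw [hu] at hij
    simp only [← zpow_add₀ hσ0] at hij
    have := hσ _ hij
    have := hα0 i
    have := hα0 j
    omega

/-- The analogue of `det_odd_numerator_ne_zero` for the even orthogonal numerator. -/
theorem det_even_numerator_ne_zero [CharZero F] (hσ0 : σ ≠ 0)
    (hσ : ∀ k : ℤ, σ ^ k = 1 → k = 0) {k : ℕ}
    {α : Fin k → ℤ} (hα0 : ∀ i, 0 ≤ α i) (hα : Function.Injective α) :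
    (Matrix.of fun i j : Fin k => if α i = 0 then 1 else (σ ^ (2 * (j : ℤ))) ^ α i +
      (σ ^ (2 * (j : ℤ))) ^ (-α i)).det ≠ 0 := by
  choose p hp1 hp2 hp3 using fun j : Fin k => exists_monic_add F (j : ℕ)
  set u : Fin k → F := fun i => σ ^ (2 * α i) with hu
  have hu0 : ∀ i, u i ≠ 0 := fun i => zpow_ne_zero _ hσ0
  have hinj : ∀ a b : ℤ, σ ^ a = σ ^ b → a = b := fun a b hab => by
    have := hσ (a - b) (by rw [zpow_sub₀ hσ0, hab, div_self (zpow_ne_zero _ hσ0)])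
    omega
  have h1 : (Matrix.of fun i j : Fin k => if α i = 0 then 1 else (σ ^ (2 * (j : ℤ))) ^ α i +
      (σ ^ (2 * (j : ℤ))) ^ (-α i)) =
      Matrix.of fun i j : Fin k => (if α i = 0 then (1 / 2 : F) else 1) *
        ((if (j : ℕ) = 0 then 2 else 1) *
        (Matrix.of fun i j => (p j).eval (u i + (u i)⁻¹)) i j) := by
    ext i j
    simp only [Matrix.of_apply]
    rw [hp3 j _ (hu0 i), hu]
    split_ifs with h0
    · simp [h0]; norm_num
    · simp only [← zpow_natCast, ← zpow_mul, ← zpow_neg, one_mul]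
      congr 2 <;> ring
  rw [h1, det_scale]
  refine mul_ne_zero (Finset.prod_ne_zero_iff.mpr fun i _ => ?_)
    (mul_ne_zero (Finset.prod_ne_zero_iff.mpr fun j _ => ?_)
      (det_eval_ne_zero (add_inv_injective hu0 ?_ ?_) p hp2 hp1))
  · split_ifs <;> norm_num
  · split_ifs <;> norm_num
  · intro i j hij
    have := hinj _ _ hij
    exact hα (by omega)
  · intro i j hne hij
    rw [hu] at hij
    simp only [← zpow_add₀ hσ0] at hij
    have := hσ _ hij
    have := hα0 i
    have := hα0 j
    exact hne (hα (by omega))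

theorem det_schur_numerator_ne_zero (hσ0 : σ ≠ 0) (hσ : ∀ k : ℤ, σ ^ k = 1 → k = 0) {k : ℕ}
    {e : Fin k → ℤ} (he : Function.Injective e) (c : ℤ) :
    (Matrix.of fun i j : Fin k => (σ ^ (2 * ((j : ℤ) - c))) ^ e i).det ≠ 0 := by
  have h1 : (Matrix.of fun i j : Fin k => (σ ^ (2 * ((j : ℤ) - c))) ^ e i) =
      Matrix.of fun i j : Fin k => (σ ^ (-2 * c * e i)) * (1 *
        (Matrix.vandermonde fun i => σ ^ (2 * e i)) i j) := by
    ext i j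
    simp only [Matrix.of_apply, Matrix.vandermonde_apply, one_mul]
    simp only [← zpow_natCast, ← zpow_mul, ← zpow_add₀ hσ0]
    congr 1; ring
  rw [h1, det_scale _ _ fun _ => 1]
  refine mul_ne_zero (Finset.prod_ne_zero_iff.mpr fun i _ => zpow_ne_zero _ hσ0)
    (mul_ne_zero (by simp) (Matrix.det_vandermonde_ne_zero_iff.mpr fun i j hij => he ?_))
  have := hσ (2 * e i - 2 * e j)
    (by rw [zpow_sub₀ hσ0, hij, div_self (zpow_ne_zero _ hσ0)])
  omega

end Numerators

section Specialization

variable {n : ℕ}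

/-- Evaluation of the indeterminates at nonzero complex numbers, on a subring of the field of
rational functions in which the indeterminates are invertible. -/
theorem exists_specialization (y : Fin n → ℂ) (hy : ∀ i, y i ≠ 0) :
    ∃ (R : Type) (_ : CommRing R) (ψ : R →+* RatFun n) (φ : R →+* ℂ) (u : Fin n → Rˣ),
      Function.Injective ψ ∧ (∀ i, ψ (u i) = x i) ∧ ∀ i, φ (u i) = y i := by
  let M : Submonoid (MvPolynomial (Fin n) ℂ) :=
    (nonZeroDivisors ℂ).comap (MvPolynomial.eval y : MvPolynomial (Fin n) ℂ →+* ℂ)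
  have hM : ∀ p : M, MvPolynomial.eval y (p : MvPolynomial (Fin n) ℂ) ≠ 0 := fun p =>
    nonZeroDivisors.ne_zero p.2
  have hM0 : ∀ p : M, (p : MvPolynomial (Fin n) ℂ) ≠ 0 := fun p h0 => hM p (by rw [h0, map_zero])
  have hinj := IsFractionRing.injective (MvPolynomial (Fin n) ℂ) (RatFun n)
  have h1 : ∀ p : M, IsUnit (algebraMap (MvPolynomial (Fin n) ℂ) (RatFun n) p) := fun p => by
    rw [isUnit_iff_ne_zero, Ne, map_eq_zero_iff _ hinj]
    exact hM0 p
  have h2 : ∀ p : M, IsUnit (MvPolynomial.eval y (p : MvPolynomial (Fin n) ℂ)) := fun p =>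
    isUnit_iff_ne_zero.mpr (hM p)
  have hX : ∀ i, (MvPolynomial.X i : MvPolynomial (Fin n) ℂ) ∈ M := fun i => by
    simpa [M] using hy i
  have hMle : M ≤ nonZeroDivisors _ := fun p hp => mem_nonZeroDivisors_of_ne_zero (hM0 ⟨p, hp⟩)
  refine ⟨Localization M, inferInstance, IsLocalization.lift h1, IsLocalization.lift h2,
    fun i => (IsLocalization.map_units (Localization M) ⟨_, hX i⟩).unit, ?_, ?_, ?_⟩
  · rw [IsLocalization.lift_injective_iff]
    intro a b
    rw [(IsLocalization.injective (Localization M) hMle).eq_iff, hinj.eq_iff]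
  · intro i
    rw [IsUnit.unit_spec, IsLocalization.lift_eq]; rfl
  · intro i
    rw [IsUnit.unit_spec, IsLocalization.lift_eq]; simp

theorem x_ne_zero (i : Fin n) : (x i : RatFun n) ≠ 0 := by
  rw [x, Ne, map_eq_zero_iff _ (IsFractionRing.injective _ _)]
  exact MvPolynomial.X_ne_zero i

theorem Xpow_ne_zero (T : ℕ) (i : Fin n) : Xpow n T i ≠ 0 := pow_ne_zero _ (x_ne_zero i)

/-- The exponents of the principal specialization of `recip`. -/
def recipExp : (Fin n ⊕ Fin n) ⊕ Unit → ℤ :=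
  Sum.elim (Sum.elim (fun i => (i : ℤ) + 1) fun i => -((i : ℤ) + 1)) fun _ => 0

/-- The specialization `xᵢ ↦ 4 ^ i` turns the entries of `recip (Xpow n T)` into even powers of
`2 ^ T`, which reduces the numerators of all the character formulas to Vandermonde determinants. -/
theorem exists_principal_specialization (n T : ℕ) :
    ∃ (R : Type) (_ : CommRing R) (ψ : R →+* RatFun n) (φ : R →+* ℂ)
      (U : (Fin n ⊕ Fin n) ⊕ Unit → Rˣ), Function.Injective ψ ∧
      (∀ q (k : ℤ), ψ ((U q ^ k : Rˣ) : R) = recip (Xpow n T) q ^ k) ∧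
      ∀ q (k : ℤ), φ ((U q ^ k : Rˣ) : R) = ((2 ^ T : ℂ) ^ (2 * recipExp q)) ^ k := by
  obtain ⟨R, hR, ψ, φ, u, hψ, hψu, hφu⟩ :=
    exists_specialization (fun i : Fin n => (4 : ℂ) ^ ((i : ℕ) + 1)) (fun i => by simp)
  have key : ∀ (L : Type) [Field L] (f : R →+* L) (v : Rˣ) (k : ℤ),
      f ((v ^ k : Rˣ) : R) = f v ^ k := by
    intro L _ f v k
    change ((Units.map (f : R →* L) (v ^ k) : Lˣ) : L) = _
    rw [map_zpow, Units.val_zpow_eq_zpow_val]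
    rfl
  refine ⟨R, hR, ψ, φ,
    Sum.elim (Sum.elim (fun i => u i ^ T) fun i => (u i ^ T)⁻¹) fun _ => 1, hψ, ?_, ?_⟩
  · intro q k
    rw [key]
    congr 1
    rcases q with (q | q) | q
    · simp [recip, snoc, double, Xpow, hψu]
    · simp only [recip, snoc, double, Xpow, Sum.elim_inl, Sum.elim_inr, ← zpow_neg_one]
      rw [key]; simp [hψu]
    · simp [recip, snoc]
  · intro q k
    rw [key]
    congr 1
    have h4 : (4 : ℂ) = 2 ^ 2 := by norm_num
    rcases q with (q | q) | q
    · simp only [recipExp, Sum.elim_inl, Units.val_pow_eq_pow_val, map_pow, hφu, h4]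
      simp only [← zpow_natCast, ← zpow_mul]
      congr 1; push_cast; ring
    · simp only [recipExp, Sum.elim_inl, Sum.elim_inr, ← zpow_neg_one]
      rw [key]
      simp only [Units.val_pow_eq_pow_val, map_pow, hφu, h4]
      simp only [← zpow_natCast, ← zpow_mul]
      congr 1; push_cast; ring
    · simp [recipExp]

theorem det_map_ne_zero {R S L m : Type*} [CommRing R] [CommRing S] [CommRing L] [Fintype m]
    [DecidableEq m] {ψ : R →+* S} (hψ : Function.Injective ψ) {φ : R →+* L} (A : Matrix m m R)
    {B : Matrix m m S} (hB : ∀ i j, ψ (A i j) = B i j) {C : Matrix m m L}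
    (hC : ∀ i j, φ (A i j) = C i j) (hdet : C.det ≠ 0) : B.det ≠ 0 := by
  obtain rfl : ψ.mapMatrix A = B := by ext i j; exact hB i j
  obtain rfl : φ.mapMatrix A = C := by ext i j; exact hC i j
  have hA := hdet
  rw [← RingHom.map_det] at hA ⊢
  rw [Ne, map_eq_zero_iff _ hψ]
  intro h0
  rw [h0, map_zero] at hA
  exact hA rfl

/-- The number `2 ^ T` is not a root of unity. -/
theorem two_pow_zpow_eq_one {T : ℕ} (hT : T ≠ 0) (k : ℤ) (hk : (2 ^ T : ℂ) ^ k = 1) : k = 0 := by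
  rw [← zpow_natCast, ← zpow_mul] at hk
  have h2 : ((2 : ℝ) ^ ((T : ℤ) * k)) = 1 := by
    simpa only [norm_zpow, RCLike.norm_ofNat, norm_one] using congrArg norm hk
  rw [zpow_eq_one_iff_right₀ (by norm_num) (by norm_num)] at h2
  simpa [hT] using h2

theorem det_odd_ne_zero {T : ℕ} (hT : T ≠ 0) {α : Fin n → ℤ} (hα0 : ∀ i, 0 ≤ α i)
    (hα : Function.Injective α) :
    (Matrix.of fun i j : Fin n => recip (Xpow n T) (.inl (.inl j)) ^ α i -
      recip (Xpow n T) (.inl (.inl j)) ^ (-1 - α i)).det ≠ 0 := by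
  obtain ⟨R, hR, ψ, φ, U, hψ, hψU, hφU⟩ := exists_principal_specialization n T
  have := det_odd_numerator_ne_zero (σ := (2 ^ T : ℂ)) (by simp) (two_pow_zpow_eq_one hT) hα0 hα
  refine det_map_ne_zero hψ (φ := φ) (Matrix.of fun i j : Fin n =>
    ((U (.inl (.inl j)) ^ α i : Rˣ) : R) - (U (.inl (.inl j)) ^ (-1 - α i) : Rˣ)) ?_ ?_ this
  · intro i j; simp [hψU, -Units.val_zpow_eq_zpow_val]
  · intro i j; simp [hφU, recipExp, -Units.val_zpow_eq_zpow_val]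

/-- The indices of the entries `1, Y₁, ..., Yₙ` of `recip Y`. -/
def halfIndex (j : Fin (n + 1)) : (Fin n ⊕ Fin n) ⊕ Unit :=
  Fin.cases (.inr ()) (fun i => .inl (.inl i)) j

theorem recipExp_halfIndex (j : Fin (n + 1)) : recipExp (halfIndex j) = (j : ℤ) := by
  cases j using Fin.cases <;> simp [recipExp, halfIndex]

theorem det_even_ne_zero {T : ℕ} (hT : T ≠ 0) {α : Fin (n + 1) → ℤ} (hα0 : ∀ i, 0 ≤ α i)
    (hα : Function.Injective α) :
    (Matrix.of fun i j : Fin (n + 1) => if α i = 0 then 1 else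
      recip (Xpow n T) (halfIndex j) ^ α i + recip (Xpow n T) (halfIndex j) ^ (-α i)).det ≠ 0 := by
  obtain ⟨R, hR, ψ, φ, U, hψ, hψU, hφU⟩ := exists_principal_specialization n T
  have := det_even_numerator_ne_zero (σ := (2 ^ T : ℂ)) (by simp) (two_pow_zpow_eq_one hT) hα0 hα
  refine det_map_ne_zero hψ (φ := φ) (Matrix.of fun i j : Fin (n + 1) => if α i = 0 then 1 else
    ((U (halfIndex j) ^ α i : Rˣ) : R) + (U (halfIndex j) ^ (-α i) : Rˣ)) ?_ ?_ this
  · intro i j; simp only [Matrix.of_apply]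
    split_ifs <;> simp [hψU, -Units.val_zpow_eq_zpow_val]
  · intro i j; simp only [Matrix.of_apply]
    split_ifs <;> simp [hφU, recipExp_halfIndex, -Units.val_zpow_eq_zpow_val]

/-- The entries of `recip Y` listed by increasing exponents in the principal specialization. -/
theorem exists_recipIndex (n : ℕ) :
    ∃ e : Fin (2 * n + 1) ≃ (Fin n ⊕ Fin n) ⊕ Unit, ∀ j, recipExp (e j) = (j : ℤ) - n := by
  let f : (Fin n ⊕ Fin n) ⊕ Unit → Fin (2 * n + 1) :=
    fun q => ⟨(recipExp q + n).toNat, by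
      rcases q with (q | q) | q <;> simp only [recipExp, Sum.elim_inl, Sum.elim_inr] <;> omega⟩
  have hf : ∀ q, ((f q : ℕ) : ℤ) = recipExp q + n := by
    intro q
    rcases q with (q | q) | q <;> simp only [f, recipExp, Sum.elim_inl, Sum.elim_inr] <;> omega
  have hinj : Function.Injective f := by
    intro a b hab
    have h1 : recipExp a = recipExp b := by
      have := hf a; have := hf b; rw [hab] at *; omega
    rcases a with (a | a) | a <;> rcases b with (b | b) | b <;> simp [recipExp] at h1 ⊢ <;> omega
  have hbij : Function.Bijective f :=
    (Fintype.bijective_iff_injective_and_card f).mpr ⟨hinj, by simp; omega⟩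
  refine ⟨(Equiv.ofBijective f hbij).symm, fun j => ?_⟩
  have := hf ((Equiv.ofBijective f hbij).symm j)
  rw [Equiv.ofBijective_apply_symm_apply f hbij] at this
  omega

theorem det_schur_ne_zero {T : ℕ} (hT : T ≠ 0) {e : Fin (2 * n + 1) → ℤ}
    (he : Function.Injective e) {ι : Fin (2 * n + 1) ≃ (Fin n ⊕ Fin n) ⊕ Unit}
    (hι : ∀ j, recipExp (ι j) = (j : ℤ) - n) :
    (Matrix.of fun i j : Fin (2 * n + 1) => recip (Xpow n T) (ι j) ^ e i).det ≠ 0 := by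
  obtain ⟨R, hR, ψ, φ, U, hψ, hψU, hφU⟩ := exists_principal_specialization n T
  have := det_schur_numerator_ne_zero (σ := (2 ^ T : ℂ)) (by simp) (two_pow_zpow_eq_one hT) he n
  refine det_map_ne_zero hψ (φ := φ) (Matrix.of fun i j : Fin (2 * n + 1) =>
    ((U (ι j) ^ e i : Rˣ) : R)) ?_ ?_ this
  · intro i j; simp [hψU, -Units.val_zpow_eq_zpow_val]
  · intro i j; simp [hφU, hι, -Units.val_zpow_eq_zpow_val]

end Specialization

/-! ### Determinants of the blocks -/

section Determinants

variable {K ι : Type*} [Field K] [Fintype ι] [DecidableEq ι]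

theorem schur_eq_det {k : ℕ} (hk : Fintype.card ι = k) (p : ℕ → ℕ) (Y : ι → K) :
    schur p Y = (Matrix.of fun i j : Fin k => h Y ((p i : ℤ) - i + j)).det := by
  subst hk; rfl

theorem oddOrth_eq_det {k : ℕ} (hk : Fintype.card ι = k) (p : ℕ → ℕ) (Y : ι → K) :
    oddOrth p Y = (Matrix.of fun i j : Fin k =>
      h (snoc (double Y) 1) ((p i : ℤ) - (i + 1) + (j + 1)) -
        h (snoc (double Y) 1) ((p i : ℤ) - (i + 1) - (j + 1))).det := by
  subst hk; rfl

theorem evenOrth_eq_det {k : ℕ} (hk : Fintype.card ι = k) (p : ℕ → ℕ) (Y : ι → K) :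
    evenOrth p Y = (Matrix.of fun i j : Fin k =>
      h (double Y) ((p i : ℤ) - (i + 1) + (j + 1)) -
        h (double Y) ((p i : ℤ) - (i + 1) - (j + 1))).det := by
  subst hk; rfl

theorem det_unitriangular {k : ℕ} (A : Matrix (Fin k) (Fin k) K) (h0 : ∀ i j, j < i → A i j = 0)
    (h1 : ∀ i, A i i = 1) : A.det = 1 := by
  rw [Matrix.det_of_isUpperTriangular (fun i j hij => h0 i j hij)]
  simp [h1]

theorem schur_eq_one {p : ℕ → ℕ} (hp : ∀ i, p i = 0) (Y : ι → K) : schur p Y = 1 := by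
  refine det_unitriangular _ (fun i j hij => ?_) fun i => ?_
  · have : (j : ℕ) < i := hij
    exact h_of_neg _ (by rw [hp]; push_cast; omega)
  · simp [hp, h_zero]

theorem oddOrth_eq_one {p : ℕ → ℕ} (hp : ∀ i, p i = 0) (Y : ι → K) : oddOrth p Y = 1 := by
  refine det_unitriangular _ (fun i j hij => ?_) fun i => ?_
  · have : (j : ℕ) < i := hij
    simp only [Matrix.of_apply, hp]
    rw [h_of_neg _ (by push_cast; omega), h_of_neg _ (by push_cast; omega), sub_zero]
  · simp only [Matrix.of_apply, hp]
    rw [h_of_neg _ (show ((0 : ℕ) : ℤ) - ((i : ℕ) + 1) - ((i : ℕ) + 1) < 0 by omega)]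
    simp [h_zero]

theorem evenOrth_eq_one {p : ℕ → ℕ} (hp : ∀ i, p i = 0) (Y : ι → K) : evenOrth p Y = 1 := by
  refine det_unitriangular _ (fun i j hij => ?_) fun i => ?_
  · have : (j : ℕ) < i := hij
    simp only [Matrix.of_apply, hp]
    rw [h_of_neg _ (by push_cast; omega), h_of_neg _ (by push_cast; omega), sub_zero]
  · simp only [Matrix.of_apply, hp]
    rw [h_of_neg _ (show ((0 : ℕ) : ℤ) - ((i : ℕ) + 1) - ((i : ℕ) + 1) < 0 by omega)]
    simp [h_zero]

end Determinants

theorem neg_one_zpow_sub {K : Type*} [Field K] (a b : ℤ) :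
    (-1 : K) ^ (a - b) = (-1) ^ (a + b) := by
  have h0 : (-1 : K) ≠ 0 := by simp
  rw [sub_eq_add_neg, zpow_add₀ h0, zpow_add₀ h0, zpow_neg, ← inv_zpow, inv_neg, inv_one]

/-- The double of `(-Y, -1)` is `(-Y, -Y⁻¹, -1, -1)`. -/
theorem eser_double_snoc_neg {K : Type*} [Field K] {n : ℕ} (Y : Fin n → K) :
    eser (double (snoc (fun i => -Y i) (-1))) = eser (snoc (fun i => -recip Y i) (-1)) := by
  have h1 : (fun i => (snoc (fun i => -Y i) (-1) i)⁻¹) = snoc (fun i => -(Y i)⁻¹) (-1) := by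
    ext i
    rcases i with i | i <;> simp [snoc, inv_neg]
  have h2 : eser (fun i => -recip Y i) =
      eser (fun i => -Y i) * eser (fun i => -(Y i)⁻¹) *
        (1 - PowerSeries.C (-1) * PowerSeries.X) := by
    simp [eser, recip, snoc, double]
  rw [eser_double, h1, eser_snoc, eser_snoc, eser_snoc, h2]
  ring

section Blocks

variable {n T : ℕ}

/-- An odd orthogonal character does not vanish, as its product with a suitable determinant is an
alternant. -/
theorem oddOrth_ne_zero (hT : T ≠ 0) {p : ℕ → ℕ} (hp : Antitone p) :
    oddOrth p (Xpow n T) ≠ 0 := by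
  set α : Fin n → ℤ := fun i => (p i : ℤ) - (i + 1) + n with hα
  have hinj : Function.Injective α := by
    refine StrictAnti.injective fun i j hij => ?_
    have h1 : p j ≤ p i := hp (show (i : ℕ) ≤ j from hij.le)
    have h2 : (i : ℕ) < j := hij
    simp only [hα]; omega
  have hα0 : ∀ i, 0 ≤ α i := fun i => by simp only [hα]; omega
  rw [oddOrth_eq_det (Fintype.card_fin n)]
  refine left_ne_zero_of_mul (b := (Matrix.of fun j q : Fin n =>
    (omitPoly (recip (Xpow n T)) (.inl (.inl q))).coeff (n - 1 - j) -
      (omitPoly (recip (Xpow n T)) (.inl (.inl q))).coeff (n + 1 + j)).det) ?_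
  rw [← Matrix.det_mul]
  refine ne_of_eq_of_ne ?_ (det_odd_ne_zero hT hα0 hinj)
  congr 1
  ext i q
  rw [Matrix.mul_apply]
  simp only [Matrix.of_apply]
  rw [← odd_jacobi_mul (Xpow_ne_zero T) _ _ (hα0 i), ← Fin.sum_univ_eq_sum_range
    (fun j => (h (recip (Xpow n T)) (α i - n + (j + 1)) -
      h (recip (Xpow n T)) (α i - n - (j + 1))) * _)]
  refine Finset.sum_congr rfl fun j _ => ?_
  rw [show α i - n = (p i : ℤ) - (i + 1) by simp [hα]]
  rfl

/-- The residue class `0` contributes an odd orthogonal character. -/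
theorem det_block_zero (p : ℕ → ℕ) (g : ℤ → RatFun n)
    (hg : ∀ a, g a = (-1) ^ a * h (recip (Xpow n T)) a) :
    (Matrix.of fun i j : Fin n => g ((p i : ℤ) - (i + 1) + (j + 1)) -
      g ((p i : ℤ) - (i + 1) - (j + 1))).det =
      (-1) ^ (∑ i ∈ Finset.range n, p i) * oddOrth p (Xpow n T) := by
  have h0 : (-1 : RatFun n) ≠ 0 := by simp
  rw [oddOrth_eq_det (Fintype.card_fin n), ← Fin.sum_univ_eq_sum_range,
    ← Finset.prod_pow_eq_pow_sum]
  have h1 := neg_one_zpow_sub (K := RatFun n)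
  have h2 : (∏ i : Fin n, (-1 : RatFun n) ^ (i : ℕ)) *
      ∏ i : Fin n, (-1 : RatFun n) ^ (i : ℕ) = 1 := by
    rw [← Finset.prod_mul_distrib]
    exact Finset.prod_eq_one fun i _ => by rw [← mul_pow]; simp
  have h3 : (Matrix.of fun i j : Fin n => g ((p i : ℤ) - (i + 1) + (j + 1)) -
      g ((p i : ℤ) - (i + 1) - (j + 1))) =
      Matrix.of fun i j : Fin n => ((-1) ^ p i * (-1) ^ (i : ℕ)) * ((-1) ^ (j : ℕ) *
        (Matrix.of fun i j : Fin n =>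
          h (snoc (double (Xpow n T)) 1) ((p i : ℤ) - (i + 1) + (j + 1)) -
            h (snoc (double (Xpow n T)) 1) ((p i : ℤ) - (i + 1) - (j + 1))) i j) := by
    ext i j
    simp only [Matrix.of_apply, hg]
    rw [h1 _ ((j : ℤ) + 1), ← mul_sub, ← mul_assoc]
    congr 1
    rw [show (p i : ℤ) - (i + 1) + (j + 1) = ((p i : ℤ) + j) - i by ring, h1,
      ← Nat.cast_add, ← Nat.cast_add, zpow_natCast]
    ring
  rw [h3, det_scale, Finset.prod_mul_distrib]
  linear_combination (∏ i : Fin n, (-1 : RatFun n) ^ p i) *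
    (Matrix.of fun i j : Fin n => h (snoc (double (Xpow n T)) 1) ((p i : ℤ) - (i + 1) + (j + 1)) -
      h (snoc (double (Xpow n T)) 1) ((p i : ℤ) - (i + 1) - (j + 1))).det * h2

/-- The determinant of the block of the class `T / 2` is a factor of an alternant. -/
theorem det_block_half_ne_zero (hT : T ≠ 0) {p : ℕ → ℕ} (hp : Antitone p) (g : ℤ → RatFun n)
    (hg : ∀ a, g a = (-1) ^ a * h (recip (Xpow n T)) a) :
    (Matrix.of fun i j : Fin (n + 1) => g ((p i : ℤ) - (i + 1) + (j + 1)) -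
      g ((p i : ℤ) - (i + 1) - j)).det ≠ 0 := by
  have h0 : (-1 : RatFun n) ≠ 0 := by simp
  set α : Fin (n + 1) → ℤ := fun i => (p i : ℤ) - (i + 1) + n + 1 with hα
  have hinj : Function.Injective α := by
    refine StrictAnti.injective fun i j hij => ?_
    have h1 : p j ≤ p i := hp (show (i : ℕ) ≤ j from hij.le)
    have h2 : (i : ℕ) < j := hij
    simp only [hα]; omega
  have hα0 : ∀ i, 0 ≤ α i := fun i => by simp only [hα]; omega
  have h1 := neg_one_zpow_sub (K := RatFun n)
  have h3 : (Matrix.of fun i j : Fin (n + 1) => g ((p i : ℤ) - (i + 1) + (j + 1)) -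
      g ((p i : ℤ) - (i + 1) - j)) =
      Matrix.of fun i j : Fin (n + 1) => ((-1) ^ ((p i : ℤ) - (i + 1))) * ((-1) ^ ((j : ℤ) + 1) *
        (Matrix.of fun i j : Fin (n + 1) =>
          h (recip (Xpow n T)) ((p i : ℤ) - (i + 1) + (j + 1)) +
            h (recip (Xpow n T)) ((p i : ℤ) - (i + 1) - j)) i j) := by
    ext i j
    simp only [Matrix.of_apply, hg]
    rw [h1 _ (j : ℤ), zpow_add₀ h0, zpow_add₀ h0, zpow_add₀ h0]
    ring
  rw [h3, det_scale]
  refine mul_ne_zero (Finset.prod_ne_zero_iff.mpr fun i _ => zpow_ne_zero _ h0)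
    (mul_ne_zero (Finset.prod_ne_zero_iff.mpr fun i _ => zpow_ne_zero _ h0) ?_)
  refine left_ne_zero_of_mul (b := (Matrix.of fun j q : Fin (n + 1) =>
    (omitPoly (recip (Xpow n T)) (halfIndex q)).coeff (n - j) +
      (omitPoly (recip (Xpow n T)) (halfIndex q)).coeff (n + 1 + j)).det) ?_
  rw [← Matrix.det_mul]
  refine ne_of_eq_of_ne ?_ (det_even_ne_zero hT hα0 hinj)
  congr 1
  ext i q
  rw [Matrix.mul_apply]
  simp only [Matrix.of_apply]
  rw [← even_jacobi_mul (Xpow_ne_zero T) _ _ (hα0 i), ← Fin.sum_univ_eq_sum_range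
    (fun j => (h (recip (Xpow n T)) (α i - n - 1 + (j + 1)) +
      h (recip (Xpow n T)) (α i - n - 1 - j)) * _)]
  refine Finset.sum_congr rfl fun j _ => ?_
  rw [show α i - n - 1 = (p i : ℤ) - (i + 1) by simp only [hα]; ring]

/-- The residue class `T / 2` contributes an even orthogonal character: adding the variable `-1`
amounts to adding to each column the preceding one. -/
theorem det_block_half (p : ℕ → ℕ) (g : ℤ → RatFun n)
    (hg : ∀ a, g a = (-1) ^ a * h (recip (Xpow n T)) a) :
    (Matrix.of fun i j : Fin (n + 1) => g ((p i : ℤ) - (i + 1) + (j + 1)) -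
      g ((p i : ℤ) - (i + 1) - j)).det =
      evenOrth p (snoc (fun i => -Xpow n T i) (-1)) := by
  set E := h (double (snoc (fun i => -Xpow n T i) (-1))) with hE
  have hstep : ∀ a, g a = E a + E (a - 1) := by
    intro a
    have h1 := eser_double_snoc_neg (Xpow n T)
    have h2 := h_snoc_sub (fun i => -recip (Xpow n T) i) (-1) a
    rw [← h_congr h1, ← h_congr h1, h_neg_family, ← hg] at h2
    rw [← h2, hE]; ring
  rw [evenOrth_eq_det (k := n + 1) (by simp)]
  symm
  refine Matrix.det_eq_of_forall_col_eq_smul_add_pred (fun _ => -1) (fun i => ?_) fun i j => ?_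
  · simp only [Matrix.of_apply, hstep, ← hE]
    rw [show (p i : ℤ) - (i + 1) + (((0 : Fin (n + 1)) : ℕ) + 1) - 1 =
      (p i : ℤ) - (i + 1) - ((0 : Fin (n + 1)) : ℕ) by simp,
      show (p i : ℤ) - (i + 1) - (((0 : Fin (n + 1)) : ℕ) : ℤ) - 1 =
      (p i : ℤ) - (i + 1) - (((0 : Fin (n + 1)) : ℕ) + 1) by simp]
    ring
  · simp only [Matrix.of_apply, hstep, ← hE, Fin.val_succ, Fin.val_castSucc]
    push_cast
    rw [show (p i : ℤ) - (i + 1) + (j + 1 + 1) - 1 = (p i : ℤ) - (i + 1) + (j + 1) by ring,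
      show (p i : ℤ) - (i + 1) - (j + 1) - 1 = (p i : ℤ) - (i + 1) - (j + 1 + 1) by ring]
    ring

theorem glue_antitone {p q : ℕ → ℕ} (hp : Antitone p) (hq : Antitone q) (M : ℕ) {i j : ℕ}
    (hij : i ≤ j) (hj : j < M) : glue p q M j ≤ glue p q M i := by
  have h1 := hp hij
  have h2 : q (M - 1 - i) ≤ q (M - 1 - j) := hq (by omega)
  have h3 : q (M - 1 - j) ≤ q 0 := hq (Nat.zero_le _)
  simp only [glue, hj, lt_of_le_of_lt hij hj, if_true]
  omega

/-- The determinant mixing complete homogeneous functions of `Y` and `Y⁻¹` equals the Schur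
function of the glued partition: both are quotients of the same alternant. -/
theorem det_mixed (hT : T ≠ 0) {p q : ℕ → ℕ} (hp : Antitone p) (hq : Antitone q) {a b : ℕ}
    (hab : a + b = 2 * n + 1) (hpa : ∀ i, a ≤ i → p i = 0) (hqb : ∀ i, b ≤ i → q i = 0) :
    (Matrix.of fun l j : Fin (2 * n + 1) =>
      if (l : ℕ) < a then h (recip (Xpow n T)) ((p l : ℤ) + a - 1 - l - 2 * n + j)
      else h (recip (Xpow n T)) ((q (2 * n - l) : ℤ) + b - 1 - (2 * n - l : ℕ) - j)).det =
      schur (glue p q (2 * n + 1)) (recip (Xpow n T)) ∧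
    schur (glue p q (2 * n + 1)) (recip (Xpow n T)) ≠ 0 := by
  obtain ⟨ι, hι⟩ := exists_recipIndex n
  set W := recip (Xpow n T) with hW
  have hW0 : ∀ i, W i ≠ 0 := recip_ne_zero (Xpow_ne_zero T)
  set G := glue p q (2 * n + 1) with hG
  set e : Fin (2 * n + 1) → ℤ := fun l => (G l : ℤ) + 2 * n - l with he
  have hinj : Function.Injective e := by
    refine StrictAnti.injective fun i j hij => ?_
    have h1 : G j ≤ G i := glue_antitone hp hq _ (show (i : ℕ) ≤ j from hij.le) j.2
    have h2 : (i : ℕ) < j := hij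
    simp only [he]; omega
  have hV := det_schur_ne_zero hT hinj hι
  rw [← hW] at hV
  set V := (Matrix.of fun i j : Fin (2 * n + 1) => W (ι j) ^ e i) with hVdef
  set B := (Matrix.of fun j r : Fin (2 * n + 1) => (omitPoly W (ι r)).coeff (2 * n - j)) with hB
  rw [schur_eq_det card_recip]
  set S := (Matrix.of fun i j : Fin (2 * n + 1) => h W ((G i : ℤ) - i + j)) with hS
  set H := (Matrix.of fun l j : Fin (2 * n + 1) =>
      if (l : ℕ) < a then h W ((p l : ℤ) + a - 1 - l - 2 * n + j)
      else h W ((q (2 * n - l) : ℤ) + b - 1 - (2 * n - l : ℕ) - j)) with hH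
  -- `S` is the Jacobi-Trudi matrix of the glued partition and `H` the mixed one; both become the
  -- alternant `V` after multiplication by `B`, up to a power of each node in the case of `H`
  have hSB : S * B = V := by
    ext i r
    rw [Matrix.mul_apply]
    have h2 := schur_jacobi_mul (Xpow n T) (ι r) (e i) (by simp only [he]; omega)
    rw [← Fin.sum_univ_eq_sum_range (fun j =>
      h (recip (Xpow n T)) (e i - 2 * n + j) * _)] at h2
    simp only [hVdef, Matrix.of_apply]
    rw [hW, ← h2]
    refine Finset.sum_congr rfl fun j _ => ?_
    rw [show e i - 2 * n = (G i : ℤ) - i by simp only [he]; ring]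
    rfl
  have hHB : H * B = Matrix.of fun i j => 1 * (W (ι j) ^ (-((q 0 : ℤ) + b)) * V i j) := by
    ext i r
    rw [Matrix.mul_apply]
    simp only [hVdef, Matrix.of_apply, one_mul]
    rw [← zpow_add₀ (hW0 _)]
    have hGi : G i = q 0 + p i - q (2 * n - i) := by
      simp only [hG, glue, i.2, if_true]; rw [show 2 * n + 1 - 1 - (i : ℕ) = 2 * n - i by omega]
    have hq0 : q (2 * n - i) ≤ q 0 := hq (Nat.zero_le _)
    by_cases hi : (i : ℕ) < a
    · have hqz : q (2 * n - i) = 0 := hqb _ (by omega)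
      have h2 := schur_jacobi_mul (Xpow n T) (ι r) ((p i : ℤ) + a - 1 - i) (by omega)
      rw [← Fin.sum_univ_eq_sum_range (fun j =>
        h (recip (Xpow n T)) ((p i : ℤ) + a - 1 - i - 2 * n + j) * _)] at h2
      rw [show -((q 0 : ℤ) + b) + e i = (p i : ℤ) + a - 1 - i by simp only [he]; omega]
      rw [hW, ← h2]
      refine Finset.sum_congr rfl fun j _ => ?_
      simp only [hH, hB, Matrix.of_apply, hi, if_true, hW]
    · have hpz : p i = 0 := hpa _ (by omega)
      have h2 := schur_jacobi_mul' (Xpow_ne_zero T) (ι r)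
        ((q (2 * n - i) : ℤ) + b - 1 - (2 * n - i : ℕ)) (by have := i.2; omega)
      rw [← Fin.sum_univ_eq_sum_range (fun j =>
        h (recip (Xpow n T)) ((q (2 * n - i) : ℤ) + b - 1 - (2 * n - i : ℕ) - j) * _)] at h2
      rw [show -((q 0 : ℤ) + b) + e i =
        -1 - ((q (2 * n - i) : ℤ) + b - 1 - (2 * n - i : ℕ)) by
          have := i.2; simp only [he]; omega]
      rw [hW, ← h2]
      refine Finset.sum_congr rfl fun j _ => ?_
      simp only [hH, hB, Matrix.of_apply, hi, if_false, hW]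
  -- the powers of the nodes cancel because their product is `1`
  have hscale : ∏ j, W (ι j) ^ (-((q 0 : ℤ) + b)) = 1 := by
    rw [Finset.prod_zpow, ι.prod_comp, prod_recip (Xpow_ne_zero T), one_zpow]
  have h3 : S.det * B.det = V.det := by rw [← Matrix.det_mul, hSB]
  have h4 : H.det * B.det = V.det := by
    rw [← Matrix.det_mul, hHB, det_scale _ (fun _ => 1), hscale]; simp
  have hB0 : B.det ≠ 0 := right_ne_zero_of_mul (h3 ▸ hV)
  exact ⟨mul_right_cancel₀ hB0 (h4.trans h3.symm), left_ne_zero_of_mul (h3 ▸ hV)⟩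

/-- The parity of the exponents left over when the signs `(-1) ^ i` of the rows and columns of a
block are collected. -/
theorem even_sum_range_id {a b n : ℕ} (hab : a + b = 2 * n + 1) :
    Even (∑ i ∈ Finset.range a, i + ∑ i ∈ Finset.range b, i +
      ∑ i ∈ Finset.range (2 * n + 1), i) := by
  have h1 : ∑ i ∈ Finset.range (a + b), i =
      ∑ i ∈ Finset.range a, i + ∑ i ∈ Finset.range b, i + a * b := by
    rw [Finset.sum_range_add, Finset.sum_add_distrib]
    simp; ring
  have h2 : Even (a * b) := by
    rw [Nat.even_mul]
    rcases Nat.even_or_odd a with ha | ha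
    · exact .inl ha
    · refine .inr ?_
      have : Odd (a + b) := ⟨n, hab⟩
      rw [Nat.odd_add] at this
      exact this.mp ha
  rw [← hab, h1, ← add_assoc, ← two_mul]
  exact (even_two_mul _).add h2

/-- A pair of opposite residue classes contributes a Schur function. The rows of index less than
`a` come from one class and those of the other class follow in increasing order. -/
theorem det_block_pair (hT : T ≠ 0) {p q : ℕ → ℕ} (hp : Antitone p) (hq : Antitone q) {a b : ℕ}
    (hab : a + b = 2 * n + 1) (hpa : ∀ i, a ≤ i → p i = 0) (hqb : ∀ i, b ≤ i → q i = 0)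
    (g : ℤ → RatFun n) (hg : ∀ a, g a = (-1) ^ a * h (recip (Xpow n T)) a) :
    (Matrix.of fun l j : Fin (2 * n + 1) => (if (j : ℕ) ≤ n then -1 else 1) *
      if (l : ℕ) < a then g ((p l : ℤ) + a - 1 - l - 2 * n + j)
      else -g ((q (2 * n - l) : ℤ) + b - 1 - (2 * n - l : ℕ) - j)).det =
      (-1) ^ (n + 1 + b + ∑ i ∈ Finset.range a, p i + ∑ i ∈ Finset.range b, q i) *
        schur (glue p q (2 * n + 1)) (recip (Xpow n T)) := by
  rw [← (det_mixed hT hp hq hab hpa hqb).1]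
  have h0 : (-1 : RatFun n) ≠ 0 := by simp
  have h1 := neg_one_zpow_sub (K := RatFun n)
  set H := (Matrix.of fun l j : Fin (2 * n + 1) =>
      if (l : ℕ) < a then h (recip (Xpow n T)) ((p l : ℤ) + a - 1 - l - 2 * n + j)
      else h (recip (Xpow n T)) ((q (2 * n - l) : ℤ) + b - 1 - (2 * n - l : ℕ) - j)) with hH
  let r : ℕ → RatFun n := fun l => if l < a then (-1) ^ (p l + (a - 1 - l)) else
    (-1) ^ (q (2 * n - l) + (b - 1 - (2 * n - l)) + 1)
  let c : ℕ → RatFun n := fun j => (if j ≤ n then -1 else 1) * (-1) ^ j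
  have h2 : (Matrix.of fun l j : Fin (2 * n + 1) => (if (j : ℕ) ≤ n then -1 else 1) *
      if (l : ℕ) < a then g ((p l : ℤ) + a - 1 - l - 2 * n + j)
      else -g ((q (2 * n - l) : ℤ) + b - 1 - (2 * n - l : ℕ) - j)) =
      Matrix.of fun l j : Fin (2 * n + 1) => r l * (c j * H l j) := by
    ext l j
    have hl := l.2
    simp only [Matrix.of_apply, hH, r, c, hg]
    by_cases hla : (l : ℕ) < a
    · simp only [hla, if_true]
      rw [show (p l : ℤ) + a - 1 - l - 2 * n + j = ((p l + (a - 1 - l) + j : ℕ) : ℤ) - 2 * n by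
        omega, h1 _ (2 * (n : ℤ)), zpow_add₀ h0, zpow_mul, zpow_natCast, pow_add]
      norm_num
      ring_nf
    · simp only [hla, if_false]
      rw [show (q (2 * n - l) : ℤ) + b - 1 - (2 * n - l : ℕ) - j =
        ((q (2 * n - l) + (b - 1 - (2 * n - l)) : ℕ) : ℤ) - j by omega, h1,
        ← Nat.cast_add, zpow_natCast]
      ring
  have hc : ∏ j : Fin (2 * n + 1), c j =
      (-1) ^ (n + 1) * (-1) ^ (∑ i ∈ Finset.range (2 * n + 1), i) := by
    rw [Fin.prod_univ_eq_prod_range c, Finset.prod_mul_distrib, Finset.prod_pow_eq_pow_sum]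
    congr 1
    rw [show 2 * n + 1 = (n + 1) + n by ring, Finset.prod_range_add, Finset.prod_congr rfl
      (fun i hi => if_pos (Nat.lt_succ_iff.mp (Finset.mem_range.mp hi))),
      Finset.prod_eq_one (s := Finset.range n) (fun i _ => if_neg (by omega))]
    simp
  have hr : ∏ l : Fin (2 * n + 1), r l =
      (-1) ^ (b + ∑ i ∈ Finset.range a, p i + ∑ i ∈ Finset.range b, q i) *
      (-1) ^ (∑ i ∈ Finset.range a, i + ∑ i ∈ Finset.range b, i) := by
    rw [Fin.prod_univ_eq_prod_range r, ← hab, Finset.prod_range_add, Finset.prod_congr rfl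
      (fun i hi => if_pos (Finset.mem_range.mp hi)), Finset.prod_pow_eq_pow_sum,
      ← Finset.prod_range_reflect]
    have h5 : ∀ j ∈ Finset.range b, r (a + (b - 1 - j)) =
        (-1) ^ (q j + (b - 1 - j) + 1) := fun j hj => by
      rw [Finset.mem_range] at hj
      simp only [r]
      rw [if_neg (by omega), show 2 * n - (a + (b - 1 - j)) = j by omega]
    rw [Finset.prod_congr rfl h5, Finset.prod_pow_eq_pow_sum]
    simp only [Finset.sum_add_distrib, Finset.sum_range_reflect (fun i => i)]
    simp only [Finset.sum_const, Finset.card_range, smul_eq_mul, mul_one]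
    ring
  rw [h2, det_scale H (fun l => r l) (fun j => c j), hr, hc]
  have h6 : (-1 : RatFun n) ^ (∑ i ∈ Finset.range a, i + ∑ i ∈ Finset.range b, i) *
      (-1) ^ (∑ i ∈ Finset.range (2 * n + 1), i) = 1 := by
    rw [← pow_add]; exact (even_sum_range_id hab).neg_one_pow
  linear_combination (-1 : RatFun n) ^ (n + 1) *
    (-1) ^ (b + ∑ i ∈ Finset.range a, p i + ∑ i ∈ Finset.range b, q i) * H.det * h6

end Blocks

/-! ### The twisted family -/

section Twist

theorem prod_range_one_sub {K : Type*} [Field K] {ζ : K} {T : ℕ} (hT : 0 < T)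
    (hζ : IsPrimitiveRoot ζ (2 * T)) (y : K) :
    ∏ k ∈ Finset.range T, (1 - PowerSeries.C (ζ ^ (2 * k + 1) * y) * PowerSeries.X) =
      1 - PowerSeries.C (-y ^ T) * PowerSeries.X ^ T := by
  classical
  have hζ2 : IsPrimitiveRoot (ζ ^ 2) T := hζ.pow (by omega) rfl
  have hζT : ζ ^ T = -1 := by
    have h2 : IsPrimitiveRoot (ζ ^ T) 2 := hζ.pow (by omega) (mul_comm 2 T)
    exact h2.eq_neg_one_of_two_right
  have hC : IsPrimitiveRoot (PowerSeries.C (ζ ^ 2)) T :=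
    hζ2.map_of_injective PowerSeries.C_injective
  have himg : (Finset.range T).image (fun k => PowerSeries.C (ζ ^ 2) ^ k) =
      Polynomial.nthRootsFinset T (1 : PowerSeries K) := by
    apply Finset.eq_of_subset_of_card_le
    · intro a ha
      obtain ⟨k, -, rfl⟩ := Finset.mem_image.mp ha
      rw [Polynomial.mem_nthRootsFinset hT, ← pow_mul, mul_comm, pow_mul, hC.pow_eq_one, one_pow]
    · rw [hC.card_nthRootsFinset, Finset.card_image_of_injOn, Finset.card_range]
      intro i hi j hj hij
      exact hC.pow_inj (Finset.mem_range.mp hi) (Finset.mem_range.mp hj) hij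
  have h1 := hC.pow_sub_pow_eq_prod_sub_mul 1 (PowerSeries.C (ζ * y) * PowerSeries.X) hT
  rw [← himg, Finset.prod_image (fun i hi j hj hij =>
    hC.pow_inj (Finset.mem_range.mp hi) (Finset.mem_range.mp hj) hij)] at h1
  rw [one_pow, mul_pow, ← map_pow, mul_pow, hζT, neg_one_mul] at h1
  rw [h1]
  refine Finset.prod_congr rfl fun k _ => ?_
  rw [← map_pow, ← mul_assoc, ← map_mul]
  congr 3
  ring

/-- The inverses of the first half of the odd powers of `ζ` are the second half. -/
theorem prod_range_one_sub_half {K : Type*} [Field K] {ζ : K} {s : ℕ} (hs : 0 < s)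
    (hζ : IsPrimitiveRoot ζ (2 * (2 * s))) :
    (∏ k ∈ Finset.range s, (1 - PowerSeries.C (ζ ^ (2 * k + 1)) * PowerSeries.X)) *
      ∏ k ∈ Finset.range s, (1 - PowerSeries.C (ζ ^ (2 * k + 1))⁻¹ * PowerSeries.X) =
      1 - PowerSeries.C (-1) * PowerSeries.X ^ (2 * s) := by
  have h1 := prod_range_one_sub (by omega) hζ 1
  simp only [mul_one, one_pow] at h1
  rw [← h1, two_mul s, Finset.prod_range_add]
  congr 1
  rw [← Finset.prod_range_reflect]
  refine Finset.prod_congr rfl fun k hk => ?_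
  rw [Finset.mem_range] at hk
  congr 3
  rw [inv_eq_iff_eq_inv, ← one_div, eq_div_iff (pow_ne_zero _ (hζ.ne_zero (by omega))), ← pow_add]
  rw [show 2 * (s - 1 - k) + 1 + (2 * (s + k) + 1) = 2 * (2 * s) by omega, hζ.pow_eq_one]

/-- Multiplying `x` by all odd powers of a primitive root of unity of order `4 s` turns `1 - x z`
into `1 + (x z) ^ (2 s)`. The roots of unity themselves contribute only half of these powers, and
their inverses the other half. -/
theorem eser_double_twist {n s : ℕ} (hs : 0 < s) {ω : ℂ} (hω : IsPrimitiveRoot ω (4 * s))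
    (hT : 2 * s ≠ 0) :
    eser (double (Xω (4 * s) n ω)) =
      PowerSeries.expand (2 * s) hT (eser (fun i => -recip (Xpow n (2 * s)) i)) := by
  have hc : const n ω = algebraMap ℂ (RatFun n) ω := rfl
  have hζ : IsPrimitiveRoot (const n ω) (2 * (2 * s)) := by
    rw [hc, show 2 * (2 * s) = 4 * s by ring]
    exact hω.map_of_injective (algebraMap ℂ (RatFun n)).injective
  have e1 : 4 * s / 2 = 2 * s := by omega
  have e2 : 4 * s / 4 = s := by omega
  have h1 : eser (Xω (4 * s) n ω) =
      (∏ i : Fin n, (1 - PowerSeries.C (-x i ^ (2 * s)) * PowerSeries.X ^ (2 * s))) *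
      ∏ k ∈ Finset.range s, (1 - PowerSeries.C (const n ω ^ (2 * k + 1)) * PowerSeries.X) := by
    simp only [eser, Xω, Fintype.prod_sum_type, Sum.elim_inl, Sum.elim_inr]
    rw [Fintype.prod_prod_type_right, Fin.prod_univ_eq_prod_range
      (fun k => (1 - PowerSeries.C (const n ω ^ (2 * k + 1)) * PowerSeries.X)), e2]
    congr 1
    refine Finset.prod_congr rfl fun i _ => ?_
    rw [← prod_range_one_sub (by omega) hζ, Fin.prod_univ_eq_prod_range
      (fun k => (1 - PowerSeries.C (const n ω ^ (2 * k + 1) * x i) * PowerSeries.X)), e1]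
  have h2 : eser (fun i => (Xω (4 * s) n ω i)⁻¹) =
      (∏ i : Fin n, (1 - PowerSeries.C (-(x i)⁻¹ ^ (2 * s)) * PowerSeries.X ^ (2 * s))) *
      ∏ k ∈ Finset.range s, (1 - PowerSeries.C (const n ω ^ (2 * k + 1))⁻¹ * PowerSeries.X) := by
    simp only [eser, Xω, Fintype.prod_sum_type, Sum.elim_inl, Sum.elim_inr]
    rw [Fintype.prod_prod_type_right, Fin.prod_univ_eq_prod_range
      (fun k => (1 - PowerSeries.C (const n ω ^ (2 * k + 1))⁻¹ * PowerSeries.X)), e2]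
    congr 1
    refine Finset.prod_congr rfl fun i _ => ?_
    rw [← prod_range_one_sub (by omega) hζ.inv, Fin.prod_univ_eq_prod_range
      (fun k => (1 - PowerSeries.C (const n ω ^ (2 * k + 1) * x i)⁻¹ * PowerSeries.X)), e1]
    simp only [mul_inv, inv_pow]
  have h3 : PowerSeries.expand (2 * s) hT (eser (fun i => -recip (Xpow n (2 * s)) i)) =
      ((∏ i : Fin n, (1 - PowerSeries.C (-x i ^ (2 * s)) * PowerSeries.X ^ (2 * s))) *
      (∏ i : Fin n, (1 - PowerSeries.C (-(x i)⁻¹ ^ (2 * s)) * PowerSeries.X ^ (2 * s)))) *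
      (1 - PowerSeries.C (-1) * PowerSeries.X ^ (2 * s)) := by
    simp only [eser, recip, snoc, double, Xpow, Fintype.prod_sum_type, Sum.elim_inl, Sum.elim_inr,
      map_mul, map_prod, map_sub, map_one, PowerSeries.expand_C, PowerSeries.expand_X,
      Finset.univ_unique, Finset.prod_singleton, inv_pow]
  rw [eser_double, h1, h2, h3, ← prod_range_one_sub_half hs hζ]
  ring

/-- The complete homogeneous functions of the twisted alphabet vanish in the degrees that are
not divisible by `2 s`. -/
theorem h_double_twist {n s : ℕ} (hs : 0 < s) {ω : ℂ} (hω : IsPrimitiveRoot ω (4 * s)) (k : ℤ) :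
    h (double (Xω (4 * s) n ω)) k = if ((2 * s : ℕ) : ℤ) ∣ k then
      (-1) ^ (k / (2 * s : ℕ)) * h (recip (Xpow n (2 * s))) (k / (2 * s : ℕ)) else 0 := by
  rw [h_of_expand (by omega) (eser_double_twist hs hω (by omega)), h_neg_family]

end Twist

/-! ### Orthogonal cores and class counts -/

section Partitions

variable {p : ℕ → ℕ}

theorem lt_ncard_setOf_iff {P : ℕ → Prop} (hP : ∀ i j, i ≤ j → P j → P i) (hfin : {i | P i}.Finite)
    (i : ℕ) : i < {i | P i}.ncard ↔ P i := by
  constructor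
  · intro hi
    by_contra hc
    have hsub : {i | P i} ⊆ (Finset.range i : Set ℕ) := fun j hj => by
      rw [Finset.mem_coe, Finset.mem_range]
      by_contra hij
      exact hc (hP i j (not_lt.mp hij) hj)
    have := Set.ncard_le_ncard hsub (Finset.finite_toSet _)
    rw [Set.ncard_coe_finset, Finset.card_range] at this
    omega
  · intro hi
    have hsub : (Finset.range (i + 1) : Set ℕ) ⊆ {i | P i} := fun j hj =>
      hP j i (Nat.lt_succ_iff.mp (Finset.mem_range.mp (Finset.mem_coe.mp hj))) hi
    have := Set.ncard_le_ncard hsub hfin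
    rw [Set.ncard_coe_finset, Finset.card_range] at this
    omega

theorem lt_length_iff (hp : IsPartition p) (i : ℕ) : i < length p ↔ p i ≠ 0 :=
  lt_ncard_setOf_iff (P := fun i => p i ≠ 0)
    (fun i j hij hj => by have := hp.1 hij; omega) hp.2 i

theorem length_le_iff (hp : IsPartition p) (k : ℕ) : length p ≤ k ↔ ∀ i, k ≤ i → p i = 0 := by
  constructor
  · intro hk i hi
    by_contra hc
    have := (lt_length_iff hp i).mpr hc
    omega
  · intro hk
    by_contra hc
    exact (lt_length_iff hp k).mp (not_le.mp hc) (hk k le_rfl)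

theorem lt_conj_iff (hp : IsPartition p) (i j : ℕ) : i < conj p j ↔ j < p i :=
  lt_ncard_setOf_iff (P := fun i => j + 1 ≤ p i)
    (fun i j hij hj => hj.trans (hp.1 hij))
    (hp.2.subset fun i hi => by have : j + 1 ≤ p i := hi; exact (by omega : p i ≠ 0)) i

theorem lt_rank_iff (hp : IsPartition p) (i : ℕ) : i < rank p ↔ i < p i := by
  have hbdd : BddAbove {k | 1 ≤ k ∧ k ≤ p (k - 1)} :=
    ⟨p 0, fun k hk => hk.2.trans (hp.1 (Nat.zero_le _))⟩
  constructor
  · intro hi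
    have hne : {k | 1 ≤ k ∧ k ≤ p (k - 1)}.Nonempty := by
      by_contra hc
      rw [Set.not_nonempty_iff_eq_empty] at hc
      rw [rank, hc] at hi
      simp at hi
    have hmem := Nat.sSup_mem hne hbdd
    change 1 ≤ rank p ∧ rank p ≤ p (rank p - 1) at hmem
    have := hp.1 (show i ≤ rank p - 1 by omega)
    omega
  · intro hi
    have : i + 1 ≤ rank p := le_csSup hbdd ⟨by omega, by simpa using hi⟩
    omega

theorem conj_antitone (hp : IsPartition p) : Antitone (conj p) := by
  intro i j hij
  by_contra hc
  have h1 := (lt_conj_iff hp _ _).mp (not_le.mp hc)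
  have h2 := (lt_conj_iff hp (conj p i) i).mpr (by omega)
  omega

/-- The numbers `p i - i - 1` and `j - conj p j` together exhaust the integers, without overlap. -/
theorem exists_part_iff_not_exists_conj (hp : IsPartition p) (z : ℤ) :
    (∃ i : ℕ, (p i : ℤ) - i - 1 = z) ↔ ¬ ∃ j : ℕ, (j : ℤ) - conj p j = z := by
  constructor
  · rintro ⟨i, hi⟩ ⟨j, hj⟩
    have := lt_conj_iff hp i j
    omega
  · intro hz
    by_contra hc
    push Not at hz hc
    have hex : ∃ i : ℕ, (p i : ℤ) - i - 1 < z := by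
      refine ⟨p 0 + z.natAbs, ?_⟩
      have := hp.1 (Nat.zero_le (p 0 + z.natAbs))
      omega
    classical
    obtain ⟨i, hi, hmin⟩ : ∃ i : ℕ, (p i : ℤ) - i - 1 < z ∧ ∀ i' < i, z ≤ (p i' : ℤ) - i' - 1 :=
      ⟨Nat.find hex, Nat.find_spec hex, fun i' hi' => not_lt.mp (Nat.find_min hex hi')⟩
    have hj0 : 0 ≤ z + i := by omega
    lift z + i to ℕ using hj0 with j hj
    apply hz j
    -- row `i` is the first one whose part lies below column `j`
    have hcj : conj p j = i := by
      apply le_antisymm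
      · by_contra h1
        have := (lt_conj_iff hp i j).mp (not_le.mp h1)
        omega
      · by_contra h1
        have h2 := hmin (i - 1) (by omega)
        have h3 := hc (i - 1)
        have h4 := lt_conj_iff hp (i - 1) j
        omega
    omega

/-- Orthogonality says that the arms `p i - i - 1 ≥ 0` are the shifted legs `conj p j - j ≥ 1`. -/
theorem isOrthogonal_iff_forall (hp : IsPartition p) :
    IsOrthogonal p ↔ ∀ z : ℤ, 0 ≤ z → ((∃ i : ℕ, (p i : ℤ) - i - 1 = z) ↔
      1 ≤ z ∧ ∃ j : ℕ, (conj p j : ℤ) - j = z) := by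
  constructor
  · intro ho z hz
    have key : ∀ i, i < p i → p i = conj p i + 1 := fun i hi => by
      have h1 := ho i ((lt_rank_iff hp i).mpr hi)
      have h2 := (lt_conj_iff hp i i).mpr hi
      simp only [arm, leg] at h1
      omega
    constructor
    · rintro ⟨i, hi⟩
      have h1 := key i (by omega)
      have h2 := (lt_conj_iff hp i i).mpr (by omega)
      exact ⟨by omega, i, by omega⟩
    · rintro ⟨hz1, j, hj⟩
      have h2 := (lt_conj_iff hp j j).mp (by omega)
      have h1 := key j h2
      exact ⟨j, by omega⟩
  · intro hall
    have key : ∀ i, i < p i → p i = conj p i + 1 := by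
      intro i
      induction i using Nat.strong_induction_on with
      | _ i ih =>
        intro hi
        have hci := (lt_conj_iff hp i i).mpr hi
        obtain ⟨hz, j, hj⟩ := (hall ((p i : ℤ) - i - 1) (by omega)).mp ⟨i, rfl⟩
        obtain ⟨k, hk⟩ := (hall ((conj p i : ℤ) - i) (by omega)).mpr ⟨by omega, i, rfl⟩
        have hij : i ≤ j := by
          by_contra hc
          have h1 := ih j (by omega) ((lt_conj_iff hp j j).mp (by omega))
          have h2 := hp.1 (show j ≤ i by omega)
          omega
        have hik : i ≤ k := by
          by_contra hc
          have h1 := ih k (by omega) (by omega)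
          have h2 := conj_antitone hp (show k ≤ i by omega)
          omega
        have h1 := conj_antitone hp hij
        have h2 := hp.1 hik
        omega
    intro i hi
    have h1 := (lt_rank_iff hp i).mp hi
    have h2 := (lt_conj_iff hp i i).mpr h1
    have h3 := key i h1
    simp only [arm, leg]
    omega

end Partitions

section BetaSets

variable {B : Finset ℕ}

theorem le_orderEmbOfFin {k : ℕ} (hk : B.card = k) (i : Fin k) :
    (i : ℕ) ≤ B.orderEmbOfFin hk i := by
  obtain ⟨i, hi⟩ := i
  induction i with
  | zero => simp
  | succ i ih =>
    have h1 := ih (by omega)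
    have h2 : B.orderEmbOfFin hk ⟨i, by omega⟩ < B.orderEmbOfFin hk ⟨i + 1, hi⟩ :=
      (B.orderEmbOfFin hk).strictMono (by simp [Fin.lt_def])
    simp only at h1 ⊢
    omega

theorem orderEmbOfFin_eq_self {k d : ℕ} (hk : B.card = k) (hd : Finset.range d ⊆ B) (i : Fin k)
    (hi : (i : ℕ) < d) : B.orderEmbOfFin hk i = i := by
  obtain ⟨i, hik⟩ := i
  induction i using Nat.strong_induction_on with
  | _ i ih =>
    simp only at hi ⊢
    have hmem : i ∈ B := hd (Finset.mem_range.mpr hi)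
    have : i ∈ Set.range (B.orderEmbOfFin hk) := by rwa [Finset.range_orderEmbOfFin]
    obtain ⟨j, hj⟩ := this
    have h1 := le_orderEmbOfFin hk j
    rcases lt_or_eq_of_le (hj ▸ h1) with h2 | h2
    · have h3 := ih j h2 j.2 (show (j : ℕ) < d by omega)
      change B.orderEmbOfFin hk j = j at h3
      omega
    · have h4 : (⟨i, hik⟩ : Fin k) = j := Fin.ext h2.symm
      rw [h4, hj]

theorem ofBetaSet_add {i : ℕ} (hi : i < B.card) :
    ofBetaSet B i + (B.card - 1 - i) = B.orderEmbOfFin rfl (Fin.rev ⟨i, hi⟩) := by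
  have h1 := le_orderEmbOfFin rfl (Fin.rev ⟨i, hi⟩)
  rw [Fin.val_rev] at h1
  simp only [ofBetaSet, hi, dite_true]
  simp only at h1
  omega

theorem ofBetaSet_of_card_le {i : ℕ} (hi : B.card ≤ i) : ofBetaSet B i = 0 := by
  simp [ofBetaSet, not_lt.mpr hi]

theorem ofBetaSet_add_mem {i : ℕ} (hi : i < B.card) : ofBetaSet B i + (B.card - 1 - i) ∈ B := by
  rw [ofBetaSet_add hi]; exact Finset.orderEmbOfFin_mem _ _ _

theorem exists_ofBetaSet_add {b : ℕ} (hb : b ∈ B) :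
    ∃ i < B.card, ofBetaSet B i + (B.card - 1 - i) = b := by
  have : b ∈ Set.range (B.orderEmbOfFin rfl) := by rwa [Finset.range_orderEmbOfFin]
  obtain ⟨j, hj⟩ := this
  refine ⟨Fin.rev j, (Fin.rev j).2, ?_⟩
  rw [ofBetaSet_add (Fin.rev j).2, Fin.eta, Fin.rev_rev, hj]

theorem ofBetaSet_antitone : Antitone (ofBetaSet B) := by
  refine antitone_nat_of_succ_le fun i => ?_
  by_cases hi : i + 1 < B.card
  · have h1 := ofBetaSet_add hi
    have h2 := ofBetaSet_add (B := B) (i := i) (by omega)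
    have h3 : B.orderEmbOfFin rfl (Fin.rev ⟨i + 1, hi⟩) <
        B.orderEmbOfFin rfl (Fin.rev ⟨i, by omega⟩) :=
      (B.orderEmbOfFin rfl).strictMono (Fin.rev_lt_rev.mpr (by simp [Fin.lt_def]))
    omega
  · rw [ofBetaSet_of_card_le (not_lt.mp hi)]; exact Nat.zero_le _

theorem ofBetaSet_isPartition : IsPartition (ofBetaSet B) :=
  ⟨ofBetaSet_antitone, (Set.finite_Iio B.card).subset fun i hi => by
    by_contra hc
    exact hi (ofBetaSet_of_card_le (not_lt.mp hc))⟩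

theorem ofBetaSet_eq_zero {d i : ℕ} (hd : Finset.range d ⊆ B) (hi : B.card ≤ i + d) :
    ofBetaSet B i = 0 := by
  by_cases hik : i < B.card
  · have h1 := ofBetaSet_add hik
    have hlt : ((Fin.rev ⟨i, hik⟩ : Fin B.card) : ℕ) < d := by rw [Fin.val_rev]; simp only; omega
    rw [orderEmbOfFin_eq_self rfl hd _ hlt, Fin.val_rev] at h1
    simp only at h1
    omega
  · exact ofBetaSet_of_card_le (not_lt.mp hik)

theorem mem_iff_exists_part (z : ℕ) :
    z ∈ B ↔ ∃ i : ℕ, (ofBetaSet B i : ℤ) - i - 1 = (z : ℤ) - B.card := by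
  constructor
  · intro hz
    obtain ⟨i, hi, h1⟩ := exists_ofBetaSet_add hz
    exact ⟨i, by omega⟩
  · rintro ⟨i, hi⟩
    have hik : i < B.card := by
      by_contra hc
      rw [ofBetaSet_of_card_le (not_lt.mp hc)] at hi
      push_cast at hi
      omega
    have h1 := ofBetaSet_add_mem hik
    rwa [show ofBetaSet B i + (B.card - 1 - i) = z by omega] at h1

/-- A partition with beta-set `B` is orthogonal if and only if the reflection of `ℤ` in the
cardinality of `B` exchanges `B`, enlarged by the negative integers, with its complement, apart from
the center of the reflection, which must not belong to `B`. -/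
theorem isOrthogonal_ofBetaSet_iff : IsOrthogonal (ofBetaSet B) ↔
    ∀ d : ℕ, B.card + d ∈ B ↔ 1 ≤ d ∧ d ≤ B.card ∧ B.card - d ∉ B := by
  have hp := ofBetaSet_isPartition (B := B)
  have key : ∀ d : ℕ, 1 ≤ d → ((∃ j : ℕ, (conj (ofBetaSet B) j : ℤ) - j = d) ↔
      d ≤ B.card ∧ B.card - d ∉ B) := by
    intro d hd
    have h1 : ∀ j, conj (ofBetaSet B) j ≤ B.card := fun j => by
      by_contra hc
      have := (lt_conj_iff hp _ _).mp (not_le.mp hc)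
      rw [ofBetaSet_of_card_le le_rfl] at this
      omega
    by_cases hdm : d ≤ B.card
    · rw [mem_iff_exists_part, exists_part_iff_not_exists_conj hp, not_not]
      simp only [hdm, true_and]
      exact exists_congr fun j => by omega
    · simp only [hdm, false_and, iff_false, not_exists]
      intro j hj
      have := h1 j
      omega
  rw [isOrthogonal_iff_forall hp]
  constructor
  · intro hall d
    have h1 := hall d (by omega)
    rw [mem_iff_exists_part]
    push_cast
    rw [add_sub_cancel_left, h1]
    by_cases hd : 1 ≤ d
    · rw [← key d hd]; simp [hd]
    · simp [show d = 0 by omega]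
  · intro hall z hz
    lift z to ℕ using hz
    have h1 := hall z
    rw [mem_iff_exists_part] at h1
    push_cast at h1
    rw [add_sub_cancel_left] at h1
    rw [h1]
    by_cases hd : 1 ≤ z
    · rw [← key z hd]; simp [hd]
    · simp [show z = 0 by omega]

end BetaSets

section CoreQuotient

variable {lam : ℕ → ℕ} {m T : ℕ}

theorem beta_strictAnti (hlam : Antitone lam) : StrictAnti (beta lam m) := by
  intro i j hij
  have h1 := hlam (show (i : ℕ) ≤ j from hij.le)
  have h2 : (i : ℕ) < j := hij
  have := j.2
  simp only [beta]
  omega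

theorem card_betaSet (hlam : Antitone lam) : (betaSet lam m).card = m := by
  rw [betaSet, Finset.card_image_of_injective _ (beta_strictAnti hlam).injective]; simp

theorem sum_classCount (hlam : Antitone lam) (hT : 0 < T) :
    ∑ r ∈ Finset.range T, classCount T lam m r = m := by
  conv_rhs => rw [← card_betaSet (m := m) hlam]
  exact (Finset.card_eq_sum_card_fiberwise (fun b _ =>
    Finset.mem_coe.mpr (Finset.mem_range.mpr (Nat.mod_lt b hT)))).symm

theorem mem_coreSet (hT : 0 < T) (c : ℕ → ℕ) {j r : ℕ} (hr : r < T) :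
    T * j + r ∈ (Finset.range T).biUnion (fun i => (Finset.range (c i)).image fun j => T * j + i) ↔
      j < c r := by
  simp only [Finset.mem_biUnion, Finset.mem_image, Finset.mem_range]
  constructor
  · rintro ⟨r', hr', j', hj', h1⟩
    have h2 := congrArg (· % T) h1
    have h3 := congrArg (· / T) h1
    simp only [Nat.mul_add_mod, Nat.mod_eq_of_lt hr, Nat.mod_eq_of_lt hr',
      Nat.mul_add_div hT, Nat.div_eq_of_lt hr, Nat.div_eq_of_lt hr', add_zero] at h2 h3
    subst h2 h3
    exact hj'
  · intro hj
    exact ⟨r, hr, j, hj, rfl⟩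

theorem card_coreSet (hT : 0 < T) (c : ℕ → ℕ) :
    ((Finset.range T).biUnion
      (fun i => (Finset.range (c i)).image fun j => T * j + i)).card =
      ∑ r ∈ Finset.range T, c r := by
  rw [Finset.card_biUnion]
  · refine Finset.sum_congr rfl fun r _ => ?_
    rw [Finset.card_image_of_injective, Finset.card_range]
    intro a b hab
    exact Nat.eq_of_mul_eq_mul_left hT (by simpa using hab)
  · intro r hr r' hr' hne
    change Disjoint _ _
    rw [Finset.disjoint_left]
    intro b hb hb'
    simp only [Finset.mem_image, Finset.mem_range] at hb hb' hr hr'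
    obtain ⟨j, -, rfl⟩ := hb
    obtain ⟨j', -, h1⟩ := hb'
    have h2 := congrArg (· % T) h1
    simp only [Nat.mul_add_mod, Finset.mem_coe, Finset.mem_range] at h2 hr hr'
    rw [Nat.mod_eq_of_lt hr, Nat.mod_eq_of_lt hr'] at h2
    exact hne h2.symm

/-- The core is orthogonal if and only if the class counts are balanced. -/
theorem isOrthogonal_core_iff (hlam : Antitone lam) (hT : 0 < T) {M : ℕ} :
    IsOrthogonal (core T lam (T * M)) ↔ classCount T lam (T * M) 0 = M ∧
      ∀ r, 1 ≤ r → r < T →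
        classCount T lam (T * M) r + classCount T lam (T * M) (T - r) = 2 * M := by
  rw [core, isOrthogonal_ofBetaSet_iff, card_coreSet hT, sum_classCount hlam hT]
  set c := classCount T lam (T * M) with hc
  set C := (Finset.range T).biUnion fun i => (Finset.range (c i)).image fun j => T * j + i with hC
  -- The reflection in `T M` exchanges the class `r` with the class `T - r`, so the criterion splits
  -- into conditions on the class `0` and on pairs of opposite classes.
  have hzero : ∀ j, (T * M + T * j ∈ C ↔ 1 ≤ T * j ∧ T * j ≤ T * M ∧ T * M - T * j ∉ C) ↔
      (M + j < c 0 ↔ 1 ≤ j ∧ j ≤ M ∧ ¬ M - j < c 0) := by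
    intro j
    rw [← mul_add, ← add_zero (T * (M + j)), mem_coreSet hT c hT, ← Nat.mul_sub,
      ← add_zero (T * (M - j)), mem_coreSet hT c hT, Nat.mul_le_mul_left_iff hT,
      Nat.one_le_iff_ne_zero, Nat.one_le_iff_ne_zero]
    simp [hT.ne']
  have hpos : ∀ r, 1 ≤ r → r < T → ∀ j, (T * M + (T * j + r) ∈ C ↔
      1 ≤ T * j + r ∧ T * j + r ≤ T * M ∧ T * M - (T * j + r) ∉ C) ↔
      (M + j < c r ↔ j < M ∧ ¬ M - 1 - j < c (T - r)) := by
    intro r hr1 hrT j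
    rw [← add_assoc, ← mul_add, mem_coreSet hT c hrT]
    have e1 : T * j + r ≤ T * M ↔ j < M := by
      constructor
      · intro h2
        by_contra h3
        have := Nat.mul_le_mul_left T (not_lt.mp h3)
        omega
      · intro h2
        have := Nat.mul_le_mul_left T (Nat.succ_le_of_lt h2)
        rw [Nat.mul_succ] at this
        omega
    have e2 : j < M → T * M - (T * j + r) = T * (M - 1 - j) + (T - r) := by
      intro h2
      obtain ⟨k, rfl⟩ := Nat.exists_eq_add_of_lt h2
      rw [show j + k + 1 - 1 - j = k by omega]
      simp only [mul_add, mul_one]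
      omega
    rw [e1]
    refine iff_congr Iff.rfl ⟨fun ⟨_, h2, h3⟩ => ⟨h2, ?_⟩, fun ⟨h2, h3⟩ => ⟨by omega, h2, ?_⟩⟩
    · rwa [e2 h2, mem_coreSet hT c (by omega)] at h3
    · rwa [e2 h2, mem_coreSet hT c (by omega)]
  constructor
  · intro hall
    have hz := fun j => (hzero j).mp (hall _)
    have hp := fun r hr1 hrT j => (hpos r hr1 hrT j).mp (hall _)
    constructor
    · have h0 := hz 0
      have h1 := hz 1
      omega
    · intro r hr1 hrT
      have hp' := hp (T - r) (by omega) (by omega)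
      rw [Nat.sub_sub_self hrT.le] at hp'
      have a1 := hp r hr1 hrT 0
      have a2 := hp r hr1 hrT (c r - M - 1)
      have a3 := hp r hr1 hrT (c r - M)
      have b1 := hp' 0
      have b2 := hp' (c (T - r) - M - 1)
      have b3 := hp' (c (T - r) - M)
      omega
  · rintro ⟨h0, hpair⟩ d
    by_cases hd : d % T = 0
    · rw [← Nat.div_add_mod d T, hd, add_zero, hzero]
      generalize d / T = j
      omega
    · have hlt := Nat.mod_lt d hT
      rw [← Nat.div_add_mod d T, hpos _ (by omega) hlt]
      have := hpair (d % T) (by omega) hlt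
      generalize d / T = j
      omega

end CoreQuotient

/-! ### The block decomposition of the Jacobi-Trudi matrix -/

section Rows

variable {s n : ℕ} {lam : ℕ → ℕ}

/-- An index set for the rows and the columns of the Jacobi-Trudi matrix that displays its block
decomposition: the residue class `0` modulo `2 s`, the pairs of classes `± (r + 1)`, and the
class `s`. -/
abbrev BlockIndex (s n : ℕ) : Type :=
  Fin n ⊕ ((Fin (2 * n + 1) × Fin (s - 1)) ⊕ Fin (n + 1))

theorem card_blockIndex (hs : 0 < s) : Fintype.card (BlockIndex s n) = s * (2 * n + 1) := by
  obtain ⟨s, rfl⟩ := Nat.exists_eq_succ_of_ne_zero hs.ne'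
  simp; ring

/-- The residue class, up to sign, of a block. -/
def blockClass (s n : ℕ) : BlockIndex s n → ℕ :=
  Sum.elim (fun _ => 0) (Sum.elim (fun lr => lr.2 + 1) fun _ => s)

/-- The number (from `1`) of the column with a given index. In a block for a pair of classes, the
columns are listed so that `± column` increases. -/
def colVal (s n : ℕ) : BlockIndex s n → ℕ :=
  Sum.elim (fun l => 2 * s * (l + 1))
    (Sum.elim (fun lr => if (lr.1 : ℕ) ≤ n then 2 * s * (n - lr.1) + (lr.2 + 1)
      else 2 * s * (lr.1 - n) - (lr.2 + 1)) fun l => 2 * s * l + s)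

/-- The beta-set entry of the row with a given index, in terms of the class counts `c` and the
quotient `Q`. In a block for a pair of classes, the entries of the first class decrease and are
followed by those of the second class, which increase. -/
def rowVal (s n : ℕ) (c : ℕ → ℕ) (Q : ℕ → ℕ → ℕ) : BlockIndex s n → ℕ :=
  Sum.elim (fun l => 2 * s * (Q 0 l + (c 0 - 1 - l)))
    (Sum.elim (fun lr => if (lr.1 : ℕ) + (n + 1) < c (lr.2 + 1) then
        2 * s * (Q (lr.2 + 1) lr.1 + (c (lr.2 + 1) - 1 - lr.1)) + (lr.2 + 1)
      else 2 * s * (Q (2 * s - (lr.2 + 1)) (2 * n - lr.1) +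
        (c (2 * s - (lr.2 + 1)) - 1 - (2 * n - lr.1))) + (2 * s - (lr.2 + 1)))
      fun l => 2 * s * (Q s l + (c s - 1 - l)) + s)

/-- The entries of the beta-set belonging to the rows of the Jacobi-Trudi matrix. -/
def topVal (s n : ℕ) (lam : ℕ → ℕ) (i : Fin (s * (2 * n + 1))) : ℕ :=
  lam i + (2 * s * (2 * n + 1) - 1 - i)

/-- The class counts of the beta-set are those of the empty partition, up to exchanging
opposite classes. -/
def Balanced (s n : ℕ) (c : ℕ → ℕ) : Prop :=
  c 0 = 2 * n + 1 ∧ c s = 2 * n + 1 ∧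
    ∀ r, 1 ≤ r → r < s → c r + c (2 * s - r) = 2 * (2 * n + 1)

/-- The number of entries smaller than `s (2 n + 1)` in a residue class modulo `2 s`. -/
def lowCount (s n r : ℕ) : ℕ := if r < s then n + 1 else n

theorem lt_lowCount_iff {r : ℕ} (hr : r < 2 * s) (j : ℕ) :
    j < lowCount s n r ↔ 2 * s * j + r < s * (2 * n + 1) := by
  have h1 : s * (2 * n + 1) = 2 * s * n + s := by ring
  rw [h1, lowCount]
  constructor
  · intro hj
    split_ifs at hj with hrs
    · have := Nat.mul_le_mul_left (2 * s) (Nat.lt_succ_iff.mp hj)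
      omega
    · have := Nat.mul_le_mul_left (2 * s) (Nat.succ_le_of_lt hj)
      rw [Nat.mul_succ] at this
      omega
  · intro hj
    by_contra hc
    split_ifs at hc with hrs
    · have := Nat.mul_le_mul_left (2 * s) (not_lt.mp hc)
      rw [Nat.mul_succ] at this
      omega
    · have := Nat.mul_le_mul_left (2 * s) (not_lt.mp hc)
      omega

theorem two_s_mul (s n : ℕ) : 2 * s * (2 * n + 1) = s * (2 * n + 1) + s * (2 * n + 1) := by ring

theorem range_subset_betaSet (hlen : ∀ i, s * (2 * n + 1) ≤ i → lam i = 0) :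
    Finset.range (s * (2 * n + 1)) ⊆ betaSet lam (2 * s * (2 * n + 1)) := by
  intro b hb
  rw [Finset.mem_range] at hb
  have h1 := two_s_mul s n
  rw [betaSet, Finset.mem_image]
  refine ⟨⟨2 * s * (2 * n + 1) - 1 - b, by omega⟩, Finset.mem_univ _, ?_⟩
  simp only [beta]
  rw [hlen _ (by omega)]
  omega

theorem topVal_mem (i : Fin (s * (2 * n + 1))) :
    topVal s n lam i ∈ betaSet lam (2 * s * (2 * n + 1)) := by
  have h1 := two_s_mul s n
  rw [betaSet, Finset.mem_image]
  exact ⟨⟨i, by omega⟩, Finset.mem_univ _, rfl⟩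

theorem le_topVal (i : Fin (s * (2 * n + 1))) : s * (2 * n + 1) ≤ topVal s n lam i := by
  have h1 := two_s_mul s n
  have := i.2
  simp only [topVal]
  omega

theorem topVal_strictAnti (hlam : Antitone lam) : StrictAnti (topVal s n lam) := by
  intro i j hij
  have h1 := hlam (show (i : ℕ) ≤ j from hij.le)
  have h2 : (i : ℕ) < j := hij
  have := j.2
  have h1 := two_s_mul s n
  simp only [topVal]
  omega

/-- The beta-set consists of the entries of the rows and of all numbers below `s (2 n + 1)`. -/
theorem betaSet_eq (hlen : ∀ i, s * (2 * n + 1) ≤ i → lam i = 0) :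
    betaSet lam (2 * s * (2 * n + 1)) =
      Finset.univ.image (topVal s n lam) ∪ Finset.range (s * (2 * n + 1)) := by
  apply Finset.Subset.antisymm
  · intro b hb
    rw [betaSet, Finset.mem_image] at hb
    obtain ⟨i, -, rfl⟩ := hb
    rw [Finset.mem_union]
    by_cases hi : (i : ℕ) < s * (2 * n + 1)
    · exact .inl (Finset.mem_image.mpr ⟨⟨i, hi⟩, Finset.mem_univ _, rfl⟩)
    · right
      have h1 := two_s_mul s n
      have := i.2
      rw [Finset.mem_range, beta, hlen _ (not_lt.mp hi)]
      omega
  · refine Finset.union_subset ?_ (range_subset_betaSet hlen)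
    intro b hb
    obtain ⟨i, -, rfl⟩ := Finset.mem_image.mp hb
    exact topVal_mem i

theorem card_quoSet (T : ℕ) (m r : ℕ) :
    ((betaClass T lam m r).image fun b => b / T).card = classCount T lam m r := by
  rw [classCount, Finset.card_image_of_injOn]
  intro a ha b hb hab
  simp only [betaClass, Finset.coe_filter, Set.mem_ofPred_eq] at ha hb
  rw [← Nat.div_add_mod a T, ← Nat.div_add_mod b T, ha.2, hb.2, show a / T = b / T from hab]

theorem range_lowCount_subset (hlen : ∀ i, s * (2 * n + 1) ≤ i → lam i = 0) {r : ℕ}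
    (hr : r < 2 * s) : Finset.range (lowCount s n r) ⊆
      (betaClass (2 * s) lam (2 * s * (2 * n + 1)) r).image fun b => b / (2 * s) := by
  intro j hj
  rw [Finset.mem_range, lt_lowCount_iff hr] at hj
  rw [Finset.mem_image]
  refine ⟨2 * s * j + r, ?_, ?_⟩
  · rw [betaClass, Finset.mem_filter]
    exact ⟨range_subset_betaSet hlen (Finset.mem_range.mpr hj),
      by rw [Nat.mul_add_mod, Nat.mod_eq_of_lt hr]⟩
  · rw [Nat.mul_add_div (by omega), Nat.div_eq_of_lt hr, add_zero]

theorem lowCount_le (hlen : ∀ i, s * (2 * n + 1) ≤ i → lam i = 0) {r : ℕ} (hr : r < 2 * s) :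
    lowCount s n r ≤ classCount (2 * s) lam (2 * s * (2 * n + 1)) r := by
  have := Finset.card_le_card (range_lowCount_subset hlen hr)
  rwa [Finset.card_range, card_quoSet] at this

theorem quo_eq_zero (hlen : ∀ i, s * (2 * n + 1) ≤ i → lam i = 0) {r i : ℕ} (hr : r < 2 * s)
    (hi : classCount (2 * s) lam (2 * s * (2 * n + 1)) r ≤ i + lowCount s n r) :
    quo (2 * s) lam (2 * s * (2 * n + 1)) r i = 0 := by
  refine ofBetaSet_eq_zero (range_lowCount_subset hlen hr) ?_
  rwa [card_quoSet]

theorem exists_quo_add (hlen : ∀ i, s * (2 * n + 1) ≤ i → lam i = 0) {b r : ℕ}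
    (hb : b ∈ betaSet lam (2 * s * (2 * n + 1))) (hb' : s * (2 * n + 1) ≤ b) (hs : 0 < s)
    (hr : b % (2 * s) = r) :
    ∃ l, l + lowCount s n r < classCount (2 * s) lam (2 * s * (2 * n + 1)) r ∧
      2 * s * (quo (2 * s) lam (2 * s * (2 * n + 1)) r l +
        (classCount (2 * s) lam (2 * s * (2 * n + 1)) r - 1 - l)) + r = b := by
  have hrs : r < 2 * s := hr ▸ Nat.mod_lt _ (by omega)
  have hmem : b / (2 * s) ∈
      (betaClass (2 * s) lam (2 * s * (2 * n + 1)) r).image fun b => b / (2 * s) :=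
    Finset.mem_image.mpr ⟨b, Finset.mem_filter.mpr ⟨hb, hr⟩, rfl⟩
  obtain ⟨l, hl, h1⟩ := exists_ofBetaSet_add hmem
  rw [card_quoSet] at hl h1
  change quo (2 * s) lam (2 * s * (2 * n + 1)) r l + _ = _ at h1
  refine ⟨l, ?_, ?_⟩
  · by_contra hc
    rw [quo_eq_zero hlen hrs (not_lt.mp hc)] at h1
    have h2 := (lt_lowCount_iff (n := n) hrs (b / (2 * s))).not
    rw [← hr, Nat.div_add_mod, hr] at h2
    omega
  · rw [h1, ← hr, Nat.div_add_mod]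

/-- Every row belongs to a block. -/
theorem exists_rowVal (hs : 0 < s) (hlen : ∀ i, s * (2 * n + 1) ≤ i → lam i = 0)
    (hbal : Balanced s n (classCount (2 * s) lam (2 * s * (2 * n + 1))))
    (i : Fin (s * (2 * n + 1))) :
    ∃ x : BlockIndex s n, rowVal s n (classCount (2 * s) lam (2 * s * (2 * n + 1)))
      (quo (2 * s) lam (2 * s * (2 * n + 1))) x = topVal s n lam i := by
  obtain ⟨l, hl, h1⟩ := exists_quo_add hlen (topVal_mem i) (le_topVal i) hs rfl
  set c := classCount (2 * s) lam (2 * s * (2 * n + 1))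
  set r := topVal s n lam i % (2 * s) with hr
  have hrs : r < 2 * s := Nat.mod_lt _ (by omega)
  obtain ⟨hb0, hbs, hbp⟩ := hbal
  rw [← h1]
  simp only [lowCount] at hl
  rcases Nat.eq_zero_or_pos r with h0 | h0
  · rw [h0, if_pos hs] at hl
    exact ⟨.inl ⟨l, by omega⟩, by simp [rowVal, h0]⟩
  · rcases lt_trichotomy r s with h2 | h2 | h2
    · rw [if_pos h2] at hl
      have h3 := hbp r h0 h2
      have h4 := lowCount_le hlen (show 2 * s - r < 2 * s by omega)
      rw [lowCount, if_neg (by omega)] at h4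
      change n ≤ c (2 * s - r) at h4
      refine ⟨.inr (.inl (⟨l, by omega⟩, ⟨r - 1, by omega⟩)), ?_⟩
      simp only [rowVal, Sum.elim_inl, Sum.elim_inr, Nat.sub_add_cancel h0]
      rw [if_pos hl]
    · rw [h2, if_neg (lt_irrefl s)] at hl
      exact ⟨.inr (.inr ⟨l, by omega⟩), by simp [rowVal, h2]⟩
    · rw [if_neg (by omega)] at hl
      have h3 := hbp (2 * s - r) (by omega) (by omega)
      rw [Nat.sub_sub_self hrs.le] at h3
      have h4 := lowCount_le hlen (show 2 * s - r < 2 * s by omega)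
      rw [lowCount, if_pos (by omega)] at h4
      change n + 1 ≤ c (2 * s - r) at h4
      refine ⟨.inr (.inl (⟨2 * n - l, by omega⟩, ⟨2 * s - r - 1, by omega⟩)), ?_⟩
      simp only [rowVal, Sum.elim_inl, Sum.elim_inr]
      rw [Nat.sub_add_cancel (show 1 ≤ 2 * s - r by omega), if_neg (by omega),
        Nat.sub_sub_self hrs.le, Nat.sub_sub_self (show l ≤ 2 * n by omega)]

/-- Every column belongs to a block. -/
theorem exists_colVal (hs : 0 < s) (j : Fin (s * (2 * n + 1))) :
    ∃ y : BlockIndex s n, colVal s n y = j + 1 := by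
  have hj := j.2
  have h1 : s * (2 * n + 1) = 2 * s * n + s := by ring
  have h2 := Nat.div_add_mod ((j : ℕ) + 1) (2 * s)
  have h3 := Nat.mod_lt ((j : ℕ) + 1) (show 0 < 2 * s by omega)
  generalize ((j : ℕ) + 1) % (2 * s) = r at h2 h3
  generalize ((j : ℕ) + 1) / (2 * s) = k at h2
  have hk : k ≤ n := by
    by_contra hc
    have := Nat.mul_le_mul_left (2 * s) (not_le.mp hc)
    rw [Nat.mul_succ] at this
    omega
  rcases Nat.eq_zero_or_pos r with h0 | h0
  · have hk0 : k ≠ 0 := by rintro hk0; rw [hk0] at h2; omega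
    refine ⟨.inl ⟨k - 1, by omega⟩, ?_⟩
    simp only [colVal, Sum.elim_inl, Nat.sub_add_cancel (Nat.one_le_iff_ne_zero.mpr hk0)]
    omega
  · rcases lt_trichotomy r s with h4 | h4 | h4
    · refine ⟨.inr (.inl (⟨n - k, by omega⟩, ⟨r - 1, by omega⟩)), ?_⟩
      simp only [colVal, Sum.elim_inl, Sum.elim_inr]
      rw [if_pos (by omega), Nat.sub_sub_self hk]
      omega
    · refine ⟨.inr (.inr ⟨k, by omega⟩), ?_⟩
      simp only [colVal, Sum.elim_inr]
      omega
    · have hk' : k ≠ n := by rintro hk'; rw [hk'] at h2; omega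
      refine ⟨.inr (.inl (⟨n + (k + 1), by omega⟩, ⟨2 * s - r - 1, by omega⟩)), ?_⟩
      simp only [colVal, Sum.elim_inl, Sum.elim_inr]
      rw [if_neg (by omega), Nat.add_sub_cancel_left, Nat.mul_succ]
      omega

theorem exists_equiv_of_surj {α β : Type*} [Fintype α] [Fintype β] {γ : Type*}
    (hcard : Fintype.card α = Fintype.card β) {f : α → γ} {v : β → γ}
    (hv : Function.Injective v) (hf : ∀ i, ∃ x, f x = v i) : ∃ e : α ≃ β, ∀ x, v (e x) = f x := by
  choose g hg using hf
  have hinj : Function.Injective g := fun i j hij => hv (by rw [← hg, ← hg, hij])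
  have hbij := (Fintype.bijective_iff_injective_and_card g).mpr ⟨hinj, hcard.symm⟩
  refine ⟨(Equiv.ofBijective g hbij).symm, fun x => ?_⟩
  rw [← hg]
  congr 1
  exact Equiv.ofBijective_apply_symm_apply g hbij x

theorem exists_rowEquiv (hs : 0 < s) (hlam : Antitone lam)
    (hlen : ∀ i, s * (2 * n + 1) ≤ i → lam i = 0)
    (hbal : Balanced s n (classCount (2 * s) lam (2 * s * (2 * n + 1)))) :
    ∃ e : BlockIndex s n ≃ Fin (s * (2 * n + 1)), ∀ x, topVal s n lam (e x) =
      rowVal s n (classCount (2 * s) lam (2 * s * (2 * n + 1)))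
        (quo (2 * s) lam (2 * s * (2 * n + 1))) x :=
  exists_equiv_of_surj (by rw [card_blockIndex hs, Fintype.card_fin])
    (topVal_strictAnti hlam).injective (exists_rowVal hs hlen hbal)

theorem exists_colEquiv (hs : 0 < s) :
    ∃ e : BlockIndex s n ≃ Fin (s * (2 * n + 1)), ∀ y, (e y : ℕ) + 1 = colVal s n y :=
  exists_equiv_of_surj (v := fun j : Fin (s * (2 * n + 1)) => (j : ℕ) + 1)
    (by rw [card_blockIndex hs, Fintype.card_fin])
    (fun i j hij => Fin.ext (by simpa using hij)) (exists_colVal hs)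

end Rows

section Factorization

variable {s n : ℕ} {lam : ℕ → ℕ} {K : Type*} [Field K]

/-- `z` is congruent to `r` or `-r` modulo `2 s`. -/
def CongrUpToSign (s : ℕ) (z : ℤ) (r : ℕ) : Prop :=
  ∃ w : ℤ, z = 2 * s * w + r ∨ z = 2 * s * w - r

theorem eq_of_congrUpToSign {z z' : ℤ} {r r' : ℕ} (hz : CongrUpToSign s z r)
    (hz' : CongrUpToSign s z' r') (hr : r ≤ s) (hr' : r' ≤ s)
    (hdvd : ((2 * s : ℕ) : ℤ) ∣ z + z' ∨ ((2 * s : ℕ) : ℤ) ∣ z - z') : r = r' := by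
  obtain ⟨w, hw⟩ := hz
  obtain ⟨w', hw'⟩ := hz'
  have key : ∀ a b : ℤ, (a = r ∨ a = -r) → (b = r' ∨ b = -r') →
      ((2 * s : ℕ) : ℤ) ∣ a + b → r = r' := by
    rintro a b ha hb ⟨k, hk⟩
    push_cast at hk
    rcases Nat.eq_zero_or_pos s with h0 | h0
    · omega
    · have h1 : -(2 * (s : ℤ)) ≤ 2 * s * k := by omega
      have h2 : 2 * (s : ℤ) * k ≤ 2 * s := by omega
      have h3 : k ≤ 1 := by nlinarith
      have h4 : -1 ≤ k := by nlinarith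
      obtain rfl | rfl | rfl : k = -1 ∨ k = 0 ∨ k = 1 := by omega
      all_goals omega
  have hz1 : ∃ a : ℤ, (a = r ∨ a = -r) ∧ z = 2 * s * w + a := by
    rcases hw with h1 | h1
    · exact ⟨r, .inl rfl, h1⟩
    · exact ⟨-r, .inr rfl, by rw [h1]; ring⟩
  have hz2 : ∃ b : ℤ, (b = r' ∨ b = -r') ∧ z' = 2 * s * w' + b := by
    rcases hw' with h1 | h1
    · exact ⟨r', .inl rfl, h1⟩
    · exact ⟨-r', .inr rfl, by rw [h1]; ring⟩
  obtain ⟨a, ha, rfl⟩ := hz1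
  obtain ⟨b, hb, rfl⟩ := hz2
  rcases hdvd with h1 | h1
  · refine key a b ha hb ?_
    have h2 : ((2 * s : ℕ) : ℤ) ∣ 2 * s * (w + w') := ⟨w + w', by push_cast; ring⟩
    have h3 := dvd_sub h1 h2
    rwa [show 2 * s * w + a + (2 * s * w' + b) - 2 * s * (w + w') = a + b by ring] at h3
  · refine key a (-b) ha (by omega) ?_
    have h2 : ((2 * s : ℕ) : ℤ) ∣ 2 * s * (w - w') := ⟨w - w', by push_cast; ring⟩
    have h3 := dvd_sub h1 h2
    rwa [show 2 * s * w + a - (2 * s * w' + b) - 2 * s * (w - w') = a + -b by ring] at h3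

theorem blockClass_le (hs : 0 < s) (x : BlockIndex s n) : blockClass s n x ≤ s := by
  rcases x with l | ⟨l, r⟩ | l
  · simp [blockClass]
  · have := r.2; simp only [blockClass, Sum.elim_inl, Sum.elim_inr]; omega
  · simp [blockClass]

theorem congrUpToSign_rowVal (c : ℕ → ℕ) (Q : ℕ → ℕ → ℕ) (x : BlockIndex s n) :
    CongrUpToSign s (rowVal s n c Q x) (blockClass s n x) := by
  rcases x with l | ⟨l, r⟩ | l
  · exact ⟨(Q 0 l + (c 0 - 1 - l) : ℕ), .inl (by simp [rowVal, blockClass])⟩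
  · simp only [rowVal, blockClass, Sum.elim_inl, Sum.elim_inr]
    have := r.2
    split_ifs
    · exact ⟨_, .inl (by push_cast; rfl)⟩
    · refine ⟨(Q (2 * s - (r + 1)) (2 * n - l) + (c (2 * s - (r + 1)) - 1 - (2 * n - l)) : ℕ) + 1,
        .inr ?_⟩
      rw [Nat.cast_add, Nat.cast_sub (by omega)]
      push_cast
      ring
  · exact ⟨_, .inl (by simp only [rowVal, blockClass, Sum.elim_inr]; push_cast; rfl)⟩

theorem congrUpToSign_colVal (y : BlockIndex s n) :
    CongrUpToSign s (colVal s n y) (blockClass s n y) := by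
  rcases y with l | ⟨l, r⟩ | l
  · exact ⟨l + 1, .inl (by simp [colVal, blockClass])⟩
  · simp only [colVal, blockClass, Sum.elim_inl, Sum.elim_inr]
    have := r.2
    split_ifs with hl
    · exact ⟨_, .inl (by push_cast; rfl)⟩
    · refine ⟨((l - n : ℕ) : ℤ), .inr ?_⟩
      have := Nat.mul_le_mul_left (2 * s) (show 1 ≤ (l : ℕ) - n by omega)
      rw [Nat.cast_sub (by omega)]
      push_cast
      ring
  · exact ⟨l, .inl (by simp [colVal, blockClass])⟩

/-- `hh` is obtained from `g` by inserting zeros outside the multiples of `2 s`. -/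
def IsSpread (s : ℕ) (hh g : ℤ → K) : Prop :=
  (∀ z, hh (2 * s * z) = g z) ∧ ∀ k, ¬ ((2 * s : ℕ) : ℤ) ∣ k → hh k = 0

/-- An entry of the Jacobi-Trudi matrix in the row of the beta-set entry `b` and the column
number `j`. -/
def jacobiEntry (s n : ℕ) (hh : ℤ → K) (b j : ℕ) : K :=
  hh ((b : ℤ) - 2 * s * (2 * n + 1) + j) - hh ((b : ℤ) - 2 * s * (2 * n + 1) - j)

/-- A row and a column meet in a nonzero entry only if they belong to the same class up to sign. -/
theorem jacobiEntry_eq_zero {hh g : ℤ → K} (hhg : IsSpread s hh g) {b j r r' : ℕ}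
    (hb : CongrUpToSign s b r) (hj : CongrUpToSign s j r') (hr : r ≤ s) (hr' : r' ≤ s)
    (hne : r ≠ r') : jacobiEntry s n hh b j = 0 := by
  have hb' : CongrUpToSign s ((b : ℤ) - 2 * s * (2 * n + 1)) r := by
    obtain ⟨w, hw⟩ := hb
    refine ⟨w - (2 * n + 1), ?_⟩
    rcases hw with hw | hw
    · left; rw [hw]; ring
    · right; rw [hw]; ring
  rw [jacobiEntry, hhg.2, hhg.2, sub_zero]
  · exact fun hd => hne (eq_of_congrUpToSign hb' hj hr hr' (.inr hd))
  · exact fun hd => hne (eq_of_congrUpToSign hb' hj hr hr' (.inl hd))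

theorem not_dvd_two_mul {r : ℕ} (hr0 : 0 < r) (hrs : r < s) (z : ℤ) :
    ¬ ((2 * s : ℕ) : ℤ) ∣ 2 * s * z + 2 * r ∧ ¬ ((2 * s : ℕ) : ℤ) ∣ 2 * s * z - 2 * r := by
  have key : ¬ ((2 * s : ℕ) : ℤ) ∣ 2 * r := fun hd => by
    have := Int.le_of_dvd (by omega) hd
    omega
  have hz : ((2 * s : ℕ) : ℤ) ∣ 2 * s * z := ⟨z, by push_cast; ring⟩
  exact ⟨fun hd => key ((dvd_add_right hz).mp hd), fun hd => key ((dvd_sub_right hz).mp hd)⟩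

/-- The block of the residue class `0`. -/
def zeroBlock (n : ℕ) (g : ℤ → K) (p : ℕ → ℕ) : Matrix (Fin n) (Fin n) K :=
  Matrix.of fun i j => g ((p i : ℤ) - (i + 1) + (j + 1)) - g ((p i : ℤ) - (i + 1) - (j + 1))

/-- The block of the residue class `s`. -/
def halfBlock (n : ℕ) (g : ℤ → K) (p : ℕ → ℕ) : Matrix (Fin (n + 1)) (Fin (n + 1)) K :=
  Matrix.of fun i j => g ((p i : ℤ) - (i + 1) + (j + 1)) - g ((p i : ℤ) - (i + 1) - j)

/-- The block of a pair of opposite residue classes, with `a` and `b` rows. -/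
def pairBlock (n : ℕ) (g : ℤ → K) (p q : ℕ → ℕ) (a b : ℕ) :
    Matrix (Fin (2 * n + 1)) (Fin (2 * n + 1)) K :=
  Matrix.of fun l j => (if (j : ℕ) ≤ n then -1 else 1) *
    if (l : ℕ) < a then g ((p l : ℤ) + a - 1 - l - 2 * n + j)
    else -g ((q (2 * n - l) : ℤ) + b - 1 - (2 * n - l : ℕ) - j)

theorem jacobiEntry_zeroBlock {hh g : ℤ → K} (hhg : IsSpread s hh g) {c : ℕ → ℕ}
    {Q : ℕ → ℕ → ℕ} (hc : c 0 = 2 * n + 1) (l j : Fin n) :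
    jacobiEntry s n hh (rowVal s n c Q (.inl l)) (colVal s n (.inl j)) =
      zeroBlock n g (Q 0) l j := by
  have hl := l.2
  simp only [jacobiEntry, rowVal, colVal, Sum.elim_inl, zeroBlock, Matrix.of_apply, hc]
  rw [← hhg.1, ← hhg.1]
  have e1 : ((2 * n - (l : ℕ) : ℕ) : ℤ) = 2 * n - l := by omega
  rw [Nat.add_sub_cancel]
  push_cast [e1]
  congr 2 <;> ring

theorem jacobiEntry_halfBlock {hh g : ℤ → K} (hhg : IsSpread s hh g) {c : ℕ → ℕ}
    {Q : ℕ → ℕ → ℕ} (hc : c s = 2 * n + 1) (l j : Fin (n + 1)) :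
    jacobiEntry s n hh (rowVal s n c Q (.inr (.inr l))) (colVal s n (.inr (.inr j))) =
      halfBlock n g (Q s) l j := by
  have hl := l.2
  simp only [jacobiEntry, rowVal, colVal, Sum.elim_inr, halfBlock, Matrix.of_apply, hc]
  rw [← hhg.1, ← hhg.1]
  have e1 : ((2 * n - (l : ℕ) : ℕ) : ℤ) = 2 * n - l := by omega
  rw [Nat.add_sub_cancel]
  push_cast [e1]
  congr 2 <;> ring

theorem jacobiEntry_pairBlock {hh g : ℤ → K} (hhg : IsSpread s hh g) {c : ℕ → ℕ}
    {Q : ℕ → ℕ → ℕ} (r : Fin (s - 1)) (hc : n + 1 ≤ c (r + 1))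
    (hc' : n ≤ c (2 * s - (r + 1)))
    (hcc : c (r + 1) + c (2 * s - (r + 1)) = 2 * (2 * n + 1)) (l j : Fin (2 * n + 1)) :
    jacobiEntry s n hh (rowVal s n c Q (.inr (.inl (l, r)))) (colVal s n (.inr (.inl (j, r)))) =
      pairBlock n g (Q (r + 1)) (Q (2 * s - (r + 1))) (c (r + 1) - (n + 1))
        (c (2 * s - (r + 1)) - n) l j := by
  have hl := l.2
  have hj := j.2
  have hr := r.2
  have hnd := not_dvd_two_mul (s := s) (r := r + 1) (by omega) (by omega)
  push_cast at hnd
  simp only [jacobiEntry, rowVal, colVal, Sum.elim_inr, Sum.elim_inl, pairBlock, Matrix.of_apply]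
  generalize hC : c (r + 1) = C at *
  generalize hC' : c (2 * s - (r + 1)) = C' at *
  have e3 : ((2 * s - ((r : ℕ) + 1) : ℕ) : ℤ) = 2 * s - (r + 1) := by omega
  have e4 : ¬ (j : ℕ) ≤ n → ((2 * s * ((j : ℕ) - n) - ((r : ℕ) + 1) : ℕ) : ℤ) =
      2 * s * ((j : ℤ) - n) - (r + 1) := by
    intro hjn
    have h5 := Nat.mul_le_mul_left (2 * s) (show 1 ≤ (j : ℕ) - n by omega)
    rw [Nat.cast_sub (by omega), Nat.cast_mul, Nat.cast_sub (by omega)]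
    push_cast
    ring
  by_cases hlC : (l : ℕ) + (n + 1) < C
  · rw [if_pos hlC, if_pos (show (l : ℕ) < C - (n + 1) by omega)]
    have e1 : ((C - 1 - (l : ℕ) : ℕ) : ℤ) = C - 1 - l := by omega
    have e2 : ((C - (n + 1) : ℕ) : ℤ) = C - (n + 1) := by omega
    by_cases hjn : (j : ℕ) ≤ n
    · simp only [hjn, if_true]
      have e5 : ((n - (j : ℕ) : ℕ) : ℤ) = n - j := by omega
      rw [hhg.2, zero_sub, neg_one_mul, ← hhg.1]
      · push_cast [e1, e2, e5]
        congr 2; ring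
      · convert (hnd (Q (r + 1) l + (C - 1 - l) - (2 * n + 1) + (n - j))).1 using 1
        push_cast [e1, e5]
        ring_nf
    · simp only [hjn, if_false]
      rw [hhg.2 (_ - _), sub_zero, one_mul, ← hhg.1, e4 hjn]
      · push_cast [e1, e2]
        congr 1; ring
      · convert (hnd (Q (r + 1) l + (C - 1 - l) - (2 * n + 1) - (j - n))).1 using 1
        rw [e4 hjn]
        push_cast [e1]
        ring_nf
  · rw [if_neg hlC, if_neg (show ¬ (l : ℕ) < C - (n + 1) by omega)]
    have e1 : ((C' - 1 - (2 * n - (l : ℕ)) : ℕ) : ℤ) = C' - 1 - (2 * n - l) := by omega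
    have e2 : ((C' - n : ℕ) : ℤ) = C' - n := by omega
    have e6 : ((2 * n - (l : ℕ) : ℕ) : ℤ) = 2 * n - l := by omega
    by_cases hjn : (j : ℕ) ≤ n
    · simp only [hjn, if_true]
      have e5 : ((n - (j : ℕ) : ℕ) : ℤ) = n - j := by omega
      rw [hhg.2 (_ - _), sub_zero, neg_one_mul, neg_neg, ← hhg.1]
      · push_cast [e1, e2, e3, e5, e6]
        congr 1; ring
      · convert (hnd (Q (2 * s - (r + 1)) (2 * n - l) + (C' - 1 - (2 * n - l)) + 1
          - (2 * n + 1) - (n - j))).2 using 1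
        push_cast [e1, e3, e5]
        ring_nf
    · simp only [hjn, if_false]
      rw [hhg.2 (_ + _), zero_sub, one_mul, ← hhg.1, e4 hjn]
      · push_cast [e1, e2, e3, e6]
        congr 2; ring
      · convert (hnd (Q (2 * s - (r + 1)) (2 * n - l) + (C' - 1 - (2 * n - l)) + 1
          - (2 * n + 1) + (j - n))).2 using 1
        rw [e4 hjn]
        push_cast [e1, e3]
        ring_nf

/-- The Jacobi-Trudi matrix, with rows given by beta-set entries. -/
def jacobiMatrix (s n : ℕ) (hh : ℤ → K) (lam : ℕ → ℕ) :
    Matrix (Fin (s * (2 * n + 1))) (Fin (s * (2 * n + 1))) K :=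
  Matrix.of fun i j => jacobiEntry s n hh (topVal s n lam i) (j + 1)

/-- The determinant of the Jacobi-Trudi matrix is, up to the sign of the permutation that sorts the
rows and columns into blocks, the product of the determinants of the blocks. -/
theorem det_jacobiMatrix (hs : 0 < s) {hh g : ℤ → K} (hhg : IsSpread s hh g) {c : ℕ → ℕ}
    {Q : ℕ → ℕ → ℕ} (hbal : Balanced s n c) (hc : ∀ r < 2 * s, lowCount s n r ≤ c r)
    {e ec : BlockIndex s n ≃ Fin (s * (2 * n + 1))}
    (he : ∀ x, topVal s n lam (e x) = rowVal s n c Q x)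
    (hec : ∀ y, (ec y : ℕ) + 1 = colVal s n y) :
    (jacobiMatrix s n hh lam).det = (Equiv.Perm.sign (ec.symm.trans e) : ℤ) *
      ((zeroBlock n g (Q 0)).det * ((∏ r : Fin (s - 1),
        (pairBlock n g (Q (r + 1)) (Q (2 * s - (r + 1))) (c (r + 1) - (n + 1))
          (c (2 * s - (r + 1)) - n)).det) * (halfBlock n g (Q s)).det)) := by
  have h1 : (jacobiMatrix s n hh lam).submatrix e ec =
      Matrix.fromBlocks (zeroBlock n g (Q 0)) 0 0 (Matrix.fromBlocks
        (Matrix.blockDiagonal fun r : Fin (s - 1) => pairBlock n g (Q (r + 1))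
          (Q (2 * s - (r + 1))) (c (r + 1) - (n + 1)) (c (2 * s - (r + 1)) - n)) 0 0
        (halfBlock n g (Q s))) := by
    have hentry : ∀ x y, (jacobiMatrix s n hh lam).submatrix e ec x y =
        jacobiEntry s n hh (rowVal s n c Q x) (colVal s n y) := fun x y => by
      simp only [jacobiMatrix, Matrix.submatrix_apply, Matrix.of_apply, he, hec]
    have hzero : ∀ x y, blockClass s n x ≠ blockClass s n y →
        (jacobiMatrix s n hh lam).submatrix e ec x y = 0 := fun x y hxy => by
      rw [hentry]
      exact jacobiEntry_eq_zero hhg (congrUpToSign_rowVal c Q x) (congrUpToSign_colVal y)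
        (blockClass_le hs x) (blockClass_le hs y) hxy
    ext x y
    rcases x with l | ⟨l, r⟩ | l <;> rcases y with j | ⟨j, r'⟩ | j
    · rw [hentry, jacobiEntry_zeroBlock hhg hbal.1]; rfl
    · exact hzero _ _ (by simp [blockClass])
    · exact hzero _ _ (by simp [blockClass]; omega)
    · exact hzero _ _ (by simp [blockClass])
    · simp only [Matrix.fromBlocks_apply₂₂, Matrix.fromBlocks_apply₁₁, Matrix.blockDiagonal_apply]
      split_ifs with hrr
      · subst hrr
        have hr := r.2
        have h2 := hc (r + 1) (by omega)
        have h3 := hc (2 * s - (r + 1)) (by omega)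
        rw [lowCount, if_pos (by omega)] at h2
        rw [lowCount, if_neg (by omega)] at h3
        rw [hentry, jacobiEntry_pairBlock hhg r h2 h3 (hbal.2.2 _ (by omega) (by omega))]
      · exact hzero _ _ (by simpa [blockClass, Fin.ext_iff] using hrr)
    · exact hzero _ _ (by have := r.2; simp [blockClass]; omega)
    · exact hzero _ _ (by simp [blockClass]; omega)
    · exact hzero _ _ (by have := r'.2; simp [blockClass]; omega)
    · rw [hentry, jacobiEntry_halfBlock hhg hbal.2.1]; rfl
  have h2 : (jacobiMatrix s n hh lam).submatrix e ec =
      ((jacobiMatrix s n hh lam).submatrix (ec.symm.trans e) id).submatrix ec ec := by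
    ext x y; simp
  have h3 := Matrix.det_permute (ec.symm.trans e) (jacobiMatrix s n hh lam)
  rw [← Matrix.det_submatrix_equiv_self ec, ← h2, h1, Matrix.det_fromBlocks_zero₂₁,
    Matrix.det_fromBlocks_zero₂₁, Matrix.det_blockDiagonal] at h3
  rw [h3, ← mul_assoc, ← Int.cast_mul, ← Units.val_mul, Int.units_mul_self]
  simp

/-- If the determinant of the Jacobi-Trudi matrix does not vanish, then the rows and the columns
are equidistributed among the residue classes up to sign. -/
theorem exists_perm_of_det_ne_zero {hh g : ℤ → K} (hhg : IsSpread s hh g)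
    (hdet : (jacobiMatrix s n hh lam).det ≠ 0) :
    ∃ σ : Equiv.Perm (Fin (s * (2 * n + 1))), ∀ i r r', CongrUpToSign s (topVal s n lam (σ i)) r →
      CongrUpToSign s ((i : ℕ) + 1 : ℕ) r' → r ≤ s → r' ≤ s → r = r' := by
  rw [Matrix.det_apply] at hdet
  obtain ⟨σ, -, hσ⟩ := Finset.exists_ne_zero_of_sum_ne_zero hdet
  refine ⟨σ, fun i r r' hr hr' hrs hrs' => ?_⟩
  by_contra hne
  apply hσ
  rw [Finset.prod_eq_zero (Finset.mem_univ i), smul_zero]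
  exact jacobiEntry_eq_zero hhg hr hr' hrs hrs' hne

end Factorization

/-! ### Inversions between linear orders -/

section Inversions

variable {α β γ δ : Type*} [LinearOrder β] [LinearOrder γ] [LinearOrder δ]

/-- The number of pairs of elements of `S` that are ordered in opposite ways by `f` and `g`. -/
def inversions (S : Finset α) (f : α → β) (g : α → γ) : ℕ :=
  ((S ×ˢ S).filter fun xy => f xy.1 < f xy.2 ∧ g xy.2 < g xy.1).card

theorem inversions_congr {S : Finset α} {f : α → β} {g : α → γ} {f' : α → δ}
    (hf : ∀ x ∈ S, ∀ y ∈ S, f x < f y ↔ f' x < f' y) : inversions S f g = inversions S f' g := by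
  rw [inversions, inversions]
  congr 1
  refine Finset.filter_congr fun xy hxy => ?_
  rw [Finset.mem_product] at hxy
  rw [hf _ hxy.1 _ hxy.2]

theorem card_filter_swap (S : Finset α) (P : α → α → Prop) [DecidableRel P] :
    ((S ×ˢ S).filter fun xy => P xy.1 xy.2).card =
      ((S ×ˢ S).filter fun xy => P xy.2 xy.1).card := by
  refine Finset.card_bij (fun xy _ => xy.swap) ?_ ?_ ?_
  · rintro ⟨x, y⟩ hxy
    simp only [Finset.mem_filter, Finset.mem_product, Prod.swap] at hxy ⊢
    tauto
  · rintro a _ b _ hab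
    exact Prod.swap_injective hab
  · rintro ⟨x, y⟩ hxy
    refine ⟨(y, x), ?_, rfl⟩
    simp only [Finset.mem_filter, Finset.mem_product] at hxy ⊢
    tauto

theorem inversions_comm (S : Finset α) (f : α → β) (g : α → γ) :
    inversions S f g = inversions S g f := by
  rw [inversions, card_filter_swap S (fun x y => f x < f y ∧ g y < g x), inversions]
  congr 1
  exact Finset.filter_congr fun xy _ => and_comm

theorem inversions_image [DecidableEq α] {ι : Type*} {S : Finset ι} {φ : ι → α}
    (hφ : Function.Injective φ) (f : α → β) (g : α → γ) :
    inversions (S.image φ) f g = inversions S (f ∘ φ) (g ∘ φ) := by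
  symm
  rw [inversions, inversions]
  refine Finset.card_bij (fun xy _ => (φ xy.1, φ xy.2)) ?_ ?_ ?_
  · rintro ⟨x, y⟩ hxy
    simp only [Finset.mem_filter, Finset.mem_product] at hxy ⊢
    exact ⟨⟨Finset.mem_image_of_mem _ hxy.1.1, Finset.mem_image_of_mem _ hxy.1.2⟩, hxy.2⟩
  · rintro ⟨x, y⟩ _ ⟨x', y'⟩ _ hab
    simp only [Prod.mk.injEq] at hab
    rw [hφ hab.1, hφ hab.2]
  · rintro ⟨a, b⟩ hab
    simp only [Finset.mem_filter, Finset.mem_product, Finset.mem_image] at hab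
    obtain ⟨⟨⟨x, hx, rfl⟩, ⟨y, hy, rfl⟩⟩, h2⟩ := hab
    exact ⟨(x, y), by simpa [hx, hy] using h2, rfl⟩

/-- Three linear orders on a finite set disagree pairwise an even number of times in total. -/
theorem inversions_cocycle {S : Finset α} {f : α → β} {g : α → γ} {k : α → δ}
    (hf : Set.InjOn f S) (hg : Set.InjOn g S) (hk : Set.InjOn k S) :
    (inversions S f g : ZMod 2) = inversions S f k + inversions S g k := by
  let N (P : α → α → Prop) [DecidableRel P] : ℕ := ((S ×ˢ S).filter fun xy => P xy.1 xy.2).card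
  have hsplit : ∀ (P Q : α → α → Prop) [DecidableRel P] [DecidableRel Q],
      N P = N (fun x y => P x y ∧ Q x y) + N (fun x y => P x y ∧ ¬ Q x y) := by
    intro P Q _ _
    simp only [N]
    rw [← Finset.filter_filter, ← Finset.filter_filter]
    exact (Finset.card_filter_add_card_filter_not _).symm
  have hcongr : ∀ (P Q : α → α → Prop) [DecidableRel P] [DecidableRel Q],
      (∀ x ∈ S, ∀ y ∈ S, P x y ↔ Q x y) → N P = N Q := by
    intro P Q _ _ hPQ
    simp only [N]
    congr 1
    refine Finset.filter_congr fun xy hxy => ?_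
    rw [Finset.mem_product] at hxy
    exact hPQ _ hxy.1 _ hxy.2
  -- Each of the three counts is split according to the position of the pair in the third order.
  -- The six parts are then equal in pairs, the last two after exchanging `x` and `y`.
  have e1 : inversions S f g = N (fun x y => (f x < f y ∧ g y < g x) ∧ k y < k x) +
      N (fun x y => (f x < f y ∧ g y < g x) ∧ ¬ k y < k x) :=
    hsplit (fun x y => f x < f y ∧ g y < g x) (fun x y => k y < k x)
  have e2 : inversions S f k = N (fun x y => (f x < f y ∧ k y < k x) ∧ g y < g x) +
      N (fun x y => (f x < f y ∧ k y < k x) ∧ ¬ g y < g x) :=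
    hsplit (fun x y => f x < f y ∧ k y < k x) (fun x y => g y < g x)
  have e3 : inversions S g k = N (fun x y => (g x < g y ∧ k y < k x) ∧ f x < f y) +
      N (fun x y => (g x < g y ∧ k y < k x) ∧ ¬ f x < f y) :=
    hsplit (fun x y => g x < g y ∧ k y < k x) (fun x y => f x < f y)
  have e4 : N (fun x y => (f x < f y ∧ g y < g x) ∧ k y < k x) =
      N (fun x y => (f x < f y ∧ k y < k x) ∧ g y < g x) :=
    hcongr (fun x y => (f x < f y ∧ g y < g x) ∧ k y < k x)
      (fun x y => (f x < f y ∧ k y < k x) ∧ g y < g x) fun x _ y _ => by tauto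
  have hne : ∀ x ∈ S, ∀ y ∈ S, f x < f y → ¬ g y < g x → g x < g y := by
    intro x hx y hy h1 h2
    refine lt_of_le_of_ne (not_lt.mp h2) fun h3 => ?_
    rw [hg hx hy h3] at h1
    exact lt_irrefl _ h1
  have e5 : N (fun x y => (f x < f y ∧ k y < k x) ∧ ¬ g y < g x) =
      N (fun x y => (g x < g y ∧ k y < k x) ∧ f x < f y) :=
    hcongr (fun x y => (f x < f y ∧ k y < k x) ∧ ¬ g y < g x)
      (fun x y => (g x < g y ∧ k y < k x) ∧ f x < f y) fun x hx y hy =>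
      ⟨fun h1 => ⟨⟨hne x hx y hy h1.1.1 h1.2, h1.1.2⟩, h1.1.1⟩,
        fun h1 => ⟨⟨h1.2, h1.1.2⟩, not_lt.mpr h1.1.1.le⟩⟩
  have e6 : N (fun x y => (f x < f y ∧ g y < g x) ∧ ¬ k y < k x) =
      N (fun x y => (g x < g y ∧ k y < k x) ∧ ¬ f x < f y) := by
    refine (hcongr (fun x y => (f x < f y ∧ g y < g x) ∧ ¬ k y < k x)
      (fun x y => (g y < g x ∧ k x < k y) ∧ ¬ f y < f x) fun x hx y hy => ?_).trans
      (card_filter_swap S (fun x y => (g y < g x ∧ k x < k y) ∧ ¬ f y < f x))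
    constructor
    · rintro ⟨⟨h1, h2⟩, h3⟩
      refine ⟨⟨h2, lt_of_le_of_ne (not_lt.mp h3) fun h4 => ?_⟩, not_lt.mpr h1.le⟩
      rw [hk hx hy h4] at h1
      exact lt_irrefl _ h1
    · rintro ⟨⟨h1, h2⟩, h3⟩
      refine ⟨⟨lt_of_le_of_ne (not_lt.mp h3) fun h4 => ?_, h1⟩, not_lt.mpr h2.le⟩
      rw [hf hx hy h4] at h1
      exact lt_irrefl _ h1
  rw [e1, e2, e3, e4, e5, e6]
  push_cast
  generalize (N (fun x y => (g x < g y ∧ k y < k x) ∧ f x < f y) : ZMod 2) = a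
  generalize (N (fun x y => (g x < g y ∧ k y < k x) ∧ ¬ f x < f y) : ZMod 2) = b
  generalize (N (fun x y => (f x < f y ∧ k y < k x) ∧ g y < g x) : ZMod 2) = c
  have ha := CharTwo.add_self_eq_zero a
  linear_combination -ha

theorem sign_eq_neg_one_pow {N : ℕ} (σ : Equiv.Perm (Fin N)) :
    ((Equiv.Perm.sign σ : ℤˣ) : ℤ) = (-1) ^ inversions Finset.univ id σ := by
  rw [Equiv.Perm.sign_eq_prod_prod_Ioi, inversions, Units.coe_prod]
  simp only [Units.coe_prod]
  rw [Finset.prod_sigma', ← Finset.prod_filter_mul_prod_filter_not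
    (Finset.univ.sigma fun i => Finset.Ioi i) (fun x => σ x.1 < σ x.2)]
  rw [Finset.prod_eq_one (s := Finset.filter _ _) (fun x hx => by
    rw [Finset.mem_filter] at hx; rw [if_pos hx.2]; rfl), one_mul,
    Finset.prod_congr rfl (g := fun _ => (-1 : ℤ)) (fun x hx => by
    rw [Finset.mem_filter] at hx; rw [if_neg hx.2]; rfl), Finset.prod_const]
  congr 1
  refine Finset.card_bij (fun x _ => (x.1, x.2)) ?_ ?_ ?_
  · rintro ⟨i, j⟩ hij
    simp only [Finset.mem_filter, Finset.mem_sigma, Finset.mem_univ, Finset.mem_Ioi, true_and,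
      Finset.mem_product, id] at hij ⊢
    exact ⟨hij.1, lt_of_le_of_ne (not_lt.mp hij.2) fun h1 => hij.1.ne' (σ.injective h1)⟩
  · rintro ⟨i, j⟩ _ ⟨i', j'⟩ _ h1
    simp only [Prod.mk.injEq] at h1
    rw [h1.1, h1.2]
  · rintro ⟨i, j⟩ hij
    simp only [Finset.mem_filter, Finset.mem_univ, true_and, Finset.mem_product, id] at hij
    exact ⟨⟨i, j⟩, by simp [hij.1, hij.2.le], rfl⟩

/-- The sign of a comparison of two enumerations, in terms of their inversions. -/
theorem sign_symm_trans {ι : Type*} [Fintype ι] [DecidableEq ι] {N : ℕ} (e e' : ι ≃ Fin N)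
    {o : ι → β} (ho : Function.Injective o) :
    ((Equiv.Perm.sign (e.symm.trans e') : ℤˣ) : ℤ) =
      (-1) ^ (inversions Finset.univ o e + inversions Finset.univ o e') := by
  have h1 : inversions Finset.univ id (e.symm.trans e') = inversions Finset.univ e e' := by
    have h2 : (Finset.univ : Finset (Fin N)) = (Finset.univ : Finset ι).image e := by
      rw [Finset.image_univ_of_surjective e.surjective]
    rw [h2, inversions_image e.injective]
    simp only [inversions, Function.comp_apply, id, Equiv.trans_apply, Equiv.symm_apply_apply]
  rw [sign_eq_neg_one_pow, h1]
  have h3 := inversions_cocycle (S := (Finset.univ : Finset ι)) (k := o) e.injective.injOn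
    e'.injective.injOn ho.injOn
  rw [inversions_comm _ o e, inversions_comm _ o e']
  rw [← Nat.cast_add, ZMod.natCast_eq_natCast_iff] at h3
  rw [neg_one_pow_eq_pow_mod_two, h3, ← neg_one_pow_eq_pow_mod_two]

end Inversions

/-! ### Parities of inversions of the beta-set -/

section Counting

theorem inversions_eq_sum {α β γ : Type*} [LinearOrder β] [LinearOrder γ] (S : Finset α)
    (f : α → β) (g : α → γ) :
    inversions S f g = ∑ b ∈ S, (S.filter fun a => f a < f b ∧ g b < g a).card := by
  rw [inversions, Finset.card_filter, Finset.sum_product_right]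
  exact Finset.sum_congr rfl fun b _ => (Finset.card_filter _ _).symm

theorem inversions_union {α β γ : Type*} [DecidableEq α] [LinearOrder β] [LinearOrder γ]
    {A L : Finset α} (f : α → β) (g : α → γ) (hdisj : Disjoint A L)
    (hg : ∀ a ∈ L, ∀ b ∈ A, g b < g a) :
    inversions (A ∪ L) f g = inversions A f g + inversions L f g +
      ∑ b ∈ A, (L.filter fun a => f a < f b).card := by
  have h1 : ∀ b ∈ A, ((A ∪ L).filter fun a => f a < f b ∧ g b < g a).card =
      (A.filter fun a => f a < f b ∧ g b < g a).card + (L.filter fun a => f a < f b).card := by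
    intro b hb
    rw [Finset.filter_union, Finset.card_union_of_disjoint (Finset.disjoint_filter_filter hdisj)]
    congr 2
    exact Finset.filter_congr fun a ha => and_iff_left (hg a ha b hb)
  have h2 : ∀ b ∈ L, ((A ∪ L).filter fun a => f a < f b ∧ g b < g a).card =
      (L.filter fun a => f a < f b ∧ g b < g a).card := by
    intro b hb
    rw [Finset.filter_union, Finset.card_union_of_disjoint (Finset.disjoint_filter_filter hdisj),
      Finset.card_eq_zero.mpr, zero_add]
    exact Finset.filter_eq_empty_iff.mpr fun a ha h3 => lt_asymm h3.2 (hg b hb a ha)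
  rw [inversions_eq_sum, Finset.sum_union hdisj, Finset.sum_congr rfl h1,
    Finset.sum_congr rfl h2, Finset.sum_add_distrib, inversions_eq_sum, inversions_eq_sum]
  ring

theorem sum_card_filter_lt (S : Finset ℕ) :
    ∑ b ∈ S, (S.filter fun a => b < a).card = S.card.choose 2 := by
  induction S using Finset.induction_on_min with
  | empty => simp
  | insert m S hm ih =>
    have hmS : m ∉ S := fun h1 => lt_irrefl _ (hm m h1)
    rw [Finset.sum_insert hmS, Finset.card_insert_of_notMem hmS, Nat.choose_succ_succ,
      Nat.choose_one_right, ← ih, Finset.filter_insert, if_neg (lt_irrefl m),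
      Finset.filter_true_of_mem hm]
    congr 1
    refine Finset.sum_congr rfl fun b hb => ?_
    rw [Finset.filter_insert, if_neg (hm b hb).not_gt]

/-- The order on beta-set entries that defines `sigma`: by residue class, then decreasing. -/
def classKey (T b : ℕ) : ℕ ×ₗ ℕᵒᵈ := toLex (b % T, OrderDual.toDual b)

/-- The order on beta-set entries in which the rows of the blocks are listed: the residue classes
modulo `2 s` come in the order `0, 1, -1, 2, -2, ..., s`, and the entries of a class decrease for
the classes `0, ..., s` and increase for the other ones. -/
def blockKey (s b : ℕ) : ℕ ×ₗ ℤ :=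
  if b % (2 * s) ≤ s then toLex (2 * (b % (2 * s)), -(b : ℤ))
  else toLex (2 * (2 * s - b % (2 * s)) + 1, (b : ℤ))

theorem classKey_injective (T : ℕ) : Function.Injective (classKey T) := fun a b hab => by
  have h1 := congrArg Prod.snd (toLex.injective hab)
  exact OrderDual.toDual.injective h1

theorem classKey_lt {T a b : ℕ} :
    classKey T a < classKey T b ↔ a % T < b % T ∨ a % T = b % T ∧ b < a := by
  rw [classKey, classKey, Prod.Lex.toLex_lt_toLex, OrderDual.toDual_lt_toDual]

theorem blockKey_lt {s a b : ℕ} (ha : a % (2 * s) < 2 * s) (hb : b % (2 * s) < 2 * s) :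
    blockKey s a < blockKey s b ↔
      (b % (2 * s) ≤ s ∧ ((a % (2 * s) < b % (2 * s) ∨ 2 * s - b % (2 * s) < a % (2 * s)) ∨
        a % (2 * s) = b % (2 * s) ∧ b < a)) ∨
      (s < b % (2 * s) ∧ ((a % (2 * s) ≤ 2 * s - b % (2 * s) ∨ b % (2 * s) < a % (2 * s)) ∨
        a % (2 * s) = b % (2 * s) ∧ a < b)) := by
  simp only [blockKey]
  split_ifs <;> rw [Prod.Lex.toLex_lt_toLex] <;> dsimp only <;> omega

theorem blockKey_injective {s : ℕ} : Function.Injective (blockKey s) := fun a b hab => by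
  simp only [blockKey] at hab
  split_ifs at hab <;> simp only [toLex_inj, Prod.mk.injEq] at hab <;> omega

end Counting

section Parity

variable {s n : ℕ}

theorem Balanced.add_eq {c : ℕ → ℕ} (hc : Balanced s n c) {r : ℕ} (hr : 0 < r)
    (hr' : r < 2 * s) : c r + c (2 * s - r) = 2 * (2 * n + 1) := by
  rcases lt_trichotomy r s with h1 | h1 | h1
  · exact hc.2.2 r hr h1
  · rw [h1, show 2 * s - s = s by omega, hc.2.1]; ring
  · have := hc.2.2 (2 * s - r) (by omega) (by omega)
    rw [Nat.sub_sub_self hr'.le] at this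
    omega

/-- The classes in an interval symmetric about `s` pair up, except for `s` itself. -/
theorem sum_Ioo_odd {c : ℕ → ℕ} (hc : Balanced s n c) {k : ℕ} (hk : k < s) :
    ∑ r ∈ Finset.Ioo k (2 * s - k), (c r : ZMod 2) = 1 := by
  have hs : s ∈ Finset.Ioo k (2 * s - k) := Finset.mem_Ioo.mpr (by omega)
  have htwo : (2 : ZMod 2) = 0 := rfl
  rw [← Finset.add_sum_erase _ _ hs, hc.2.1, Finset.sum_involution (fun r _ => 2 * s - r)]
  · push_cast
    linear_combination (n : ZMod 2) * htwo
  · intro r hr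
    simp only [Finset.mem_erase, Finset.mem_Ioo] at hr
    rw [← Nat.cast_add, hc.add_eq (by omega) (by omega)]
    push_cast
    linear_combination (2 * n + 1 : ZMod 2) * htwo
  · intro r hr _
    simp only [Finset.mem_erase, Finset.mem_Ioo] at hr
    omega
  · intro r hr
    simp only [Finset.mem_erase, Finset.mem_Ioo] at hr ⊢
    omega
  · intro r hr
    simp only [Finset.mem_erase, Finset.mem_Ioo] at hr
    omega

/-- The parity of the difference between the orders `classKey` and `blockKey`. -/
theorem inversions_classKey_blockKey (hs : 0 < s) {B : Finset ℕ} {c : ℕ → ℕ}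
    (hB : ∀ r, (B.filter fun b => b % (2 * s) = r).card = c r) (hc : Balanced s n c) :
    (inversions B (classKey (2 * s)) (blockKey s) : ZMod 2) =
      ∑ r ∈ Finset.Ioo s (2 * s), ((c r + 1).choose 2 : ZMod 2) := by
  have hmod : ∀ a, a % (2 * s) < 2 * s := fun a => Nat.mod_lt _ (by omega)
  have h1 : ∀ b ∈ B, ((B.filter fun a => classKey (2 * s) a < classKey (2 * s) b ∧
      blockKey s b < blockKey s a).card : ZMod 2) = if s < b % (2 * s) then
        (1 + ((B.filter fun a => a % (2 * s) = b % (2 * s)).filter fun a => b < a).card : ZMod 2)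
      else 0 := by
    intro b _
    have hb := hmod b
    split_ifs with hsb
    · have h2 : (B.filter fun a => classKey (2 * s) a < classKey (2 * s) b ∧
          blockKey s b < blockKey s a) =
          (B.filter fun a => a % (2 * s) ∈ Finset.Ioo (2 * s - b % (2 * s)) (b % (2 * s))) ∪
          ((B.filter fun a => a % (2 * s) = b % (2 * s)).filter fun a => b < a) := by
        rw [Finset.filter_filter, ← Finset.filter_or]
        refine Finset.filter_congr fun a _ => ?_
        have ha := hmod a
        rw [classKey_lt, blockKey_lt hb ha, Finset.mem_Ioo]
        omega
      rw [h2, Finset.card_union_of_disjoint, Nat.cast_add]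
      · congr 1
        rw [Finset.card_eq_sum_card_fiberwise (f := fun a => a % (2 * s))
          (s := B.filter fun a => a % (2 * s) ∈ Finset.Ioo (2 * s - b % (2 * s)) (b % (2 * s)))
          (t := Finset.Ioo (2 * s - b % (2 * s)) (b % (2 * s)))
          (fun a ha => (Finset.mem_filter.mp ha).2), Nat.cast_sum]
        have h3 := sum_Ioo_odd hc (show 2 * s - b % (2 * s) < s by omega)
        rw [Nat.sub_sub_self hb.le] at h3
        rw [← h3]
        refine Finset.sum_congr rfl fun r hr => ?_
        rw [← hB r, Finset.filter_filter]
        congr 2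
        refine Finset.filter_congr fun a _ => and_iff_right_of_imp fun h4 => ?_
        rwa [h4]
      · rw [Finset.filter_filter]
        refine Finset.disjoint_filter.mpr fun a _ h3 h4 => ?_
        rw [Finset.mem_Ioo] at h3
        omega
    · rw [Finset.card_eq_zero.mpr, Nat.cast_zero]
      refine Finset.filter_eq_empty_iff.mpr fun a _ => ?_
      have ha := hmod a
      rw [classKey_lt, blockKey_lt hb ha]
      omega
  rw [inversions_eq_sum, Nat.cast_sum, Finset.sum_congr rfl h1, ← Finset.sum_filter,
    ← Finset.sum_fiberwise_of_maps_to (g := fun b => b % (2 * s)) (t := Finset.Ioo s (2 * s))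
      (fun b hb => Finset.mem_Ioo.mpr ⟨(Finset.mem_filter.mp hb).2, hmod b⟩)]
  refine Finset.sum_congr rfl fun r hr => ?_
  rw [Finset.mem_Ioo] at hr
  have h4 : ((B.filter fun b => s < b % (2 * s)).filter fun b => b % (2 * s) = r) =
      B.filter fun b => b % (2 * s) = r := by
    rw [Finset.filter_filter]
    refine Finset.filter_congr fun b _ => and_iff_right_of_imp fun h5 => ?_
    rw [h5]; exact hr.1
  rw [h4, Finset.sum_add_distrib, Finset.sum_const, hB, Nat.choose_succ_succ,
    Nat.choose_one_right, ← hB r, ← sum_card_filter_lt]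
  push_cast
  rw [nsmul_one]
  congr 1
  refine Finset.sum_congr rfl fun b hb => ?_
  rw [(Finset.mem_filter.mp hb).2]

theorem card_range_filter_mod {r : ℕ} (hr : r < 2 * s) :
    ((Finset.range (s * (2 * n + 1))).filter fun a => a % (2 * s) = r).card =
      lowCount s n r := by
  have h1 : ((Finset.range (s * (2 * n + 1))).filter fun a => a % (2 * s) = r) =
      (Finset.range (lowCount s n r)).image fun j => 2 * s * j + r := by
    ext a
    simp only [Finset.mem_filter, Finset.mem_range, Finset.mem_image]
    constructor
    · rintro ⟨ha, rfl⟩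
      refine ⟨a / (2 * s), ?_, Nat.div_add_mod a (2 * s)⟩
      rwa [lt_lowCount_iff hr, Nat.div_add_mod]
    · rintro ⟨j, hj, rfl⟩
      exact ⟨(lt_lowCount_iff hr j).mp hj, by rw [Nat.mul_add_mod, Nat.mod_eq_of_lt hr]⟩
  rw [h1, Finset.card_image_of_injective, Finset.card_range]
  intro i j hij
  have h2 : 0 < 2 * s := by omega
  exact Nat.eq_of_mul_eq_mul_left h2 (Nat.add_right_cancel hij)

/-- The number of entries below `s (2 n + 1)` whose class up to sign is smaller than `k`. -/
def lowerBlocks (s n k : ℕ) : ℕ :=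
  ((Finset.range (s * (2 * n + 1))).filter fun a =>
    min (a % (2 * s)) (2 * s - a % (2 * s)) < k).card

/-- The number of low entries that precede `b` depends only on the residue class of `b`. -/
theorem card_range_filter_blockKey (hs : 0 < s) {b : ℕ} (hb : s * (2 * n + 1) ≤ b) :
    ((Finset.range (s * (2 * n + 1))).filter fun a => blockKey s a < blockKey s b).card =
      lowerBlocks s n (min (b % (2 * s)) (2 * s - b % (2 * s))) +
        if s < b % (2 * s) then 2 * n + 1 else 0 := by
  have hmod : ∀ a, a % (2 * s) < 2 * s := fun a => Nat.mod_lt _ (by omega)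
  have hb' := hmod b
  split_ifs with hsb
  · have h1 : ((Finset.range (s * (2 * n + 1))).filter fun a => blockKey s a < blockKey s b) =
        ((Finset.range (s * (2 * n + 1))).filter fun a =>
          min (a % (2 * s)) (2 * s - a % (2 * s)) < min (b % (2 * s)) (2 * s - b % (2 * s))) ∪
        (((Finset.range (s * (2 * n + 1))).filter fun a => a % (2 * s) = 2 * s - b % (2 * s)) ∪
        ((Finset.range (s * (2 * n + 1))).filter fun a => a % (2 * s) = b % (2 * s))) := by
      rw [← Finset.filter_or, ← Finset.filter_or]
      refine Finset.filter_congr fun a ha => ?_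
      rw [Finset.mem_range] at ha
      have ha' := hmod a
      rw [blockKey_lt ha' hb']
      omega
    rw [h1, Finset.card_union_of_disjoint, Finset.card_union_of_disjoint,
      card_range_filter_mod (by omega), card_range_filter_mod (by omega), lowerBlocks, lowCount,
      if_pos (by omega), lowCount, if_neg (by omega)]
    · omega
    · exact Finset.disjoint_filter.mpr fun a _ h3 h4 => by omega
    · rw [← Finset.filter_or]
      exact Finset.disjoint_filter.mpr fun a _ h3 h4 => by omega
  · rw [lowerBlocks, add_zero]
    congr 1
    refine Finset.filter_congr fun a ha => ?_
    rw [Finset.mem_range] at ha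
    have ha' := hmod a
    rw [blockKey_lt ha' hb']
    omega

end Parity

/-! ### The sign of the sorting permutation -/

section Signs

variable {s n : ℕ} {lam : ℕ → ℕ}

/-- `sigma` sorts the beta-set, so its sign counts the inversions of `classKey` against the
decreasing order. -/
theorem sgn_eq (T m : ℕ) (hlam : Antitone lam) :
    sgn T lam m = (-1) ^ inversions (betaSet lam m) (classKey T) OrderDual.toDual := by
  have hanti := beta_strictAnti (m := m) hlam
  have hmono : StrictMono ((classKey T ∘ beta lam m) ∘ sigma T lam m) :=
    (Tuple.monotone_sort _).strictMono_of_injective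
      (((classKey_injective T).comp hanti.injective).comp (sigma T lam m).injective)
  have huniv : inversions Finset.univ (classKey T ∘ beta lam m) (OrderDual.toDual ∘ beta lam m) =
      inversions Finset.univ id (sigma T lam m) := by
    rw [← Finset.image_univ_of_surjective (sigma T lam m).surjective,
      inversions_image (sigma T lam m).injective, inversions, inversions,
      Finset.image_univ_of_surjective (sigma T lam m).surjective]
    refine congrArg Finset.card (Finset.filter_congr fun ij _ => ?_)
    rw [hmono.lt_iff_lt, Function.comp_apply, Function.comp_apply, Function.comp_apply,
      Function.comp_apply, OrderDual.toDual_lt_toDual, hanti.lt_iff_gt]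
    rfl
  rw [sgn, sign_eq_neg_one_pow, betaSet, inversions_image hanti.injective, huniv]

/-- The order in which the rows are listed in the block decomposition. -/
def blockOrder (s n : ℕ) (x : BlockIndex s n) : ℕ ×ₗ ℕ :=
  toLex (blockClass s n x,
    Sum.elim (fun l : Fin n => (l : ℕ))
      (Sum.elim (fun lr : Fin (2 * n + 1) × Fin (s - 1) => (lr.1 : ℕ))
        fun l : Fin (n + 1) => (l : ℕ)) x)

theorem blockOrder_injective (hs : 0 < s) : Function.Injective (blockOrder s n) := by
  intro x y hxy
  simp only [blockOrder, toLex_inj, Prod.mk.injEq] at hxy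
  obtain ⟨h1, h2⟩ := hxy
  rcases x with l | ⟨l, r⟩ | l <;> rcases y with j | ⟨j, r'⟩ | j <;>
    simp only [blockClass, Sum.elim_inl, Sum.elim_inr] at h1 h2
  · rw [Fin.ext h2]
  · omega
  · omega
  · omega
  · rw [Fin.ext h2, Fin.ext (show (r : ℕ) = r' by omega)]
  · have := r.2; omega
  · omega
  · have := r'.2; omega
  · rw [Fin.ext h2]

theorem rowVal_mod (hs : 0 < s) (c : ℕ → ℕ) (Q : ℕ → ℕ → ℕ) (x : BlockIndex s n) :
    min (rowVal s n c Q x % (2 * s)) (2 * s - rowVal s n c Q x % (2 * s)) =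
      blockClass s n x := by
  rcases x with l | ⟨l, r⟩ | l <;> simp only [rowVal, blockClass, Sum.elim_inl, Sum.elim_inr]
  · rw [Nat.mul_mod_right]; omega
  · have := r.2
    split_ifs
    · rw [Nat.mul_add_mod, Nat.mod_eq_of_lt (by omega)]; omega
    · rw [Nat.mul_add_mod, Nat.mod_eq_of_lt (by omega)]; omega
  · rw [Nat.mul_add_mod, Nat.mod_eq_of_lt (by omega)]; omega

theorem blockKey_of_le {k r : ℕ} (hs : 0 < s) (hr : r ≤ s) :
    blockKey s (2 * s * k + r) = toLex (2 * r, -((2 * s * k + r : ℕ) : ℤ)) := by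
  rw [blockKey, Nat.mul_add_mod, Nat.mod_eq_of_lt (by omega), if_pos hr]

theorem blockKey_of_lt {k r : ℕ} (hr : s < r) (hr' : r < 2 * s) :
    blockKey s (2 * s * k + r) =
      toLex (2 * (2 * s - r) + 1, ((2 * s * k + r : ℕ) : ℤ)) := by
  rw [blockKey, Nat.mul_add_mod, Nat.mod_eq_of_lt hr', if_neg (by omega)]

theorem fst_blockKey_rowVal (hs : 0 < s) (c : ℕ → ℕ) (Q : ℕ → ℕ → ℕ) (x : BlockIndex s n) :
    (ofLex (blockKey s (rowVal s n c Q x))).1 / 2 = blockClass s n x := by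
  rw [← rowVal_mod hs c Q x, blockKey]
  have := Nat.mod_lt (rowVal s n c Q x) (show 0 < 2 * s by omega)
  split_ifs <;> simp only [ofLex_toLex] <;> omega

theorem blockKey_rowVal_lt (hs : 0 < s) {c : ℕ → ℕ} {Q : ℕ → ℕ → ℕ} (hQ : ∀ r, Antitone (Q r))
    (hbal : Balanced s n c) (hc : ∀ r < 2 * s, lowCount s n r ≤ c r) {x y : BlockIndex s n}
    (hxy : blockOrder s n x < blockOrder s n y) :
    blockKey s (rowVal s n c Q x) < blockKey s (rowVal s n c Q y) := by
  have hmul : ∀ {k k' : ℕ}, k < k' → 2 * s * k < 2 * s * k' := fun hk =>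
    Nat.mul_lt_mul_of_pos_left hk (by omega)
  rw [blockOrder, blockOrder, Prod.Lex.toLex_lt_toLex] at hxy
  rcases hxy with hxy | ⟨hxy, hl⟩
  · simp only at hxy
    rw [← fst_blockKey_rowVal hs c Q x, ← fst_blockKey_rowVal hs c Q y] at hxy
    exact Prod.Lex.lt_iff.mpr (.inl (by omega))
  · rcases x with l | ⟨l, r⟩ | l <;> rcases y with j | ⟨j, r'⟩ | j <;>
      simp only [blockClass, Sum.elim_inl, Sum.elim_inr] at hxy hl
    · have h1 := hQ 0 hl.le
      have := j.2
      have h2 := hbal.1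
      have h3 := blockKey_of_le (r := 0) (k := Q 0 l + (c 0 - 1 - l)) hs (by omega)
      have h4 := blockKey_of_le (r := 0) (k := Q 0 j + (c 0 - 1 - j)) hs (by omega)
      rw [add_zero] at h3 h4
      simp only [rowVal, Sum.elim_inl]
      rw [h3, h4, Prod.Lex.toLex_lt_toLex]
      have := hmul (show Q 0 j + (c 0 - 1 - j) < Q 0 l + (c 0 - 1 - l) by omega)
      exact .inr ⟨rfl, by dsimp only; omega⟩
    · omega
    · omega
    · omega
    · obtain rfl : r = r' := Fin.ext (by omega)
      have hr := r.2
      have hj := j.2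
      have h5 := hbal.2.2 (r + 1) (by omega) (by omega)
      have h6 := hc (2 * s - (r + 1)) (by omega)
      have h7 := hc (r + 1) (by omega)
      rw [lowCount, if_neg (by omega)] at h6
      rw [lowCount, if_pos (by omega)] at h7
      simp only [rowVal, Sum.elim_inl, Sum.elim_inr]
      by_cases hjc : (j : ℕ) + (n + 1) < c (r + 1)
      · have h1 := hQ (r + 1) hl.le
        rw [if_pos hjc, if_pos (by omega), blockKey_of_le hs (by omega),
          blockKey_of_le hs (by omega), Prod.Lex.toLex_lt_toLex]
        have := hmul (show Q (r + 1) j + (c (r + 1) - 1 - j) <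
          Q (r + 1) l + (c (r + 1) - 1 - l) by omega)
        exact .inr ⟨rfl, by dsimp only; omega⟩
      · rw [if_neg hjc, blockKey_of_lt (r := 2 * s - (r + 1)) (by omega) (by omega)]
        split_ifs with hlc
        · rw [blockKey_of_le hs (by omega), Prod.Lex.toLex_lt_toLex]
          exact .inl (by dsimp only; omega)
        · have h1 := hQ (2 * s - (r + 1)) (show 2 * n - (j : ℕ) ≤ 2 * n - l by omega)
          rw [blockKey_of_lt (r := 2 * s - (r + 1)) (by omega) (by omega),
            Prod.Lex.toLex_lt_toLex]
          have := hmul (show Q (2 * s - (r + 1)) (2 * n - l) +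
            (c (2 * s - (r + 1)) - 1 - (2 * n - l)) < Q (2 * s - (r + 1)) (2 * n - j) +
            (c (2 * s - (r + 1)) - 1 - (2 * n - j)) by omega)
          exact .inr ⟨rfl, by dsimp only; omega⟩
    · have := r.2; omega
    · omega
    · have := r'.2; omega
    · have h1 := hQ s hl.le
      have := j.2
      have h2 := hbal.2.1
      simp only [rowVal, Sum.elim_inr]
      rw [blockKey_of_le hs le_rfl, blockKey_of_le hs le_rfl, Prod.Lex.toLex_lt_toLex]
      have := hmul (show Q s j + (c s - 1 - j) < Q s l + (c s - 1 - l) by omega)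
      exact .inr ⟨rfl, by dsimp only; omega⟩

theorem image_topVal {c : ℕ → ℕ} {Q : ℕ → ℕ → ℕ} {e : BlockIndex s n ≃ Fin (s * (2 * n + 1))}
    (he : ∀ x, topVal s n lam (e x) = rowVal s n c Q x) :
    Finset.univ.image (topVal s n lam) = Finset.univ.image (rowVal s n c Q) := by
  rw [← Finset.image_univ_of_surjective e.surjective, Finset.image_image]
  exact Finset.image_congr fun x _ => he x

/-- The inversions of the enumeration of the rows, in terms of the beta-set. -/
theorem inversions_blockOrder (hs : 0 < s) (hlam : Antitone lam) {c : ℕ → ℕ} {Q : ℕ → ℕ → ℕ}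
    (hQ : ∀ r, Antitone (Q r)) (hbal : Balanced s n c)
    (hc : ∀ r < 2 * s, lowCount s n r ≤ c r) {e : BlockIndex s n ≃ Fin (s * (2 * n + 1))}
    (he : ∀ x, topVal s n lam (e x) = rowVal s n c Q x) :
    inversions Finset.univ (blockOrder s n) e =
      inversions (Finset.univ.image (topVal s n lam)) (blockKey s) OrderDual.toDual := by
  have hanti := topVal_strictAnti (s := s) (n := n) hlam
  have hinj : Function.Injective (rowVal s n c Q) := fun x y hxy =>
    e.injective (hanti.injective (by rw [he, he, hxy]))
  rw [image_topVal he, inversions_image hinj]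
  have h1 : ∀ x ∈ Finset.univ, ∀ y ∈ Finset.univ, blockOrder s n x < blockOrder s n y ↔
      (blockKey s ∘ rowVal s n c Q) x < (blockKey s ∘ rowVal s n c Q) y := by
    intro x _ y _
    refine ⟨blockKey_rowVal_lt hs hQ hbal hc, fun h1 => ?_⟩
    rcases lt_trichotomy (blockOrder s n x) (blockOrder s n y) with h2 | h2 | h2
    · exact h2
    · rw [blockOrder_injective hs h2] at h1
      exact absurd h1 (lt_irrefl _)
    · exact absurd h1 (blockKey_rowVal_lt hs hQ hbal hc h2).asymm
  rw [inversions_congr h1, inversions, inversions]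
  congr 1
  refine Finset.filter_congr fun xy _ => ?_
  rw [Function.comp_apply, Function.comp_apply (f := OrderDual.toDual),
    Function.comp_apply (f := OrderDual.toDual), OrderDual.toDual_lt_toDual, ← he, ← he,
    hanti.lt_iff_gt]

theorem card_topVal_filter (hlen : ∀ i, s * (2 * n + 1) ≤ i → lam i = 0)
    {r : ℕ} (hr : r < 2 * s) :
    ((Finset.univ.image (topVal s n lam)).filter fun b => b % (2 * s) = r).card +
      lowCount s n r = classCount (2 * s) lam (2 * s * (2 * n + 1)) r := by
  rw [classCount, betaClass, betaSet_eq hlen, Finset.filter_union, Finset.card_union_of_disjoint,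
    card_range_filter_mod hr]
  refine Finset.disjoint_filter_filter (Finset.disjoint_left.mpr fun b hb hb' => ?_)
  obtain ⟨i, -, rfl⟩ := Finset.mem_image.mp hb
  exact (le_topVal i).not_gt (Finset.mem_range.mp hb')

/-- The parity that relates `sigma` to the enumeration of the rows depends on the class counts
only. -/
theorem inversions_parity (hs : 0 < s) (hlam : Antitone lam)
    (hlen : ∀ i, s * (2 * n + 1) ≤ i → lam i = 0)
    (hbal : Balanced s n (classCount (2 * s) lam (2 * s * (2 * n + 1)))) :
    (inversions (betaSet lam (2 * s * (2 * n + 1))) (classKey (2 * s)) OrderDual.toDual : ZMod 2) =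
      inversions (Finset.univ.image (topVal s n lam)) (blockKey s) OrderDual.toDual +
      ∑ r ∈ Finset.Ioo s (2 * s),
        (((classCount (2 * s) lam (2 * s * (2 * n + 1)) r + 1).choose 2 : ZMod 2) +
          (classCount (2 * s) lam (2 * s * (2 * n + 1)) r - n : ℕ)) +
      (inversions (Finset.range (s * (2 * n + 1))) (blockKey s) OrderDual.toDual +
        ∑ x : BlockIndex s n, lowerBlocks s n (blockClass s n x) : ℕ) := by
  obtain ⟨e, he⟩ := exists_rowEquiv hs hlam hlen hbal
  set c := classCount (2 * s) lam (2 * s * (2 * n + 1)) with hcdef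
  set Q := quo (2 * s) lam (2 * s * (2 * n + 1))
  have htwo : (2 : ZMod 2) = 0 := rfl
  have hanti := topVal_strictAnti (s := s) (n := n) hlam
  have hle : ∀ b ∈ Finset.univ.image (topVal s n lam), s * (2 * n + 1) ≤ b := fun b hb => by
    obtain ⟨i, -, rfl⟩ := Finset.mem_image.mp hb
    exact le_topVal i
  have h1 := inversions_cocycle (S := betaSet lam (2 * s * (2 * n + 1)))
    (classKey_injective (2 * s)).injOn (OrderDual.toDual (α := ℕ)).injective.injOn
    (blockKey_injective (s := s)).injOn
  rw [inversions_classKey_blockKey hs (c := c) (fun r => rfl) hbal,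
    inversions_comm _ OrderDual.toDual, betaSet_eq hlen, inversions_union (blockKey s)] at h1
  · have h2 : ∑ b ∈ Finset.univ.image (topVal s n lam),
        ((Finset.range (s * (2 * n + 1))).filter fun a => blockKey s a < blockKey s b).card =
        ∑ x : BlockIndex s n, lowerBlocks s n (blockClass s n x) +
          ∑ r ∈ Finset.Ioo s (2 * s), (c r - n) * (2 * n + 1) := by
      rw [Finset.sum_congr rfl fun b hb => card_range_filter_blockKey hs (hle b hb),
        Finset.sum_add_distrib]
      congr 1
      · rw [image_topVal he, Finset.sum_image]
        · exact Finset.sum_congr rfl fun x _ => by rw [rowVal_mod hs]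
        · intro x _ y _ hxy
          exact e.injective (hanti.injective (by rw [he, he, hxy]))
      · rw [← Finset.sum_filter, ← Finset.sum_fiberwise_of_maps_to (g := fun b => b % (2 * s))
          (t := Finset.Ioo s (2 * s)) (fun b hb => Finset.mem_Ioo.mpr
            ⟨(Finset.mem_filter.mp hb).2, Nat.mod_lt _ (by omega)⟩)]
        refine Finset.sum_congr rfl fun r hr => ?_
        rw [Finset.mem_Ioo] at hr
        have h3 := card_topVal_filter hlen hr.2
        rw [lowCount, if_neg (by omega), ← hcdef] at h3
        rw [Finset.sum_const, smul_eq_mul, Finset.filter_filter, ← h3, Nat.add_sub_cancel]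
        congr 2
        refine Finset.filter_congr fun b _ => and_iff_right_of_imp fun h5 => ?_
        rw [h5]; exact hr.1
    rw [betaSet_eq hlen, h1, h2, Finset.sum_add_distrib, ← Finset.sum_mul]
    push_cast
    linear_combination (n * ∑ r ∈ Finset.Ioo s (2 * s), ((c r - n : ℕ) : ZMod 2)) * htwo
  · exact Finset.disjoint_left.mpr fun b hb hb' =>
      (hle b hb).not_gt (Finset.mem_range.mp hb')
  · intro a ha b hb
    rw [OrderDual.toDual_lt_toDual]
    exact (Finset.mem_range.mp ha).trans_le (hle b hb)

end Signs

/-! ### The empty partition and the vanishing criterion -/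

section Empty

theorem card_range_mul_filter_mod {T : ℕ} (k : ℕ) {r : ℕ} (hr : r < T) :
    ((Finset.range (T * k)).filter fun a => a % T = r).card = k := by
  have h1 : ((Finset.range (T * k)).filter fun a => a % T = r) =
      (Finset.range k).image fun j => T * j + r := by
    ext a
    simp only [Finset.mem_filter, Finset.mem_range, Finset.mem_image]
    constructor
    · rintro ⟨ha, rfl⟩
      exact ⟨a / T, Nat.div_lt_of_lt_mul ha, Nat.div_add_mod a T⟩
    · rintro ⟨j, hj, rfl⟩
      refine ⟨?_, by rw [Nat.mul_add_mod, Nat.mod_eq_of_lt hr]⟩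
      have := Nat.mul_le_mul_left T (Nat.succ_le_of_lt hj)
      rw [Nat.mul_succ] at this
      omega
  rw [h1, Finset.card_image_of_injective, Finset.card_range]
  intro i j hij
  exact Nat.eq_of_mul_eq_mul_left (show 0 < T by omega) (Nat.add_right_cancel hij)

theorem betaSet_zero (m : ℕ) : betaSet (fun _ => 0) m = Finset.range m := by
  ext b
  simp only [betaSet, beta, Finset.mem_image, Finset.mem_univ, true_and, Finset.mem_range, zero_add]
  constructor
  · rintro ⟨i, rfl⟩
    omega
  · intro hb
    exact ⟨⟨m - 1 - b, by omega⟩, by dsimp only; omega⟩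

theorem classCount_zero {T : ℕ} (k : ℕ) {r : ℕ} (hr : r < T) :
    classCount T (fun _ => 0) (T * k) r = k := by
  rw [classCount, betaClass, betaSet_zero, card_range_mul_filter_mod k hr]

theorem quo_zero {T : ℕ} (k : ℕ) {r : ℕ} (hr : r < T) (i : ℕ) :
    quo T (fun _ => 0) (T * k) r i = 0 := by
  refine ofBetaSet_eq_zero (d := k) (fun j hj => ?_) ?_
  · rw [Finset.mem_range] at hj
    rw [Finset.mem_image]
    refine ⟨T * j + r, ?_, by rw [Nat.mul_add_div (by omega), Nat.div_eq_of_lt hr, add_zero]⟩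
    rw [betaClass, Finset.mem_filter, betaSet_zero, Finset.mem_range]
    refine ⟨?_, by rw [Nat.mul_add_mod, Nat.mod_eq_of_lt hr]⟩
    have := Nat.mul_le_mul_left T (Nat.succ_le_of_lt hj)
    rw [Nat.mul_succ] at this
    omega
  · rw [card_quoSet, classCount_zero k hr]
    omega

/-- The inversions of `sigma` for the empty partition. -/
theorem inversions_range_classKey {T : ℕ} (hT : 0 < T) (k : ℕ) :
    inversions (Finset.range (T * k)) (classKey T) OrderDual.toDual =
      T.choose 2 * (k + 1).choose 2 := by
  have h1 : ∀ b ∈ Finset.range (T * k), ((Finset.range (T * k)).filter fun a =>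
      classKey T a < classKey T b ∧ OrderDual.toDual b < OrderDual.toDual a).card =
      (b % T) * (b / T + 1) := by
    intro b hb
    rw [Finset.mem_range] at hb
    have hbT := Nat.mod_lt b hT
    have hbm := Nat.div_add_mod b T
    have h2 : T * (b / T + 1) ≤ T * k :=
      Nat.mul_le_mul_left T (Nat.succ_le_of_lt (Nat.div_lt_of_lt_mul hb))
    have h3 : ((Finset.range (T * k)).filter fun a =>
        classKey T a < classKey T b ∧ OrderDual.toDual b < OrderDual.toDual a) =
        (Finset.range (T * (b / T + 1))).filter fun a => a % T ∈ Finset.range (b % T) := by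
      ext a
      simp only [Finset.mem_filter, Finset.mem_range, classKey_lt, OrderDual.toDual_lt_toDual]
      have ham := Nat.div_add_mod a T
      rw [Nat.mul_succ] at h2 ⊢
      constructor
      · omega
      · rintro ⟨ha, hab⟩
        refine ⟨by omega, .inl hab, ?_⟩
        have h4 : a / T ≤ b / T := by
          rw [← Nat.lt_succ_iff]
          exact Nat.div_lt_of_lt_mul (by rw [Nat.mul_succ]; exact ha)
        have := Nat.mul_le_mul_left T h4
        omega
    rw [h3, Finset.card_eq_sum_card_fiberwise (f := fun a => a % T)
      (s := (Finset.range (T * (b / T + 1))).filter fun a => a % T ∈ Finset.range (b % T))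
      (t := Finset.range (b % T)) (fun a ha => (Finset.mem_filter.mp ha).2)]
    refine (Finset.sum_const_nat (m := b / T + 1) fun r hr => ?_).trans (by rw [Finset.card_range])
    rw [Finset.filter_filter]
    refine Eq.trans (congrArg Finset.card ?_)
      (card_range_mul_filter_mod (b / T + 1) ((Finset.mem_range.mp hr).trans hbT))
    refine Finset.filter_congr fun a _ => and_iff_right_of_imp fun h5 => ?_
    rw [h5]; exact hr
  rw [inversions_eq_sum, Finset.sum_congr rfl h1]
  clear h1
  induction k with
  | zero => simp
  | succ k ih =>
    rw [Nat.mul_succ, Finset.sum_range_add, ih, Nat.choose_succ_succ (k + 1), Nat.choose_one_right,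
      add_comm (k + 1), mul_add, Nat.choose_two_right T, ← Finset.sum_range_id, Finset.sum_mul,
      Finset.sum_mul]
    congr 1
    refine Finset.sum_congr rfl fun r hr => ?_
    rw [Finset.mem_range] at hr
    rw [Nat.mul_add_mod, Nat.mod_eq_of_lt hr, Nat.mul_add_div hT, Nat.div_eq_of_lt hr, add_zero]

end Empty

section Vanishing

variable {s n : ℕ} {lam : ℕ → ℕ}

theorem isOrthogonal_core_iff_balanced (hs : 0 < s) (hlam : Antitone lam) :
    IsOrthogonal (core (2 * s) lam (2 * s * (2 * n + 1))) ↔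
      Balanced s n (classCount (2 * s) lam (2 * s * (2 * n + 1))) := by
  rw [isOrthogonal_core_iff hlam (by omega)]
  constructor
  · rintro ⟨h0, h1⟩
    have h2 := h1 s hs (by omega)
    rw [show 2 * s - s = s by omega] at h2
    exact ⟨h0, by omega, fun r hr hrs => h1 r hr (by omega)⟩
  · exact fun hbal => ⟨hbal.1, fun r hr hrs => hbal.add_eq hr hrs⟩

theorem congrUpToSign_min (hs : 0 < s) (b : ℕ) :
    CongrUpToSign s b (min (b % (2 * s)) (2 * s - b % (2 * s))) := by
  have h1 : (2 * s : ℤ) * (b / (2 * s) : ℕ) + (b % (2 * s) : ℕ) = b := by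
    exact_mod_cast Nat.div_add_mod b (2 * s)
  have h2 := Nat.mod_lt b (show 0 < 2 * s by omega)
  rcases le_total (b % (2 * s)) (2 * s - b % (2 * s)) with h3 | h3
  · rw [min_eq_left h3]
    exact ⟨_, .inl h1.symm⟩
  · rw [min_eq_right h3]
    refine ⟨(b / (2 * s) : ℕ) + 1, .inr ?_⟩
    rw [mul_add, mul_one, Nat.cast_sub h2.le]
    push_cast at h1 ⊢
    linarith

theorem card_filter_min (hs : 0 < s) (S : Finset ℕ) {r : ℕ} (hr : r ≤ s) :
    (S.filter fun b => min (b % (2 * s)) (2 * s - b % (2 * s)) = r).card =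
      (S.filter fun b => b % (2 * s) = r).card +
        if 0 < r ∧ r < s then (S.filter fun b => b % (2 * s) = 2 * s - r).card else 0 := by
  have hmod : ∀ a, a % (2 * s) < 2 * s := fun a => Nat.mod_lt _ (by omega)
  split_ifs with h1
  · rw [← Finset.card_union_of_disjoint, ← Finset.filter_or]
    · congr 1
      refine Finset.filter_congr fun b _ => ?_
      have := hmod b
      omega
    · exact Finset.disjoint_filter.mpr fun b _ h2 h3 => by omega
  · rw [add_zero]
    congr 1
    refine Finset.filter_congr fun b _ => ?_
    have := hmod b
    omega

/-- If the determinant of the Jacobi-Trudi matrix does not vanish, the rows and the columns have the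
same class counts, and this determines the class counts of the beta-set. -/
theorem balanced_of_det_ne_zero {K : Type*} [Field K] (hs : 0 < s) (hlam : Antitone lam)
    (hlen : ∀ i, s * (2 * n + 1) ≤ i → lam i = 0) {hh g : ℤ → K} (hhg : IsSpread s hh g)
    (hdet : (jacobiMatrix s n hh lam).det ≠ 0) :
    Balanced s n (classCount (2 * s) lam (2 * s * (2 * n + 1))) := by
  obtain ⟨σ, hσ⟩ := exists_perm_of_det_ne_zero hhg hdet
  set cl : ℕ → ℕ := fun b => min (b % (2 * s)) (2 * s - b % (2 * s)) with hcl
  have hmod : ∀ a, a % (2 * s) < 2 * s := fun a => Nat.mod_lt _ (by omega)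
  have hcls : ∀ b, cl b ≤ s := fun b => by simp only [hcl]; omega
  have hclass : ∀ i, cl (topVal s n lam (σ i)) = cl (i + 1) := fun i =>
    hσ i _ _ (congrUpToSign_min hs _) (congrUpToSign_min hs _) (hcls _) (hcls _)
  -- The columns are numbered `1, ..., s (2 n + 1)`, so their class counts differ from those of
  -- `0, ..., s (2 n + 1) - 1` only by the two end points.
  have hcount : ∀ r, ((Finset.univ.image (topVal s n lam)).filter fun b => cl b = r).card +
      (if cl 0 = r then 1 else 0) =
      ((Finset.range (s * (2 * n + 1))).filter fun b => cl b = r).card +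
        if cl (s * (2 * n + 1)) = r then 1 else 0 := by
    intro r
    rw [Finset.card_filter, Finset.card_filter,
      ← Finset.sum_range_succ (fun b => if cl b = r then 1 else 0), Finset.sum_range_succ',
      ← Fin.sum_univ_eq_sum_range (fun b => if cl (b + 1) = r then 1 else 0),
      Finset.sum_image ((topVal_strictAnti hlam).injective.injOn), ← Equiv.sum_comp σ]
    simp only [hclass]
  have hN : s * (2 * n + 1) % (2 * s) = s := by
    rw [show s * (2 * n + 1) = 2 * s * n + s by ring, Nat.mul_add_mod, Nat.mod_eq_of_lt (by omega)]
  have hcl0 : cl 0 = 0 := by simp [hcl]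
  have hclN : cl (s * (2 * n + 1)) = s := by simp only [hcl, hN]; omega
  simp only [hcl0, hclN] at hcount
  refine ⟨?_, ?_, fun r hr hrs => ?_⟩
  · have h1 := hcount 0
    have h2 := card_topVal_filter (r := 0) hlen (by omega)
    rw [card_filter_min hs _ (by omega), card_filter_min hs _ (by omega),
      card_range_filter_mod (by omega)] at h1
    simp only [lowCount, lt_self_iff_false, false_and, if_false, if_true, if_pos hs,
      if_neg hs.ne'] at h1 h2
    omega
  · have h1 := hcount s
    have h2 := card_topVal_filter (r := s) hlen (by omega)
    rw [card_filter_min hs _ le_rfl, card_filter_min hs _ le_rfl,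
      card_range_filter_mod (by omega)] at h1
    simp only [lowCount, lt_self_iff_false, and_false, if_false, if_true,
      if_neg hs.ne] at h1 h2
    omega
  · have h1 := hcount r
    have h2 := card_topVal_filter (r := r) hlen (by omega)
    have h3 := card_topVal_filter (r := 2 * s - r) hlen (by omega)
    rw [card_filter_min hs _ hrs.le, card_filter_min hs _ hrs.le,
      card_range_filter_mod (by omega), card_range_filter_mod (by omega),
      if_pos (show 0 < r ∧ r < s from ⟨hr, hrs⟩), if_pos (show 0 < r ∧ r < s from ⟨hr, hrs⟩),
      if_neg (show ¬ 0 = r by omega), if_neg (show ¬ s = r by omega)] at h1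
    have h4 : lowCount s n r = n + 1 := if_pos hrs
    have h5 : lowCount s n (2 * s - r) = n := if_neg (by omega)
    omega

end Vanishing

/-! ### Factorization and its sign -/

section Assembly

variable {s n : ℕ} {lam : ℕ → ℕ} {ω : ℂ}

theorem size_eq_sum {p : ℕ → ℕ} {k : ℕ} (hp : ∀ i, k ≤ i → p i = 0) :
    size p = ∑ i ∈ Finset.range k, p i := by
  refine finsum_eq_sum_of_support_subset _ fun i hi => ?_
  rw [Finset.mem_coe, Finset.mem_range]
  by_contra hc
  exact hi (hp i (not_lt.mp hc))

theorem prod_Icc_eq_prod_fin {M : Type*} [CommMonoid M] (f : ℕ → M) (k : ℕ) :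
    ∏ r ∈ Finset.Icc 1 k, f r = ∏ r : Fin k, f (r + 1) := by
  rw [Fin.prod_univ_eq_prod_range (fun r => f (r + 1)), Finset.range_eq_Ico,
    Finset.prod_Ico_add' f 0 k 1]
  rfl

/-- The coefficients that survive in the generating function of `h (double (Xω (4 * s) n ω))`. -/
noncomputable def spreadCoeff (s n : ℕ) (a : ℤ) : RatFun n :=
  (-1) ^ a * h (recip (Xpow n (2 * s))) a

theorem isSpread_h (hs : 0 < s) (hω : IsPrimitiveRoot ω (4 * s)) :
    IsSpread s (h (double (Xω (4 * s) n ω))) (spreadCoeff s n) := by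
  constructor
  · intro z
    have h1 : (2 * (s : ℤ)) = ((2 * s : ℕ) : ℤ) := by push_cast; rfl
    rw [h_double_twist hs hω, h1, if_pos (dvd_mul_right _ _), Int.mul_ediv_cancel_left _ (by omega),
      spreadCoeff]
  · intro k hk
    rw [h_double_twist hs hω, if_neg hk]

theorem evenOrth_eq_det_jacobiMatrix (lam : ℕ → ℕ) (ω : ℂ) :
    evenOrth lam (Xω (4 * s) n ω) =
      (jacobiMatrix s n (h (double (Xω (4 * s) n ω))) lam).det := by
  have h1 : 4 * s / 2 = 2 * s := by omega
  have h2 : 4 * s / 4 = s := by omega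
  rw [evenOrth_eq_det (k := s * (2 * n + 1)) (by simp [h1, h2]; ring), jacobiMatrix]
  congr 1
  ext i j
  have h3 := two_s_mul s n
  have h4 : ((topVal s n lam i : ℕ) : ℤ) - 2 * s * (2 * n + 1) = (lam i : ℤ) - (i + 1) := by
    have h5 : (2 * s * (2 * n + 1) : ℤ) = ((2 * s * (2 * n + 1) : ℕ) : ℤ) := by push_cast; ring
    rw [h5, topVal]
    omega
  simp only [Matrix.of_apply, jacobiEntry]
  rw [h4]
  push_cast
  rfl

theorem quo_antitone (T m r : ℕ) : Antitone (quo T lam m r) := ofBetaSet_antitone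

/-- The factorization of the character, up to the sign of the block decomposition. -/
theorem evenOrth_eq_sign_mul (hs : 0 < s) (hω : IsPrimitiveRoot ω (4 * s))
    (hlen : ∀ i, s * (2 * n + 1) ≤ i → lam i = 0) {c : ℕ → ℕ} {Q : ℕ → ℕ → ℕ}
    (hcdef : c = classCount (2 * s) lam (2 * s * (2 * n + 1)))
    (hQdef : Q = quo (2 * s) lam (2 * s * (2 * n + 1))) (hbal : Balanced s n c)
    {e ec : BlockIndex s n ≃ Fin (s * (2 * n + 1))}
    (he : ∀ x, topVal s n lam (e x) = rowVal s n c Q x)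
    (hec : ∀ y, (ec y : ℕ) + 1 = colVal s n y) :
    evenOrth lam (Xω (4 * s) n ω) = (Equiv.Perm.sign (ec.symm.trans e) : ℤ) *
      ((-1) ^ size (Q 0) * oddOrth (Q 0) (Xpow n (2 * s)) *
        ((∏ r ∈ Finset.Icc 1 (s - 1),
          ((-1) ^ (n + 1 + (c (2 * s - r) - n) + size (Q r) + size (Q (2 * s - r))) *
            schur (glue (Q r) (Q (2 * s - r)) (2 * n + 1)) (recip (Xpow n (2 * s))))) *
          evenOrth (Q s) (snoc (fun i => -Xpow n (2 * s) i) (-1)))) := by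
  have hc : ∀ r < 2 * s, lowCount s n r ≤ c r := fun r hr => hcdef ▸ lowCount_le hlen hr
  have hQ : ∀ r, Antitone (Q r) := fun r => hQdef ▸ quo_antitone _ _ r
  have hQ0 : ∀ r i, r < 2 * s → c r ≤ i + lowCount s n r → Q r i = 0 := fun r i hr hi => by
    rw [hQdef]; rw [hcdef] at hi; exact quo_eq_zero hlen hr hi
  have hT : 2 * s ≠ 0 := by omega
  rw [evenOrth_eq_det_jacobiMatrix,
    det_jacobiMatrix hs (isSpread_h hs hω) hbal hc he hec]
  congr 2
  · rw [zeroBlock, det_block_zero _ (spreadCoeff s n) fun _ => rfl, size_eq_sum fun i hi => ?_]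
    refine hQ0 0 i (by omega) ?_
    rw [hbal.1, lowCount, if_pos hs]; omega
  · congr 1
    · rw [prod_Icc_eq_prod_fin]
      refine Finset.prod_congr rfl fun r _ => ?_
      have hr := r.2
      have h1 := hc (r + 1) (by omega)
      have h2 := hc (2 * s - (r + 1)) (by omega)
      have h3 := hbal.2.2 (r + 1) (by omega) (by omega)
      have h4 : lowCount s n (r + 1) = n + 1 := if_pos (by omega)
      have h5 : lowCount s n (2 * s - (r + 1)) = n := if_neg (by omega)
      have h6 : ∀ i, c (r + 1) - (n + 1) ≤ i → Q (r + 1) i = 0 := fun i hi =>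
        hQ0 _ _ (by omega) (by omega)
      have h7 : ∀ i, c (2 * s - (r + 1)) - n ≤ i → Q (2 * s - (r + 1)) i = 0 := fun i hi =>
        hQ0 _ _ (by omega) (by omega)
      rw [pairBlock, det_block_pair hT (hQ _) (hQ _) (by omega) h6 h7 (spreadCoeff s n)
          fun _ => rfl,
        size_eq_sum h6, size_eq_sum h7]
    · exact det_block_half _ (spreadCoeff s n) fun _ => rfl

/-- The sign of the block decomposition. It is calibrated at the empty partition, where all the
characters are `1`. -/
theorem sign_rows (hs : 0 < s) (hω : IsPrimitiveRoot ω (4 * s)) (hlam : Antitone lam)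
    (hlen : ∀ i, s * (2 * n + 1) ≤ i → lam i = 0) {c : ℕ → ℕ} {Q : ℕ → ℕ → ℕ}
    (hcdef : c = classCount (2 * s) lam (2 * s * (2 * n + 1)))
    (hQdef : Q = quo (2 * s) lam (2 * s * (2 * n + 1))) (hbal : Balanced s n c)
    {e ec : BlockIndex s n ≃ Fin (s * (2 * n + 1))}
    (he : ∀ x, topVal s n lam (e x) = rowVal s n c Q x)
    (hec : ∀ y, (ec y : ℕ) + 1 = colVal s n y) :
    ((Equiv.Perm.sign (ec.symm.trans e) : ℤˣ) : ℤ) = sgn (2 * s) lam (2 * s * (2 * n + 1)) *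
      (-1) ^ (∑ r ∈ Finset.Ioo s (2 * s), ((c r + 1).choose 2 + (c r - n)) + s * (n + 1)) := by
  have hQ : ∀ r, Antitone (Q r) := fun r => hQdef ▸ quo_antitone _ _ r
  have hc : ∀ r < 2 * s, lowCount s n r ≤ c r := fun r hr => hcdef ▸ lowCount_le hlen hr
  -- the same data for the empty partition
  set c₀ := classCount (2 * s) (fun _ => 0) (2 * s * (2 * n + 1)) with hc₀def
  set Q₀ := quo (2 * s) (fun _ => 0) (2 * s * (2 * n + 1)) with hQ₀def
  have hanti₀ : Antitone (fun _ : ℕ => 0) := antitone_const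
  have hlen₀ : ∀ i, s * (2 * n + 1) ≤ i → (fun _ : ℕ => 0) i = 0 := fun _ _ => rfl
  have hc₀ : ∀ r < 2 * s, c₀ r = 2 * n + 1 := fun r hr => classCount_zero _ hr
  have hQ₀ : ∀ r < 2 * s, ∀ i, Q₀ r i = 0 := fun r hr i => quo_zero _ hr i
  have hbal₀ : Balanced s n c₀ := ⟨hc₀ _ (by omega), hc₀ _ (by omega), fun r hr hrs => by
    rw [hc₀ _ (by omega), hc₀ _ (by omega)]; ring⟩
  obtain ⟨e₀, he₀⟩ := exists_rowEquiv hs hanti₀ hlen₀ hbal₀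
  have hsize₀ : ∀ r < 2 * s, size (Q₀ r) = 0 := fun r hr => by
    rw [size_eq_sum (k := 0) fun i _ => hQ₀ r hr i]; rfl
  have h1 : ((Equiv.Perm.sign (ec.symm.trans e₀) : ℤˣ) : ℤ) = 1 := by
    have h2 := evenOrth_eq_sign_mul hs hω hlen₀ hc₀def hQ₀def hbal₀ he₀ hec
    rw [evenOrth_eq_one fun _ => rfl, hsize₀ 0 (by omega), oddOrth_eq_one (hQ₀ 0 (by omega)),
      evenOrth_eq_one (hQ₀ s (by omega)), Finset.prod_eq_one] at h2
    · simp only [pow_zero, mul_one] at h2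
      exact_mod_cast h2.symm
    · intro r hr
      rw [Finset.mem_Icc] at hr
      have h3 := hQ₀ r (by omega)
      have h4 := hQ₀ (2 * s - r) (by omega)
      rw [hsize₀ r (by omega), hsize₀ _ (by omega), hc₀ _ (by omega), schur_eq_one, mul_one]
      · rw [show n + 1 + (2 * n + 1 - n) + 0 + 0 = 2 * (n + 1) by omega]
        simp
      · intro i
        simp [glue, h3, h4]
  -- the rows are compared with the columns through the rows of the empty partition
  have h2 : ec.symm.trans e = (ec.symm.trans e₀).trans (e₀.symm.trans e) := by
    ext i; simp
  rw [h2, Equiv.Perm.sign_trans, Units.val_mul, h1, mul_one,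
    sign_symm_trans e₀ e (blockOrder_injective hs), sgn_eq _ _ hlam, ← pow_add,
    inversions_blockOrder hs hlam hQ hbal hc he,
    inversions_blockOrder hs hanti₀ (fun r => quo_antitone _ _ r) hbal₀
      (fun r hr => lowCount_le hlen₀ hr) he₀]
  -- the two applications of the parity formula share the constant that is not computed
  have p1 := inversions_parity hs hlam hlen (hcdef ▸ hbal)
  have p2 := inversions_parity hs hanti₀ hlen₀ hbal₀
  have p3 := inversions_range_classKey (show 0 < 2 * s by omega) (2 * n + 1)
  rw [← hcdef] at p1
  rw [← hc₀def, betaSet_zero, p3] at p2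
  set A := inversions (betaSet lam (2 * s * (2 * n + 1))) (classKey (2 * s)) OrderDual.toDual
  set A' := inversions (Finset.univ.image (topVal s n lam)) (blockKey s) OrderDual.toDual
  set A₀ := inversions (Finset.univ.image (topVal s n fun _ => 0)) (blockKey s) OrderDual.toDual
  have htwo : (2 : ZMod 2) = 0 := rfl
  have hchoose : ((2 * s).choose 2 : ZMod 2) = s * (2 * s - 1) := by
    have h3 : (2 * s).choose 2 = s * (2 * s - 1) := by
      rw [Nat.choose_two_right, mul_assoc, Nat.mul_div_cancel_left _ (by omega)]
    rw [h3, Nat.cast_mul, Nat.cast_sub (by omega)]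
    push_cast; rfl
  have hchoose' : ((2 * n + 1 + 1).choose 2 : ZMod 2) = (n + 1) * (2 * n + 1) := by
    have h3 : (2 * n + 1 + 1).choose 2 = (n + 1) * (2 * n + 1) := by
      rw [Nat.choose_two_right, Nat.add_sub_cancel, show 2 * n + 1 + 1 = 2 * (n + 1) by ring,
        mul_assoc, Nat.mul_div_cancel_left _ (by omega)]
    rw [h3]; push_cast; rfl
  have p4 : ∑ r ∈ Finset.Ioo s (2 * s), (((c₀ r + 1).choose 2 : ZMod 2) + (c₀ r - n : ℕ)) = 0 := by
    refine Finset.sum_eq_zero fun r hr => ?_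
    rw [hc₀ r (Finset.mem_Ioo.mp hr).2, hchoose', show 2 * n + 1 - n = n + 1 by omega]
    push_cast
    linear_combination ((n + 1) * (n + 1) : ZMod 2) * htwo
  have hS : ∑ r ∈ Finset.Ioo s (2 * s), (((c r + 1).choose 2 : ZMod 2) + (c r - n : ℕ)) =
      ((∑ r ∈ Finset.Ioo s (2 * s), ((c r + 1).choose 2 + (c r - n)) : ℕ) : ZMod 2) := by
    push_cast; rfl
  have key : ((A₀ + A' : ℕ) : ZMod 2) = ((A + (∑ r ∈ Finset.Ioo s (2 * s),
      ((c r + 1).choose 2 + (c r - n)) + s * (n + 1)) : ℕ) : ZMod 2) := by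
    rw [hS] at p1
    rw [p4, Nat.cast_mul, hchoose, hchoose'] at p2
    set S := ∑ r ∈ Finset.Ioo s (2 * s), ((c r + 1).choose 2 + (c r - n))
    set X := inversions (Finset.range (s * (2 * n + 1))) (blockKey s) OrderDual.toDual +
      ∑ x : BlockIndex s n, lowerBlocks s n (blockClass s n x)
    simp only [Nat.cast_add, Nat.cast_mul, Nat.cast_one]
    linear_combination -p1 - p2 +
      (s * (n + 1) * (2 * s * n + s - n - 1) - X - S : ZMod 2) * htwo
  rw [ZMod.natCast_eq_natCast_iff] at key
  rw [neg_one_pow_eq_pow_mod_two, key, ← neg_one_pow_eq_pow_mod_two]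

end Assembly

/-! ### The theorem -/

section Conclusion

variable {s n : ℕ} {lam : ℕ → ℕ} {ω : ℂ}

/-- The parts of the quotient beyond its possible length. The entries of the beta-set below
`s (2 n + 1)` contribute nothing to the quotient. -/
theorem quo_eq_zero_of_balanced (hs : 0 < s) (hlen : ∀ i, s * (2 * n + 1) ≤ i → lam i = 0)
    {c : ℕ → ℕ} {Q : ℕ → ℕ → ℕ} (hcdef : c = classCount (2 * s) lam (2 * s * (2 * n + 1)))
    (hQdef : Q = quo (2 * s) lam (2 * s * (2 * n + 1))) (hbal : Balanced s n c) :
    (∀ i, n ≤ i → Q 0 i = 0) ∧ (∀ i, n + 1 ≤ i → Q s i = 0) ∧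
      ∀ r, 1 ≤ r → r < s → (c r - (n + 1)) + (c (2 * s - r) - n) = 2 * n + 1 ∧
        (∀ i, c r - (n + 1) ≤ i → Q r i = 0) ∧
        ∀ i, c (2 * s - r) - n ≤ i → Q (2 * s - r) i = 0 := by
  have hc : ∀ r < 2 * s, lowCount s n r ≤ c r := fun r hr => hcdef ▸ lowCount_le hlen hr
  have hQ0 : ∀ r i, r < 2 * s → c r ≤ i + lowCount s n r → Q r i = 0 := fun r i hr hi => by
    rw [hQdef]; rw [hcdef] at hi; exact quo_eq_zero hlen hr hi
  refine ⟨fun i hi => hQ0 0 i (by omega) ?_, fun i hi => hQ0 s i (by omega) ?_, fun r hr hrs => ?_⟩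
  · rw [hbal.1, lowCount, if_pos hs]; omega
  · rw [hbal.2.1, lowCount, if_neg (lt_irrefl s)]; omega
  · have h1 := hc r (by omega)
    have h2 := hc (2 * s - r) (by omega)
    have h3 := hbal.2.2 r hr hrs
    have h4 : lowCount s n r = n + 1 := if_pos hrs
    have h5 : lowCount s n (2 * s - r) = n := if_neg (by omega)
    exact ⟨by omega, fun i hi => hQ0 _ _ (by omega) (by omega),
      fun i hi => hQ0 _ _ (by omega) (by omega)⟩

theorem evenOrth_ne_zero (hs : 0 < s) (hω : IsPrimitiveRoot ω (4 * s)) (hlam : Antitone lam)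
    (hlen : ∀ i, s * (2 * n + 1) ≤ i → lam i = 0)
    (hbal : Balanced s n (classCount (2 * s) lam (2 * s * (2 * n + 1)))) :
    evenOrth lam (Xω (4 * s) n ω) ≠ 0 := by
  have hT : 2 * s ≠ 0 := by omega
  obtain ⟨e, he⟩ := exists_rowEquiv hs hlam hlen hbal
  obtain ⟨ec, hec⟩ := exists_colEquiv (n := n) hs
  obtain ⟨-, -, hpair⟩ := quo_eq_zero_of_balanced hs hlen rfl rfl hbal
  have hpow : ∀ k : ℕ, (-1 : RatFun n) ^ k ≠ 0 := fun k => pow_ne_zero _ (by simp)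
  rw [evenOrth_eq_sign_mul hs hω hlen rfl rfl hbal he hec]
  refine mul_ne_zero (by simp) (mul_ne_zero (mul_ne_zero (hpow _)
    (oddOrth_ne_zero hT (quo_antitone _ _ _))) (mul_ne_zero
      (Finset.prod_ne_zero_iff.mpr fun r hr => mul_ne_zero (hpow _) ?_) ?_))
  · rw [Finset.mem_Icc] at hr
    obtain ⟨h1, h2, h3⟩ := hpair r (by omega) (by omega)
    exact (det_mixed hT (quo_antitone _ _ _) (quo_antitone _ _ _) h1 h2 h3).2
  · rw [← det_block_half _ (spreadCoeff s n) fun _ => rfl]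
    exact det_block_half_ne_zero hT (quo_antitone _ _ _) _ fun _ => rfl

/-- The factorization of the character, with its sign in terms of `sigma`. -/
theorem evenOrth_factorization (hs : 0 < s) (hω : IsPrimitiveRoot ω (4 * s)) (hlam : Antitone lam)
    (hlen : ∀ i, s * (2 * n + 1) ≤ i → lam i = 0) {c : ℕ → ℕ} {Q : ℕ → ℕ → ℕ}
    (hcdef : c = classCount (2 * s) lam (2 * s * (2 * n + 1)))
    (hQdef : Q = quo (2 * s) lam (2 * s * (2 * n + 1))) (hbal : Balanced s n c) :
    evenOrth lam (Xω (4 * s) n ω) =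
      (-1) ^ ((∑ i ∈ Finset.Icc (s + 1) (2 * s - 1), (c i + 1).choose 2)
          + (n + 1) + size (Q 0)
          + ∑ i ∈ Finset.Icc 1 (s - 1), (size (Q i) + size (Q (2 * s - i))))
        * (sgn (2 * s) lam (2 * s * (2 * n + 1)) : RatFun n)
        * oddOrth (Q 0) (Xpow n (2 * s))
        * evenOrth (Q s) (snoc (fun i => -Xpow n (2 * s) i) (-1))
        * ∏ i ∈ Finset.Icc 1 (s - 1), schur (glue (Q i) (Q (2 * s - i)) (2 * n + 1))
            (snoc (double (Xpow n (2 * s))) 1) := by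
  obtain ⟨e, he⟩ := exists_rowEquiv hs hlam hlen (hcdef ▸ hbal)
  obtain ⟨ec, hec⟩ := exists_colEquiv (n := n) hs
  rw [← hcdef, ← hQdef] at he
  rw [evenOrth_eq_sign_mul hs hω hlen hcdef hQdef hbal he hec,
    sign_rows hs hω hlam hlen hcdef hQdef hbal he hec, Finset.prod_mul_distrib,
    Finset.prod_pow_eq_pow_sum]
  have h1 : Finset.Ioo s (2 * s) = Finset.Icc (s + 1) (2 * s - 1) := by
    ext r; simp only [Finset.mem_Ioo, Finset.mem_Icc]; omega
  have h2 : ∑ r ∈ Finset.Icc (s + 1) (2 * s - 1), (c r - n) =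
      ∑ r ∈ Finset.Icc 1 (s - 1), (c (2 * s - r) - n) := by
    refine Finset.sum_nbij' (fun r => 2 * s - r) (fun r => 2 * s - r) ?_ ?_ ?_ ?_ ?_ <;>
      intro r hr <;> simp only [Finset.mem_Icc] at hr ⊢
    · omega
    · omega
    · omega
    · omega
    · rw [Nat.sub_sub_self (by omega)]
  rw [h1, Finset.sum_add_distrib, h2]
  simp only [Finset.sum_add_distrib, Finset.sum_const, Nat.card_Icc, smul_eq_mul,
    Nat.add_sub_cancel, recip]
  generalize ∑ r ∈ Finset.Icc (s + 1) (2 * s - 1), (c r + 1).choose 2 = A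
  generalize ∑ r ∈ Finset.Icc 1 (s - 1), (c (2 * s - r) - n) = B
  generalize ∑ r ∈ Finset.Icc 1 (s - 1), size (Q r) = C
  generalize ∑ r ∈ Finset.Icc 1 (s - 1), size (Q (2 * s - r)) = D
  have h3 : (-1 : RatFun n) ^ (A + B + s * (n + 1)) * ((-1) ^ size (Q 0) *
      (-1) ^ ((s - 1) * n + (s - 1) + B + C + D)) =
      (-1) ^ (A + (n + 1) + size (Q 0) + (C + D)) := by
    obtain ⟨k, rfl⟩ := Nat.exists_eq_succ_of_ne_zero hs.ne'
    rw [← pow_add, ← pow_add, show A + B + (k + 1) * (n + 1) + (size (Q 0) +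
      ((k + 1 - 1) * n + (k + 1 - 1) + B + C + D)) =
      A + (n + 1) + size (Q 0) + (C + D) + 2 * (B + k * (n + 1)) by
        rw [Nat.add_sub_cancel]; ring]
    rw [pow_add _ _ (2 * _), pow_mul]
    simp
  rw [← h3]
  push_cast
  ring

end Conclusion
end TwistedChar

theorem mainTheorem2 (t n : ℕ) (ht : 0 < t) (h4 : 4 ∣ t) (ω : ℂ) (hω : IsPrimitiveRoot ω t)
    (lam : ℕ → ℕ) (hlam : IsPartition lam) (hlen : TwistedChar.length lam ≤ t * n / 2 + t / 4) :
    (evenOrth lam (Xω t n ω) ≠ 0 ↔ IsOrthogonal (core (t / 2) lam (t * n + t / 2))) ∧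
    (IsOrthogonal (core (t / 2) lam (t * n + t / 2)) →
      ∀ q : ℕ → ℕ → ℕ, q = quo (t / 2) lam (t * n + t / 2) →
      ∀ c : ℕ → ℕ, c = classCount (t / 2) lam (t * n + t / 2) →
        TwistedChar.length (q 0) ≤ n ∧
        TwistedChar.length (q (t / 4)) ≤ n + 1 ∧
        (∀ i ∈ Finset.Icc 1 (t / 4 - 1),
          TwistedChar.length (q i) + TwistedChar.length (q (t / 2 - i)) ≤ 2 * n + 1) ∧
        evenOrth lam (Xω t n ω) =
          (-1) ^ ((∑ i ∈ Finset.Icc (t / 4 + 1) (t / 2 - 1), (c i + 1).choose 2)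
              + (n + 1) + size (q 0)
              + ∑ i ∈ Finset.Icc 1 (t / 4 - 1), (size (q i) + size (q (t / 2 - i))))
            * (sgn (t / 2) lam (t * n + t / 2) : RatFun n)
            * oddOrth (q 0) (Xpow n (t / 2))
            * evenOrth (q (t / 4)) (snoc (fun i => -Xpow n (t / 2) i) (-1))
            * ∏ i ∈ Finset.Icc 1 (t / 4 - 1),
                schur (glue (q i) (q (t / 2 - i)) (2 * n + 1))
                  (snoc (double (Xpow n (t / 2))) 1)) := by
  obtain ⟨s, rfl⟩ := h4
  have hs : 0 < s := by omega
  have e1 : 4 * s / 2 = 2 * s := by omega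
  have e2 : 4 * s / 4 = s := by omega
  have e3 : 4 * s * n / 2 = 2 * s * n := by
    rw [show 4 * s * n = 2 * (2 * s * n) by ring, Nat.mul_div_cancel_left _ (by omega)]
  have e4 : 4 * s * n + 2 * s = 2 * s * (2 * n + 1) := by ring
  have e5 : 2 * s * n + s = s * (2 * n + 1) := by ring
  rw [e3, e2, e5, length_le_iff hlam] at hlen
  -- the index type of the variables depends on `4 * s / 2` and `4 * s / 4` as well
  generalize hE : evenOrth lam (Xω (4 * s) n ω) = E
  rw [e1, e2, e4, isOrthogonal_core_iff_balanced hs hlam.1]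
  subst hE
  refine ⟨⟨fun hne => ?_, evenOrth_ne_zero hs hω hlam.1 hlen⟩, ?_⟩
  · rw [evenOrth_eq_det_jacobiMatrix] at hne
    exact balanced_of_det_ne_zero hs hlam.1 hlen (isSpread_h hs hω) hne
  · rintro hbal q hq c hc
    rw [← hc] at hbal
    obtain ⟨h0, h1, h2⟩ := quo_eq_zero_of_balanced hs hlen hc hq hbal
    have hpart : ∀ r, IsPartition (q r) := fun r => by rw [hq]; exact ofBetaSet_isPartition
    refine ⟨(length_le_iff (hpart _) _).mpr h0, (length_le_iff (hpart _) _).mpr h1,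
      fun i hi => ?_, evenOrth_factorization hs hω hlam.1 hlen hc hq hbal⟩
    rw [Finset.mem_Icc] at hi
    obtain ⟨h3, h4, h5⟩ := h2 i (by omega) (by omega)
    have h6 := (length_le_iff (hpart i) _).mpr h4
    have h7 := (length_le_iff (hpart (2 * s - i)) _).mpr h5
    omega
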